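/- **Setting.** A continuous language $\mathscr L$ has a set of sorts, function symbols $f:S_1\times\dots\times S_n\to S$ and relation symbols $R\subseteq S_1\times\dots\times S_n$ ($n\ge 0$). Terms are built as usual; formulas are built from the atomic formulas $R(t_1,\dots,t_n)$ using all continuous functions $[0,1]^n\to[0,1]$ as connectives and the quantifiers $\forall=\sup$, $\exists=\inf$. A structure $\mathcal M$ assigns to each sort a *nonempty* set, to each function symbol a function, and to each relation symbol a $[0,1]$-valued function. A sentence holds in $\mathcal M$ if its value is $0$; a theory is a set of sentences, and $T\models\sigma$ means that $\sigma$ holds in every structure satisfying $T$. A *metric theory* $(\mathscr L,T)$ is a theory with a formula $d_S(x,y)$ for every sort $S$ such that in all structures satisfying $T$ every $d_S$ is a pseudo-metric and, with moduli that depend only on $T$, all function and relation symbols are uniformly continuous with respect to the $d_S$. A *model* of $(\mathscr L,T)$ is a structure satisfying $T$ in which every $d_S$ is a complete metric. $\mathrm{Mod}(\mathscr L,T)$ is the category of models, with elementary maps (families of functions, one for every sort, that commute with the function symbols and preserve the values of all formulas) as morphisms. On tuples we use $d(\bar x,\bar y)=\max_i d(x_i,y_i)$. A formula $A(\bar x)$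 is a *definable set* of $T$ if $T\models\forall_{\bar x}\exists_{\bar y}\max\{A(\bar y),|A(\bar x)-d(\bar x,\bar y)|\}$ and $T\models\forall_{\bar x}|A(\bar x)-\exists_{\bar y}(A(\bar y)+d(\bar x,\bar y))|$ (sums are truncated at $1$). **The expansion.** Let $(\mathscr L^{\rm eq},T^{\rm eq})$ be the smallest expansion of $(\mathscr L,T)$ that is closed under the following four constructions. Every new sort $S$ has a metric symbol $d_S$, and $T^{\rm eq}$ contains the sentences saying that $d_S$ is a pseudo-metric. 1. *Countable products.* For every sequence $(S_i)_{i\ge 1}$ of sorts of $\mathscr L^{\rm eq}$ there are a sort $S$ and function symbols $\pi_i:S\to S_i$, with axioms, for all $n$: $\forall_{x_1}\cdots\forall_{x_n}\exists_{y\in S}\max_{i\le n}d_{S_i}(\pi_i(y),x_i)$, and $\forall_{x,y\in S}$ $\bigl|d_S(x,y)-\sum_{i=1}^n 2^{-i}d_{S_i}(\pi_i(x),\pi_i(y))\bigr|\le 2^{-n}$. 2. *Definable sets.* For every formula $A(x_1,\dots,x_n)$ of $\mathscr L^{\rm eq}$ that is a definable set of $T^{\rm eq}$ there are a sort $S_A$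 and function symbols $f_i$ from $S_A$ to the sort of $x_i$, with axioms $\forall_{\bar x}|A(\bar x)-\exists_{y\in S_A}\max_i d(x_i,f_i(y))|$ and $\forall_{x,y\in S_A}|d_{S_A}(x,y)-\max_i d(f_i(x),f_i(y))|$. 3. *Canonical parameters.* For every formula $\varphi(\bar x,\bar y)$ of $\mathscr L^{\rm eq}$ there are a sort $S_\varphi$ and a function symbol $\pi_\varphi$ from the sorts of $\bar y$ to $S_\varphi$, with axioms $\forall_{\bar y,\bar y'}\bigl|d_{S_\varphi}(\pi_\varphi(\bar y),\pi_\varphi(\bar y'))-\forall_{\bar x}|\varphi(\bar x,\bar y)-\varphi(\bar x,\bar y')|\bigr|$ and $\forall_{z\in S_\varphi}\exists_{\bar y}d_{S_\varphi}(\pi_\varphi(\bar y),z)$. 4. *Finite unions.* For all formulas $\varphi_1(\bar x,\bar y_1),\dots,\varphi_n(\bar x,\bar y_n)$ of $\mathscr L^{\rm eq}$, $n\ge1$, there are a sort $S$ and function symbols $i_j:S_{\varphi_j}\to S$, with axioms $\forall_{x\in S}\min_{j}\exists_{y\in S_{\varphi_j}}d_S(x,i_j(y))$ and, for all $j,k\le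 n$, $\forall_{y\in S_{\varphi_j}}\forall_{z\in S_{\varphi_k}}\bigl|d_S(i_j(y),i_k(z))-\forall_{\bar x}|\varphi_j(\bar x,y)-\varphi_k(\bar x,z)|\bigr|$. Here $\varphi_j(\bar x,y)$, for $y$ of sort $S_{\varphi_j}$, is the extension by continuity of $\varphi_j(\bar x,\pi_{\varphi_j}(\bar y)):=\varphi_j(\bar x,\bar y)$, that is, $\exists_{\bar y}\bigl(\varphi_j(\bar x,\bar y)+d_{S_{\varphi_j}}(\pi_{\varphi_j}(\bar y),y)\bigr)$. **Theorem.** If $(\mathscr L,T)$ is a metric theory, then the forgetful functor $$F:\mathrm{Mod}(\mathscr L^{\rm eq},T^{\rm eq})\to\mathrm{Mod}(\mathscr L,T),$$ taking reducts to $\mathscr L$, is an equivalence of categories; i.e. $T^{\rm eq}$ is a conservative expansion of $T$. -/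

import Mathlib

open CategoryTheory

universe u v w

noncomputable section

namespace ContLogic

/-! ### Typed variables

A context is a list of sorts. `Var Γ s` is the type of positions of the list `Γ` carrying the
sort `s`; a tuple of elements matching `Γ` is a function on `Var Γ`. -/

inductive Var {α : Type u} : List α → α → Type u
  | zero {a : α} {Γ : List α} : Var (a :: Γ) a
  | succ {a b : α} {Γ : List α} : Var Γ a → Var (b :: Γ) a

namespace Var

variable {α : Type u} {β : Type v}

/-- The position of a variable, as a number. -/
def idx {a : α} : {Γ : List α} → Var Γ a → ℕ
  | _, zero => 0
  | _, succ x => x.idx + 1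

/-- All positions of a context, in order. -/
def all : (Γ : List α) → List (Σ a, Var Γ a)
  | [] => []
  | a :: Γ => ⟨a, zero⟩ :: (all Γ).map fun p => ⟨p.1, succ p.2⟩

/-- The tuple for the empty context. -/
def nil {X : α → Type w} : ∀ a, Var ([] : List α) a → X a :=
  fun _ x => nomatch x

/-- Put an element in front of a tuple. -/
def cons {X : α → Type w} {b : α} {Γ : List α} (x : X b) (e : ∀ a, Var Γ a → X a) :
    ∀ a, Var (b :: Γ) a → X a
  | _, zero => x
  | _, succ v => e _ v

/-- The tuple `(x, y)`. -/
def pair {X : α → Type w} {a b : α} (x : X a) (y : X b) : ∀ c, Var [a, b] c → X c :=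
  cons x (cons y nil)

/-- The tuple `(x)`. -/
def single {X : α → Type w} {a : α} (x : X a) : ∀ c, Var [a] c → X c :=
  cons x nil

def inl {a : α} : {Γ Δ : List α} → Var Γ a → Var (Γ ++ Δ) a
  | _, _, zero => zero
  | _, _, succ x => succ (inl x)

def inr {a : α} : (Γ : List α) → {Δ : List α} → Var Δ a → Var (Γ ++ Δ) a
  | [], _, x => x
  | _ :: Γ, _, x => succ (inr Γ x)

/-- Concatenation of two tuples. -/
def append {X : α → Type w} : {Γ Δ : List α} → (∀ a, Var Γ a → X a) → (∀ a, Var Δ a → X a) →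
    ∀ a, Var (Γ ++ Δ) a → X a
  | [], _, _, e₂ => e₂
  | _ :: _, _, e₁, e₂ =>
      cons (e₁ _ zero) (append (fun a x => e₁ a (succ x)) e₂)

def map (f : α → β) {a : α} : {Γ : List α} → Var Γ a → Var (Γ.map f) (f a)
  | _, zero => zero
  | _, succ x => succ (map f x)

/-- A tuple indexed by `Γ`, read as a tuple indexed by the image of `Γ` under `f`. -/
def mapElim (f : α → β) {X : β → Type w} : (Γ : List α) → (∀ a, Var Γ a → X (f a)) →
    ∀ b, Var (Γ.map f) b → X b
  | [], _ => nil
  | _ :: Γ, e => cons (e _ zero) (mapElim f Γ fun a x => e a (succ x))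

end Var

/-! ### Languages, terms, formulas -/

/-- A many-sorted continuous language; function symbols are indexed by the list of the sorts of
their arguments and their target sort, relation symbols by the list of the sorts of their
arguments. -/
structure Language where
  Sorts : Type u
  Func : List Sorts → Sorts → Type u
  Rel : List Sorts → Type u

/-- Terms of sort `s` with free variables in the context `Γ`. -/
inductive Term (L : Language.{u}) (Γ : List L.Sorts) : L.Sorts → Type u
  | var {s : L.Sorts} (x : Var Γ s) : Term L Γ s
  | app {Δ : List L.Sorts} {s : L.Sorts} (f : L.Func Δ s)
      (ts : ∀ t, Var Δ t → Term L Γ t) : Term L Γ s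

/-- Formulas with free variables in the context `Γ`. The connectives are all continuous functions
`[0,1]ⁿ → [0,1]`; the quantifiers `all` and `ex` bind the first variable of the context. -/
inductive Formula (L : Language.{u}) : List L.Sorts → Type u
  | rel {Γ Δ : List L.Sorts} (R : L.Rel Δ) (ts : ∀ s, Var Δ s → Term L Γ s) : Formula L Γ
  | conn {Γ : List L.Sorts} (n : ℕ) (c : C(Fin n → unitInterval, unitInterval))
      (φ : Fin n → Formula L Γ) : Formula L Γ
  | all {Γ : List L.Sorts} (s : L.Sorts) (φ : Formula L (s :: Γ)) : Formula L Γ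
  | ex {Γ : List L.Sorts} (s : L.Sorts) (φ : Formula L (s :: Γ)) : Formula L Γ

abbrev Sentence (L : Language.{u}) : Type u := Formula L []

namespace Term

variable {L : Language.{u}} {Γ Δ : List L.Sorts}

/-- Simultaneous substitution of terms for variables. -/
def subst (σ : ∀ s, Var Γ s → Term L Δ s) : {s : L.Sorts} → Term L Γ s → Term L Δ s
  | _, var x => σ _ x
  | _, app f ts => app f fun t x => (ts t x).subst σ

/-- Add an unused variable in front of the context. -/
def weaken {b s : L.Sorts} (t : Term L Γ s) : Term L (b :: Γ) s :=
  t.subst fun _ x => var x.succ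

end Term

namespace Formula

variable {L : Language.{u}}

/-- Simultaneous (capture-avoiding) substitution of terms for variables. -/
def subst : {Γ Δ : List L.Sorts} → (∀ s, Var Γ s → Term L Δ s) → Formula L Γ → Formula L Δ
  | _, _, σ, rel R ts => rel R fun s x => (ts s x).subst σ
  | _, _, σ, conn n c φ => conn n c fun i => (φ i).subst σ
  | _, _, σ, all s φ =>
      all s (φ.subst (Var.cons (X := Term L (s :: _)) (.var .zero) fun _ x => (σ _ x).weaken))
  | _, _, σ, ex s φ =>
      ex s (φ.subst (Var.cons (X := Term L (s :: _)) (.var .zero) fun _ x => (σ _ x).weaken))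

/-- Quantification `∀_x` over the tuple `x` of the first variables. -/
def allBlock {Δ : List L.Sorts} : (Γ : List L.Sorts) → Formula L (Γ ++ Δ) → Formula L Δ
  | [], φ => φ
  | s :: Γ, φ => allBlock Γ (all s φ)

/-- Quantification `∃_x` over the tuple `x` of the first variables. -/
def exBlock {Δ : List L.Sorts} : (Γ : List L.Sorts) → Formula L (Γ ++ Δ) → Formula L Δ
  | [], φ => φ
  | s :: Γ, φ => exBlock Γ (ex s φ)

/-- Universal closure. -/
def close : {Γ : List L.Sorts} → Formula L Γ → Sentence L
  | [], φ => φ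
  | s :: _, φ => close (all s φ)

end Formula

/-- The connective given by a continuous real function, truncated to `[0,1]`. -/
def Connective.ofReal {n : ℕ} (f : (Fin n → unitInterval) → ℝ) (hf : Continuous f) :
    C(Fin n → unitInterval, unitInterval) :=
  ⟨fun a => Set.projIcc 0 1 zero_le_one (f a), continuous_projIcc.comp hf⟩

namespace Formula

variable {L : Language.{u}} {Γ Δ : List L.Sorts}

/-- The constant `r`, truncated to `[0,1]`. -/
def const (r : ℝ) : Formula L Γ :=
  conn 0 (Connective.ofReal (fun _ => r) continuous_const) Fin.elim0

/-- `max φ ψ`, the conjunction. -/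
def max (φ ψ : Formula L Γ) : Formula L Γ :=
  conn 2 (Connective.ofReal (fun a => Max.max (a 0 : ℝ) (a 1)) (by fun_prop)) ![φ, ψ]

/-- `min φ ψ`, the disjunction. -/
def min (φ ψ : Formula L Γ) : Formula L Γ :=
  conn 2 (Connective.ofReal (fun a => Min.min (a 0 : ℝ) (a 1)) (by fun_prop)) ![φ, ψ]

/-- `|φ - ψ|`. -/
def absDiff (φ ψ : Formula L Γ) : Formula L Γ :=
  conn 2 (Connective.ofReal (fun a => |(a 0 : ℝ) - a 1|) (by fun_prop)) ![φ, ψ]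

/-- Truncated subtraction `max (φ - ψ) 0`. -/
def tsub (φ ψ : Formula L Γ) : Formula L Γ :=
  conn 2 (Connective.ofReal (fun a => (a 0 : ℝ) - a 1) (by fun_prop)) ![φ, ψ]

/-- Truncated addition `min (φ + ψ) 1`. -/
def plus (φ ψ : Formula L Γ) : Formula L Γ :=
  conn 2 (Connective.ofReal (fun a => (a 0 : ℝ) + a 1) (by fun_prop)) ![φ, ψ]

/-- `∑_{i < n} φ_i / 2^(i+1)`. -/
def weightedSum {n : ℕ} (φ : Fin n → Formula L Γ) : Formula L Γ :=
  conn n (Connective.ofReal (fun a => ∑ i, (a i : ℝ) / 2 ^ ((i : ℕ) + 1)) (by fun_prop)) φ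

/-- Minimum of finitely many formulas (`1` for the empty family). -/
def minList : List (Formula L Γ) → Formula L Γ
  | [] => const 1
  | φ :: l => min φ (minList l)

/-- Maximum of finitely many formulas indexed by the positions of a list (`0` if it is empty). -/
def maxVars {α : Type v} : (l : List α) → (∀ a, Var l a → Formula L Γ) → Formula L Γ
  | [], _ => const 0
  | _ :: l, F => max (F _ .zero) (maxVars l fun a x => F a x.succ)

/-- `d_s(t, t')` for a family `d` of formulas in two variables of the same sort. -/
def distTerm (d : ∀ s, Formula L [s, s]) {s : L.Sorts} (t t' : Term L Γ s) : Formula L Γ :=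
  (d s).subst (Var.pair (X := Term L Γ) t t')

/-- The maximum of the `d(t_i, t'_i)`, for two tuples of terms. -/
def distTuple (d : ∀ s, Formula L [s, s]) (σ τ : ∀ s, Var Δ s → Term L Γ s) : Formula L Γ :=
  maxVars Δ fun s x => distTerm d (σ s x) (τ s x)

end Formula

/-! ### Structures -/

/-- A `[0,1]`-valued structure, with nonempty sorts. -/
structure Struc (L : Language.{u}) where
  carrier : L.Sorts → Type u
  nonempty : ∀ s, Nonempty (carrier s)
  fn : ∀ {Γ : List L.Sorts} {s : L.Sorts}, L.Func Γ s → (∀ t, Var Γ t → carrier t) → carrier s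
  rel : ∀ {Γ : List L.Sorts}, L.Rel Γ → (∀ t, Var Γ t → carrier t) → unitInterval

/-- Tuples of elements of `M` of the sorts listed in `Γ`. -/
abbrev Struc.Tuple {L : Language.{u}} (M : Struc L) (Γ : List L.Sorts) : Type u :=
  ∀ s, Var Γ s → M.carrier s

def Term.realize {L : Language.{u}} (M : Struc L) {Γ : List L.Sorts} (e : M.Tuple Γ) :
    {s : L.Sorts} → Term L Γ s → M.carrier s
  | _, .var x => e _ x
  | _, .app f ts => M.fn f fun t x => (ts t x).realize M e

/-- The value of a formula; `all` is a supremum and `ex` an infimum in `[0,1]`. -/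
def Formula.realize {L : Language.{u}} (M : Struc L) :
    {Γ : List L.Sorts} → Formula L Γ → M.Tuple Γ → unitInterval
  | _, .rel R ts, e => M.rel R fun s x => (ts s x).realize M e
  | _, .conn _ c φ, e => c fun i => (φ i).realize M e
  | _, .all s φ, e => ⨆ a : M.carrier s, φ.realize M (Var.cons (X := M.carrier) a e)
  | _, .ex s φ, e => ⨅ a : M.carrier s, φ.realize M (Var.cons (X := M.carrier) a e)

/-- Truth of a sentence is value `0`. -/
def Struc.Sat {L : Language.{u}} (M : Struc L) (σ : Sentence L) : Prop :=
  σ.realize M Var.nil = 0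

/-! ### Metric theories and their models -/

/-- A language, a set of sentences, and a formula `d_s(x, y)` for every sort `s`. -/
structure Theory where
  L : Language.{u}
  axm : Set (Sentence L)
  d : ∀ s, Formula L [s, s]

namespace Theory

/-- `M` satisfies all sentences of the theory. -/
def Holds (P : Theory.{u}) (M : Struc P.L) : Prop := ∀ σ ∈ P.axm, M.Sat σ

/-- `P ⊨ σ`. -/
def Entails (P : Theory.{u}) (σ : Sentence P.L) : Prop := ∀ M : Struc P.L, P.Holds M → M.Sat σ

/-- The value of the formula `d_s` in `M`. -/
def dist (P : Theory.{u}) (M : Struc P.L) {s : P.L.Sorts} (a b : M.carrier s) : ℝ :=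
  (P.d s).realize M (Var.pair (X := M.carrier) a b)

/-- A metric theory: every `d_s` is a pseudo-metric for the theory, and the theory provides moduli
of uniform continuity for all function and relation symbols. -/
structure IsMetric (P : Theory.{u}) : Prop where
  dist_self : ∀ M, P.Holds M → ∀ s (a : M.carrier s), P.dist M a a = 0
  dist_comm : ∀ M, P.Holds M → ∀ s (a b : M.carrier s), P.dist M a b = P.dist M b a
  dist_triangle : ∀ M, P.Holds M → ∀ s (a b c : M.carrier s),
    P.dist M a c ≤ P.dist M a b + P.dist M b c
  uc_func : ∀ {Γ : List P.L.Sorts} {s : P.L.Sorts} (f : P.L.Func Γ s) (ε : ℝ), 0 < ε →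
    ∃ δ : ∀ t, Var Γ t → ℝ, (∀ t x, 0 < δ t x) ∧
      ∀ M, P.Holds M → ∀ e e' : M.Tuple Γ, (∀ t x, P.dist M (e t x) (e' t x) < δ t x) →
        P.dist M (M.fn f e) (M.fn f e') ≤ ε
  uc_rel : ∀ {Γ : List P.L.Sorts} (R : P.L.Rel Γ) (ε : ℝ), 0 < ε →
    ∃ δ : ∀ t, Var Γ t → ℝ, (∀ t x, 0 < δ t x) ∧
      ∀ M, P.Holds M → ∀ e e' : M.Tuple Γ, (∀ t x, P.dist M (e t x) (e' t x) < δ t x) →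
        |(M.rel R e : ℝ) - M.rel R e'| ≤ ε

end Theory

/-- `d` is the distance function of a complete metric space. -/
def IsCompleteMetric {X : Type u} (d : X → X → ℝ) : Prop :=
  ∃ m : MetricSpace X, (∀ a b, m.dist a b = d a b) ∧
    @CompleteSpace X m.toPseudoMetricSpace.toUniformSpace

/-- The models of a metric theory: structures satisfying the theory in which every `d_s` is a
complete metric. -/
structure Mod (P : Theory.{u}) where
  str : Struc P.L
  holds : P.Holds str
  complete : ∀ s, IsCompleteMetric fun a b : str.carrier s => P.dist str a b

/-- Elementary maps: sort-preserving families of functions which commute with the function symbols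
and preserve the values of all formulas (in particular of all relation symbols). -/
@[ext]
structure ElemMap {L : Language.{u}} (M N : Struc L) where
  toFun : ∀ s, M.carrier s → N.carrier s
  map_fn : ∀ {Γ : List L.Sorts} {s : L.Sorts} (f : L.Func Γ s) (e : M.Tuple Γ),
    toFun s (M.fn f e) = N.fn f fun t x => toFun t (e t x)
  map_formula : ∀ {Γ : List L.Sorts} (φ : Formula L Γ) (e : M.Tuple Γ),
    φ.realize N (fun t x => toFun t (e t x)) = φ.realize M e

/-- The category of models, with elementary maps as morphisms. -/
instance (P : Theory.{u}) : Category (Mod P) where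
  Hom M N := ElemMap M.str N.str
  id M := ⟨fun _ a => a, fun _ _ => rfl, fun _ _ => rfl⟩
  comp g h := ⟨fun s a => h.toFun s (g.toFun s a),
    fun f e => by rw [g.map_fn, h.map_fn],
    fun φ e => by rw [h.map_formula φ (fun t x => g.toFun t (e t x)), g.map_formula]⟩

/-! ### Definable sets -/

/-- `A(x)` is a definable set of the theory: the theory proves
`∀x ∃y max (A(y), |A(x) - d(x,y)|)` and `∀x |A(x) - ∃y (A(y) + d(x,y))|`, where `d` is the maximum
metric on tuples. -/
def Theory.IsDefinableSet (P : Theory.{u}) {Γ : List P.L.Sorts} (A : Formula P.L Γ) : Prop :=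
  let y : ∀ s, Var Γ s → Term P.L (Γ ++ Γ) s := fun _ v => .var v.inl
  let x : ∀ s, Var Γ s → Term P.L (Γ ++ Γ) s := fun _ v => .var (v.inr Γ)
  P.Entails (Formula.close (Formula.exBlock Γ
    (.max (A.subst y) (.absDiff (A.subst x) (.distTuple P.d x y))))) ∧
  P.Entails (Formula.close (.absDiff A (Formula.exBlock Γ
    (.plus (A.subst y) (.distTuple P.d x y)))))

/-! ### Morphisms of languages and reducts -/

structure LHom (L : Language.{u}) (L' : Language.{u}) where
  onSort : L.Sorts → L'.Sorts
  onFunc : ∀ {Γ : List L.Sorts} {s : L.Sorts}, L.Func Γ s → L'.Func (Γ.map onSort) (onSort s)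
  onRel : ∀ {Γ : List L.Sorts}, L.Rel Γ → L'.Rel (Γ.map onSort)

def Term.map {L L' : Language.{u}} (h : LHom L L') {Γ : List L.Sorts} :
    {s : L.Sorts} → Term L Γ s → Term L' (Γ.map h.onSort) (h.onSort s)
  | _, .var x => .var (x.map h.onSort)
  | _, .app (Δ := Δ) f ts =>
      .app (h.onFunc f) (Var.mapElim h.onSort (X := Term L' (Γ.map h.onSort)) Δ
        fun t x => (ts t x).map h)

def Formula.map {L L' : Language.{u}} (h : LHom L L') :
    {Γ : List L.Sorts} → Formula L Γ → Formula L' (Γ.map h.onSort)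
  | Γ, .rel (Δ := Δ) R ts =>
      .rel (h.onRel R) (Var.mapElim h.onSort (X := Term L' (Γ.map h.onSort)) Δ
        fun t x => (ts t x).map h)
  | _, .conn n c φ => .conn n c fun i => (φ i).map h
  | _, .all s φ => .all (h.onSort s) (φ.map h)
  | _, .ex s φ => .ex (h.onSort s) (φ.map h)

def Struc.reduct {L L' : Language.{u}} (h : LHom L L') (M : Struc L') : Struc L where
  carrier s := M.carrier (h.onSort s)
  nonempty s := M.nonempty (h.onSort s)
  fn {Γ _} f e := M.fn (h.onFunc f) (Var.mapElim h.onSort (X := M.carrier) Γ e)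
  rel {Γ} R e := M.rel (h.onRel R) (Var.mapElim h.onSort (X := M.carrier) Γ e)

theorem Var.apply_mapElim {α : Type u} {β : Type v} (f : α → β) {X : β → Type w} {Y : β → Type w}
    (g : ∀ b, X b → Y b) : (Γ : List α) → (e : ∀ a, Var Γ a → X (f a)) →
    ∀ b (x : Var (Γ.map f) b),
      g b (Var.mapElim f (X := X) Γ e b x) = Var.mapElim f (X := Y) Γ (fun a y => g _ (e a y)) b x
  | _ :: _, _, _, .zero => rfl
  | _ :: Γ, e, b, .succ x => Var.apply_mapElim f g Γ (fun a y => e a y.succ) b x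

theorem Var.mapElim_map {α : Type u} {β : Type v} (f : α → β) {X : β → Type w} :
    (Γ : List α) → (e : ∀ a, Var Γ a → X (f a)) → ∀ a (x : Var Γ a),
      Var.mapElim f (X := X) Γ e _ (x.map f) = e a x
  | _ :: _, _, _, .zero => rfl
  | _ :: Γ, e, a, .succ x => Var.mapElim_map f Γ (fun a y => e a y.succ) a x

theorem Term.realize_map {L L' : Language.{u}} (h : LHom L L') (M : Struc L') {Γ : List L.Sorts}
    {s : L.Sorts} (t : Term L Γ s) (e : M.Tuple (Γ.map h.onSort)) :
    (t.map h).realize M e = t.realize (M.reduct h) (fun _ x => e _ (x.map h.onSort)) := by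
  induction t with
  | var x => rfl
  | app f ts ih =>
    simp only [Term.map, Term.realize, Struc.reduct]
    congr 1
    funext b x
    rw [Var.apply_mapElim h.onSort (Y := M.carrier) (fun b t => Term.realize M e t)]
    congr 1
    funext a y
    exact ih a y

theorem Formula.realize_map {L L' : Language.{u}} (h : LHom L L') (M : Struc L') {Γ : List L.Sorts}
    (φ : Formula L Γ) (e : M.Tuple (Γ.map h.onSort)) :
    (φ.map h).realize M e = φ.realize (M.reduct h) (fun _ x => e _ (x.map h.onSort)) := by
  induction φ with
  | rel R ts =>
    simp only [Formula.map, Formula.realize, Struc.reduct]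
    congr 1
    funext b x
    rw [Var.apply_mapElim h.onSort (Y := M.carrier) (fun b t => Term.realize M e t)]
    congr 1
    funext a y
    exact Term.realize_map h M _ _
  | conn n c φ ih =>
    simp only [Formula.map, Formula.realize]
    congr 1
    funext i
    exact ih i e
  | all s φ ih =>
    simp only [Formula.map, Formula.realize]
    refine iSup_congr fun a => ?_
    rw [ih]
    congr 1
    funext t x
    cases x <;> rfl
  | ex s φ ih =>
    simp only [Formula.map, Formula.realize]
    refine iInf_congr fun a => ?_
    rw [ih]
    congr 1
    funext t x
    cases x <;> rfl

/-! ### The imaginary sorts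

The sorts of the expansion are built from formulas that themselves mention such sorts. So we first
take a large set of *names*, which only record how a sort or a formula is written down (a formula
name is the plain syntax tree of a formula); which names do denote a sort is decided below. -/

mutual

/-- Names of sorts: sorts of `L`, countable products, definable sets `A(x)`, sorts of canonical
parameters of `φ(x, y)`, and unions of the sorts of canonical parameters of `φ_j(x, y_j)`, `j ≤ n`;
here `Γ` lists the sorts of `x`, and `Δ`, `Δ j` those of `y`, `y_j`. -/
inductive Name (L : Language.{u}) : Type u
  | base (s : L.Sorts) : Name L
  | prod (S : ℕ → Name L) : Name L
  | defset (Γ : List (Name L)) (A : FormulaName L) : Name L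
  | canon (Γ Δ : List (Name L)) (φ : FormulaName L) : Name L
  | union (Γ : List (Name L)) (n : ℕ) (Δ : Fin (n + 1) → List (Name L))
      (φ : Fin (n + 1) → FormulaName L) : Name L

/-- Syntax trees of terms; `newFn S i` is the `i`-th function symbol that comes with the sort `S`. -/
inductive TermName (L : Language.{u}) : Type u
  | var (i : ℕ) : TermName L
  | baseFn {Γ : List L.Sorts} {s : L.Sorts} (f : L.Func Γ s) (ts : List (TermName L)) : TermName L
  | newFn (S : Name L) (i : ℕ) (ts : List (TermName L)) : TermName L

/-- Syntax trees of formulas; `newDist S` is the metric symbol that comes with the sort `S`. -/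
inductive FormulaName (L : Language.{u}) : Type u
  | baseRel {Γ : List L.Sorts} (R : L.Rel Γ) (ts : List (TermName L)) : FormulaName L
  | newDist (S : Name L) (ts : List (TermName L)) : FormulaName L
  | conn (n : ℕ) (c : C(Fin n → unitInterval, unitInterval)) (φ : Fin n → FormulaName L) :
      FormulaName L
  | all (S : Name L) (φ : FormulaName L) : FormulaName L
  | ex (S : Name L) (φ : FormulaName L) : FormulaName L

end

/-- The name is not that of a sort of `L`. -/
def Name.IsNew {L : Language.{u}} : Name L → Prop
  | .base _ => False
  | _ => True

/-- A set of names of sorts containing all sorts of `L`. -/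
structure NameSet (L : Language.{u}) where
  carrier : Set (Name L)
  base_mem : ∀ s, Name.base s ∈ carrier

namespace NameSet

variable {L : Language.{u}} (V : NameSet L)

abbrev Srt : Type u := {S : Name L // S ∈ V.carrier}

def base (s : L.Sorts) : V.Srt := ⟨.base s, V.base_mem s⟩

variable {V} in
/-- The names of the sorts in a context. -/
abbrev names (Γ : List V.Srt) : List (Name L) := Γ.map Subtype.val

theorem names_map_base (Γ : List L.Sorts) : names (Γ.map V.base) = Γ.map Name.base := by
  rw [names, List.map_map]
  rfl

/-- The function symbols over `V`: those of `L`; the projections `π_n` of a product; the coordinate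
functions of a definable set; the quotient map `π_φ` to a sort of canonical parameters; and the
inclusions of the sorts of canonical parameters in their union. -/
inductive EqFunc : List V.Srt → V.Srt → Type u
  | base {Γ : List L.Sorts} {s : L.Sorts} (f : L.Func Γ s) {Δ : List V.Srt} {S : V.Srt}
      (hΔ : names Δ = Γ.map Name.base) (hS : S.1 = Name.base s) : EqFunc Δ S
  | proj {S : V.Srt} (F : ℕ → V.Srt) (h : S.1 = Name.prod fun n => (F n).1) (n : ℕ) :
      EqFunc [S] (F n)
  | incl {S : V.Srt} (Γ : List V.Srt) (A : FormulaName L) (h : S.1 = Name.defset (names Γ) A)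
      {s : V.Srt} (i : Var Γ s) : EqFunc [S] s
  | quot {S : V.Srt} (Γ Δ : List V.Srt) (φ : FormulaName L)
      (h : S.1 = Name.canon (names Γ) (names Δ) φ) : EqFunc Δ S
  | inj {S C : V.Srt} (Γ : List V.Srt) (n : ℕ) (Δ : Fin (n + 1) → List V.Srt)
      (φ : Fin (n + 1) → FormulaName L)
      (h : S.1 = Name.union (names Γ) n (fun j => names (Δ j)) φ) (j : Fin (n + 1))
      (hC : C.1 = Name.canon (names Γ) (names (Δ j)) (φ j)) : EqFunc [C] S

/-- The relation symbols over `V`: those of `L`, and a metric symbol for every new sort. -/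
inductive EqRel : List V.Srt → Type u
  | base {Γ : List L.Sorts} (R : L.Rel Γ) {Δ : List V.Srt} (hΔ : names Δ = Γ.map Name.base) :
      EqRel Δ
  | dist (S : V.Srt) (h : S.1.IsNew) : EqRel [S, S]

/-- The expansion of `L` by the sorts in `V`. -/
abbrev lang : Language.{u} := ⟨V.Srt, V.EqFunc, V.EqRel⟩

/-- The inclusion of `L` in its expansion. -/
abbrev baseHom : LHom L V.lang where
  onSort := V.base
  onFunc f := .base f (V.names_map_base _) rfl
  onRel R := .base R (V.names_map_base _)

end NameSet

/-- The syntax tree of a term. -/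
def Term.erase {L : Language.{u}} {V : NameSet L} {Γ : List V.Srt} :
    {s : V.Srt} → Term V.lang Γ s → TermName L
  | _, .var x => .var x.idx
  | _, .app (Δ := Δ) f ts =>
      let args := (Var.all Δ).map fun p => (ts p.1 p.2).erase
      match f with
      | .base f _ _ => .baseFn f args
      | .proj F _ n => .newFn (.prod fun n => (F n).1) n args
      | .incl Γ A _ i => .newFn (.defset (NameSet.names Γ) A) i.idx args
      | .quot Γ Δ φ _ => .newFn (.canon (NameSet.names Γ) (NameSet.names Δ) φ) 0 args
      | .inj Γ n Δ φ _ j _ =>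
          .newFn (.union (NameSet.names Γ) n (fun j => NameSet.names (Δ j)) φ) j args

/-- The syntax tree of a formula. -/
def Formula.erase {L : Language.{u}} {V : NameSet L} :
    {Γ : List V.Srt} → Formula V.lang Γ → FormulaName L
  | _, .rel (Δ := Δ) R ts =>
      let args := (Var.all Δ).map fun p => (ts p.1 p.2).erase
      match R with
      | .base R _ => .baseRel R args
      | .dist S _ => .newDist S.1 args
  | _, .conn n c φ => .conn n c fun i => (φ i).erase
  | _, .all S φ => .all S.1 φ.erase
  | _, .ex S φ => .ex S.1 φ.erase

namespace Theory

open NameSet Formula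

variable (P : Theory.{u}) (V : NameSet P.L)

/-- The metrics of the expansion. -/
def eqDist : ∀ S : V.Srt, Formula V.lang [S, S]
  | ⟨.base s, _⟩ => (P.d s).map V.baseHom
  | ⟨.prod S, h⟩ => .rel (L := V.lang) (EqRel.dist ⟨.prod S, h⟩ trivial) fun _ x => .var x
  | ⟨.defset Γ A, h⟩ => .rel (L := V.lang) (EqRel.dist ⟨.defset Γ A, h⟩ trivial) fun _ x => .var x
  | ⟨.canon Γ Δ φ, h⟩ =>
      .rel (L := V.lang) (EqRel.dist ⟨.canon Γ Δ φ, h⟩ trivial) fun _ x => .var x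
  | ⟨.union Γ n Δ φ, h⟩ =>
      .rel (L := V.lang) (EqRel.dist ⟨.union Γ n Δ φ, h⟩ trivial) fun _ x => .var x

variable {P V}

/-- The term `f(t)`, for a unary function symbol. -/
def app1 {Γ : List V.Srt} {S S' : V.Srt} (f : V.EqFunc [S] S') (t : Term V.lang Γ S) :
    Term V.lang Γ S' :=
  .app (L := V.lang) f (Var.single (X := Term V.lang Γ) t)

/-- The term `π_φ(t)`, for a tuple `t` of terms matching `Δ`. -/
def quotTerm {Θ : List V.Srt} (Γ Δ : List V.Srt) (φ : Formula V.lang (Γ ++ Δ)) {C : V.Srt}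
    (hC : C.1 = Name.canon (names Γ) (names Δ) φ.erase)
    (t : ∀ s, Var Δ s → Term V.lang Θ s) : Term V.lang Θ C :=
  .app (L := V.lang) (EqFunc.quot Γ Δ φ.erase hC) t

variable (P) in
/-- The formula `φ(x, z)` with `z` of the sort `C` of canonical parameters of `φ(x, y)`, as a formula
in `x` and the variables `Θ`, where `z` is a term over `Θ`. Its value is `φ(x, y)` if `z = π_φ(y)`;
in general it is the unique extension by continuity, `∃_y (φ(x, y) + d(π_φ(y), z))`. -/
def paramFormula {Θ : List V.Srt} (Γ Δ : List V.Srt) (φ : Formula V.lang (Γ ++ Δ)) {C : V.Srt}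
    (hC : C.1 = Name.canon (names Γ) (names Δ) φ.erase) (z : Term V.lang Θ C) :
    Formula V.lang (Γ ++ Θ) :=
  exBlock (L := V.lang) Δ (.plus
    (φ.subst (Var.append (X := Term V.lang (Δ ++ (Γ ++ Θ)))
      (fun _ x => .var ((x.inl).inr Δ)) (fun _ y => .var y.inl)))
    (distTerm (P.eqDist V)
      (quotTerm Γ Δ φ hC fun _ y => .var y.inl)
      (z.subst fun _ x => .var ((x.inr Γ).inr Δ))))

variable (P V)

/-- The axioms of the expansion by the sorts in `V`. -/
inductive EqAxiom : Sentence V.lang → Prop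
  /-- the axioms of the given theory -/
  | base (σ : Sentence P.L) (h : σ ∈ P.axm) : EqAxiom (σ.map V.baseHom)
  /-- every metric symbol is a pseudo-metric -/
  | dist_self (S : V.Srt) :
      EqAxiom (close (Γ := [S]) (distTerm (P.eqDist V) (.var .zero) (.var .zero)))
  | dist_comm (S : V.Srt) :
      EqAxiom (close (Γ := [S, S]) (absDiff
        (distTerm (P.eqDist V) (.var .zero) (.var (.succ .zero)))
        (distTerm (P.eqDist V) (.var (.succ .zero)) (.var .zero))))
  | dist_triangle (S : V.Srt) :
      EqAxiom (close (Γ := [S, S, S]) (tsub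
        (distTerm (P.eqDist V) (.var .zero) (.var (.succ (.succ .zero))))
        (plus
          (distTerm (P.eqDist V) (.var .zero) (.var (.succ .zero)))
          (distTerm (P.eqDist V) (.var (.succ .zero)) (.var (.succ (.succ .zero)))))))
  /-- products: `∀ x_0 … x_{n-1} ∃ y max_{i < n} d(π_i(y), x_i)` -/
  | prod_dense (S : V.Srt) (F : ℕ → V.Srt) (h : S.1 = Name.prod fun n => (F n).1) (n : ℕ) :
      EqAxiom (close (Γ := (List.range n).map F) (.ex (L := V.lang) S
        (maxVars (List.range n) fun i x =>
          distTerm (P.eqDist V)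
            (app1 (EqFunc.proj F h i) (.var .zero))
            (.var (.succ (x.map F))))))
  /-- products: `∀ x y (|d(x, y) - ∑_{i < n} d(π_i(x), π_i(y)) / 2^(i+1)| - 1 / 2^n)` -/
  | prod_dist (S : V.Srt) (F : ℕ → V.Srt) (h : S.1 = Name.prod fun n => (F n).1) (n : ℕ) :
      EqAxiom (close (Γ := [S, S]) (tsub
        (absDiff
          (distTerm (P.eqDist V) (.var .zero) (.var (.succ .zero)))
          (weightedSum fun i : Fin n =>
            distTerm (P.eqDist V)
              (app1 (EqFunc.proj F h i) (.var .zero))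
              (app1 (EqFunc.proj F h i) (.var (.succ .zero)))))
        (const (1 / 2 ^ n))))
  /-- definable sets: `∀ x |A(x) - ∃ y max_i d(x_i, f_i(y))|` -/
  | defset_image (S : V.Srt) (Γ : List V.Srt) (A : Formula V.lang Γ)
      (h : S.1 = Name.defset (names Γ) A.erase) :
      EqAxiom (close (absDiff A (.ex (L := V.lang) S
        (distTuple (L := V.lang) (Δ := Γ) (P.eqDist V)
          (fun _ x => .var x.succ)
          (fun _ x => app1 (EqFunc.incl Γ A.erase h x) (.var .zero))))))
  /-- definable sets: `∀ x y |d(x, y) - max_i d(f_i(x), f_i(y))|` -/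
  | defset_dist (S : V.Srt) (Γ : List V.Srt) (A : Formula V.lang Γ)
      (h : S.1 = Name.defset (names Γ) A.erase) :
      EqAxiom (close (Γ := [S, S]) (absDiff
        (distTerm (P.eqDist V) (.var .zero) (.var (.succ .zero)))
        (distTuple (L := V.lang) (Δ := Γ) (P.eqDist V)
          (fun _ x => app1 (EqFunc.incl Γ A.erase h x) (.var .zero))
          (fun _ x => app1 (EqFunc.incl Γ A.erase h x) (.var (.succ .zero))))))
  /-- canonical parameters: `∀ y y' |d(π_φ(y), π_φ(y')) - ∀ x |φ(x, y) - φ(x, y')||` -/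
  | canon_dist (C : V.Srt) (Γ Δ : List V.Srt) (φ : Formula V.lang (Γ ++ Δ))
      (h : C.1 = Name.canon (names Γ) (names Δ) φ.erase) :
      EqAxiom (close (Γ := Δ ++ Δ) (absDiff
        (distTerm (P.eqDist V)
          (quotTerm Γ Δ φ h fun _ y => .var y.inl)
          (quotTerm Γ Δ φ h fun _ y => .var (y.inr Δ)))
        (allBlock (L := V.lang) Γ (absDiff
          (φ.subst (Var.append (X := Term V.lang (Γ ++ (Δ ++ Δ)))
            (fun _ x => .var x.inl) (fun _ y => .var ((y.inl).inr Γ))))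
          (φ.subst (Var.append (X := Term V.lang (Γ ++ (Δ ++ Δ)))
            (fun _ x => .var x.inl) (fun _ y => .var ((y.inr Δ).inr Γ))))))))
  /-- canonical parameters: `∀ z ∃ y d(π_φ(y), z)` -/
  | canon_dense (C : V.Srt) (Γ Δ : List V.Srt) (φ : Formula V.lang (Γ ++ Δ))
      (h : C.1 = Name.canon (names Γ) (names Δ) φ.erase) :
      EqAxiom (close (Γ := [C]) (exBlock (L := V.lang) Δ
        (distTerm (P.eqDist V)
          (quotTerm Γ Δ φ h fun _ y => .var y.inl)
          (.var (Var.zero.inr Δ)))))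
  /-- unions: `∀ x min_j ∃ y d(x, i_j(y))` -/
  | union_cover (S : V.Srt) (Γ : List V.Srt) (n : ℕ) (Δ : Fin (n + 1) → List V.Srt)
      (φ : ∀ j, Formula V.lang (Γ ++ Δ j))
      (h : S.1 = Name.union (names Γ) n (fun j => names (Δ j)) (fun j => (φ j).erase))
      (C : Fin (n + 1) → V.Srt)
      (hC : ∀ j, (C j).1 = Name.canon (names Γ) (names (Δ j)) (φ j).erase) :
      EqAxiom (close (Γ := [S]) (minList (List.ofFn fun j : Fin (n + 1) =>
        .ex (L := V.lang) (C j) (distTerm (P.eqDist V)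
          (.var (.succ .zero))
          (app1 (EqFunc.inj Γ n Δ (fun j => (φ j).erase) h j (hC j)) (.var .zero))))))
  /-- unions: `∀ y z |d(i_j(y), i_k(z)) - ∀ x |φ_j(x, y) - φ_k(x, z)||` -/
  | union_dist (S : V.Srt) (Γ : List V.Srt) (n : ℕ) (Δ : Fin (n + 1) → List V.Srt)
      (φ : ∀ j, Formula V.lang (Γ ++ Δ j))
      (h : S.1 = Name.union (names Γ) n (fun j => names (Δ j)) (fun j => (φ j).erase))
      (C : Fin (n + 1) → V.Srt)
      (hC : ∀ j, (C j).1 = Name.canon (names Γ) (names (Δ j)) (φ j).erase)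
      (j k : Fin (n + 1)) :
      EqAxiom (close (Γ := [C j, C k]) (absDiff
        (distTerm (P.eqDist V)
          (app1 (EqFunc.inj Γ n Δ (fun j => (φ j).erase) h j (hC j)) (.var .zero))
          (app1 (EqFunc.inj Γ n Δ (fun j => (φ j).erase) h k (hC k)) (.var (.succ .zero))))
        (allBlock (L := V.lang) Γ (absDiff
          (paramFormula P Γ (Δ j) (φ j) (hC j) (.var .zero))
          (paramFormula P Γ (Δ k) (φ k) (hC k) (.var (.succ .zero)))))))

/-- The expansion of `P` by the sorts in `V`, with all their axioms. -/
abbrev expansion : Theory.{u} := ⟨V.lang, {σ | P.EqAxiom V σ}, P.eqDist V⟩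

/-- Closure under countable products, definable sets, canonical parameters and finite unions. -/
structure IsClosed : Prop where
  prod_mem : ∀ S : ℕ → V.Srt, Name.prod (fun n => (S n).1) ∈ V.carrier
  defset_mem : ∀ (Γ : List V.Srt) (A : Formula V.lang Γ),
    (P.expansion V).IsDefinableSet A → Name.defset (names Γ) A.erase ∈ V.carrier
  canon_mem : ∀ (Γ Δ : List V.Srt) (φ : Formula V.lang (Γ ++ Δ)),
    Name.canon (names Γ) (names Δ) φ.erase ∈ V.carrier
  union_mem : ∀ (Γ : List V.Srt) (n : ℕ) (Δ : Fin (n + 1) → List V.Srt)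
    (φ : ∀ j, Formula V.lang (Γ ++ Δ j)),
    Name.union (names Γ) n (fun j => names (Δ j)) (fun j => (φ j).erase) ∈ V.carrier

/-- The smallest set of sorts with the four closure properties. (They are preserved by
intersections: if `V ⊆ V'` then models of the expansion by `V'` restrict to the expansion by `V`, so
that a set which is definable over `V` is definable over `V'`.) -/
def eqSorts : NameSet P.L where
  carrier := {S | ∀ V : NameSet P.L, P.IsClosed V → S ∈ V.carrier}
  base_mem s V _ := V.base_mem s

/-- The theory `(L^eq, T^eq)`. -/
abbrev eq : Theory.{u} := P.expansion P.eqSorts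

/-- The reduct of a model of the expansion satisfies the given theory. -/
theorem holds_reduct (M : Struc V.lang) (hM : (P.expansion V).Holds M) :
    P.Holds (M.reduct V.baseHom) := by
  intro σ hσ
  have h := hM _ (EqAxiom.base σ hσ)
  have h' := Formula.realize_map V.baseHom M σ Var.nil
  have e : (fun t (x : Var [] t) => Var.nil (X := M.carrier) _ (x.map V.baseHom.onSort)) =
      Var.nil (X := (M.reduct V.baseHom).carrier) := by
    funext t x
    cases x
  rw [e] at h'
  exact h'.symm.trans h

/-- The metric of a sort of `L` does not change under taking reducts. -/
theorem dist_reduct (M : Struc V.lang) (s : P.L.Sorts) (a b : M.carrier (V.base s)) :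
    P.dist (M.reduct V.baseHom) (s := s) a b = (P.expansion V).dist M a b := by
  have h' := Formula.realize_map V.baseHom M (P.d s)
    (Var.pair (X := M.carrier) (a := V.base s) (b := V.base s) a b)
  have e : (fun t (x : Var [s, s] t) =>
      Var.pair (X := M.carrier) (a := V.base s) (b := V.base s) a b _
        (x.map V.baseHom.onSort)) =
      Var.pair (X := (M.reduct V.baseHom).carrier) (a := s) (b := s) a b := by
    funext t x
    cases x with
    | zero => rfl
    | succ x =>
      cases x with
      | zero => rfl
      | succ x => cases x
  rw [e] at h'
  exact congrArg Subtype.val h'.symm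

/-- The forgetful functor from models of `T^eq` to models of `T`, taking reducts to `L`. -/
def forgetEq : Mod P.eq ⥤ Mod P where
  obj M :=
    { str := M.str.reduct P.eqSorts.baseHom
      holds := P.holds_reduct P.eqSorts M.str M.holds
      complete := fun s => by
        have h := M.complete (P.eqSorts.base s)
        have e : (fun a b : M.str.carrier (P.eqSorts.base s) => P.eq.dist M.str a b) =
            fun a b => P.dist (M.str.reduct P.eqSorts.baseHom) (s := s) a b := by
          funext a b
          exact (P.dist_reduct P.eqSorts M.str s a b).symm
        rw [e] at h
        exact h }
  map {M N} g :=
    { toFun := fun s a => g.toFun (P.eqSorts.base s) a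
      map_fn := fun {Γ s} f e => by
        refine (g.map_fn (P.eqSorts.baseHom.onFunc f)
          (Var.mapElim P.eqSorts.base (X := M.str.carrier) Γ e)).trans ?_
        refine congrArg (N.str.fn (P.eqSorts.baseHom.onFunc f)) ?_
        funext t x
        exact Var.apply_mapElim P.eqSorts.base (X := M.str.carrier) (Y := N.str.carrier)
          g.toFun Γ e t x
      map_formula := fun {Γ} φ e => by
        have h := g.map_formula (φ.map P.eqSorts.baseHom)
          (Var.mapElim P.eqSorts.base (X := M.str.carrier) Γ e)
        have h₁ := Formula.realize_map P.eqSorts.baseHom M.str φ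
          (Var.mapElim P.eqSorts.base (X := M.str.carrier) Γ e)
        have h₂ := Formula.realize_map P.eqSorts.baseHom N.str φ
          (fun t x => g.toFun t (Var.mapElim P.eqSorts.base (X := M.str.carrier) Γ e t x))
        have e₀ : ∀ t (x : Var Γ t),
            Var.mapElim P.eqSorts.base (X := M.str.carrier) Γ e _ (x.map P.eqSorts.base) =
              e t x :=
          fun t x => Var.mapElim_map P.eqSorts.base (X := M.str.carrier) Γ e t x
        have e₁ : (fun t (x : Var Γ t) =>
            Var.mapElim P.eqSorts.base (X := M.str.carrier) Γ e _
              (x.map P.eqSorts.baseHom.onSort)) = e := by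
          funext t x
          exact e₀ t x
        have e₂ : (fun t (x : Var Γ t) => g.toFun _
            (Var.mapElim P.eqSorts.base (X := M.str.carrier) Γ e _
              (x.map P.eqSorts.baseHom.onSort))) =
            fun t x => g.toFun (P.eqSorts.base t) (e t x) := by
          funext t x
          exact congrArg _ (e₀ t x)
        rw [e₁] at h₁
        rw [e₂] at h₂
        exact (h₂.symm.trans h).trans h₁ }
  map_id M := rfl
  map_comp g h := rfl

end Theory

end ContLogic

end

/-!
The forgetful functor is shown to be essentially surjective, full and faithful. All three rest on
`Theory.eqSorts_induction`, or on the closure of the imaginary sorts that it expresses: the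
imaginary sorts are built from sorts and formulas built before. The axioms of the expansion are
used in the quantitative form `Theory.EqSpec`, by `Theory.expansion_holds_iff`.

*Essential surjectivity.* Over a model `M` of the theory there is a canonical choice for each
imaginary sort: a product consists of sequences, a definable set of its zeros, and a sort of
canonical parameters of `φ(x, y)`, or a union of such sorts, is the completion of the set of
parameters for the supremum distance of the functions `φ(·, y)`. The elements of all these sorts
are coded in one type `Val M`, so that names of sorts, terms and formulas are interpreted by one
recursion (`interp`). The sorts whose interpretation is nonempty and complete, and for a definable
set `A` has `A` as its distance function, are closed under the constructions
(`Theory.isGoodSort_eqSorts`); for definable sets this is because `A` has a zero near each point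
where `A` is small (`Theory.DefinableIn.exists_zero`). So the interpretations of the imaginary
sorts form a model of the expansion, whose reduct is isomorphic to `M`.

*Faithfulness and fullness.* A map `g` of the reducts of two models `M`, `N` of the expansion
induces a relation `Theory.Lift g` between imaginary elements of `M` and of `N`: elements of
products and of definable sets are related if their coordinates are, and elements of the other new
sorts if they are limits of related values of the quotient maps or inclusions. If `g` is the reduct
of an elementary map `δ`, then this relation is contained in the graph of `δ`
(`Theory.Lift.eq_of_map`). By induction on imaginary sorts, the relation is the graph of an
isometric map on each sort (`Theory.transfers`). The induction uses that the relation preserves the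
values of all formulas in sorts that are already dealt with (`Theory.LiftTuple.realize`), because
the metric of a sort of canonical parameters is given by the formula it belongs to.

The critical step in the preservation of formulas is a quantifier over an imaginary sort of `N`,
since the relation is not known to be surjective, and `g` is only elementary for the base language.
It is overcome by amalgamation (`Theory.exists_amalgam`): by compactness, the reduct of `N` maps to
an ultrapower of `M` so that the composition with `g` is the diagonal map. The ultrapower is taken
with all imaginary sorts of `M`. After identification of elements of distance `0` it is a model of
the expansion, and the diagonal is elementary for the whole expansion; so an element of `N` that is
a witness for a formula gives a witness in an elementary extension of `M`.
-/

namespace ContLogic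

/-! ### Tuples -/

namespace Var

variable {α : Type u} {X : α → Type w}

theorem cons_eta {b : α} {Γ : List α} (e : ∀ a, Var (b :: Γ) a → X a) :
    cons (e _ zero) (fun a x => e a x.succ) = e := by
  funext a x
  cases x <;> rfl

theorem eq_nil (e : ∀ a, Var ([] : List α) a → X a) : e = nil := by
  funext a x
  cases x

theorem forall_tuple_cons {b : α} {Γ : List α} {p : (∀ a, Var (b :: Γ) a → X a) → Prop} :
    (∀ e, p e) ↔ ∀ (x : X b) (e : ∀ a, Var Γ a → X a), p (cons x e) :=
  ⟨fun h _ _ => h _, fun h e => cons_eta e ▸ h _ _⟩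

@[simp] theorem append_inl {a : α} : {Γ Δ : List α} → (e₁ : ∀ a, Var Γ a → X a) →
    (e₂ : ∀ a, Var Δ a → X a) → (x : Var Γ a) → append e₁ e₂ a x.inl = e₁ a x
  | _, _, _, _, zero => rfl
  | _, _, e₁, e₂, succ x => append_inl (fun a x => e₁ a (succ x)) e₂ x

@[simp] theorem append_inr {a : α} : (Γ : List α) → {Δ : List α} → (e₁ : ∀ a, Var Γ a → X a) →
    (e₂ : ∀ a, Var Δ a → X a) → (x : Var Δ a) → append e₁ e₂ a (x.inr Γ) = e₂ a x
  | [], _, _, _, _ => rfl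
  | _ :: Γ, _, e₁, e₂, x => append_inr Γ (fun a x => e₁ a (succ x)) e₂ x

/-- Every variable of a concatenated context comes from one of the two parts. -/
theorem append_cases {a : α} {Δ : List α} : (Γ : List α) → {p : Var (Γ ++ Δ) a → Prop} →
    (∀ x : Var Γ a, p x.inl) → (∀ x : Var Δ a, p (x.inr Γ)) → ∀ x, p x
  | [], _, _, h₂, x => h₂ x
  | _ :: _, _, h₁, _, zero => h₁ zero
  | _ :: Γ, p, h₁, h₂, succ x =>
      append_cases Γ (p := fun x => p x.succ) (fun x => h₁ x.succ) h₂ x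

theorem append_ext {Γ Δ : List α} {e e' : ∀ a, Var (Γ ++ Δ) a → X a}
    (h₁ : ∀ a (x : Var Γ a), e a x.inl = e' a x.inl)
    (h₂ : ∀ a (x : Var Δ a), e a (x.inr Γ) = e' a (x.inr Γ)) : e = e' := by
  funext a x
  exact append_cases Γ (p := fun x => e a x = e' a x) (h₁ a) (h₂ a) x

theorem append_eta {Γ Δ : List α} (e : ∀ a, Var (Γ ++ Δ) a → X a) :
    append (fun a (x : Var Γ a) => e a x.inl) (fun a (x : Var Δ a) => e a (x.inr Γ)) = e :=
  append_ext (fun _ x => append_inl _ _ x) fun _ x => append_inr _ _ _ x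

theorem append_map {Y : α → Type v} (f : ∀ a, X a → Y a) {Γ Δ : List α}
    (e₁ : ∀ a, Var Γ a → X a) (e₂ : ∀ a, Var Δ a → X a) :
    (fun a (x : Var (Γ ++ Δ) a) => f a (append e₁ e₂ a x)) =
      append (fun a x => f a (e₁ a x)) (fun a x => f a (e₂ a x)) :=
  append_ext (fun a x => by simp) fun a x => by simp

theorem forall_tuple_append {Γ Δ : List α} {p : (∀ a, Var (Γ ++ Δ) a → X a) → Prop} :
    (∀ e, p e) ↔ ∀ (e₁ : ∀ a, Var Γ a → X a) (e₂ : ∀ a, Var Δ a → X a), p (append e₁ e₂) :=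
  ⟨fun h _ _ => h _, fun h e => append_eta e ▸ h _ _⟩

theorem forall_tuple_single {b : α} {p : (∀ a, Var [b] a → X a) → Prop} :
    (∀ e, p e) ↔ ∀ x : X b, p (single x) := by
  rw [forall_tuple_cons]
  refine forall_congr' fun x => ⟨fun h => h _, fun h e => ?_⟩
  rw [eq_nil e]
  exact h

theorem forall_tuple_pair {b c : α} {p : (∀ a, Var [b, c] a → X a) → Prop} :
    (∀ e, p e) ↔ ∀ (x : X b) (y : X c), p (pair x y) := by
  rw [forall_tuple_cons]
  exact forall_congr' fun x => forall_tuple_single (p := fun e => p (cons x e))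

theorem map_single {Y : α → Type v} (f : ∀ a, X a → Y a) {b : α} (x : X b) :
    (fun a v => f a (single x a v)) = single (f b x) := by
  funext a v
  cases v with
  | zero => rfl
  | succ v => cases v

theorem map_pair {Y : α → Type v} (f : ∀ a, X a → Y a) {b c : α} (x : X b) (y : X c) :
    (fun a v => f a (pair x y a v)) = pair (f b x) (f c y) := by
  funext a v
  cases v with
  | zero => rfl
  | succ v =>
    cases v with
    | zero => rfl
    | succ v => cases v

theorem map_cons {Y : α → Type v} (f : ∀ a, X a → Y a) {b : α} {Γ : List α} (x : X b)
    (e : ∀ a, Var Γ a → X a) :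
    (fun a v => f a (cons x e a v)) = cons (f b x) (fun a v => f a (e a v)) := by
  funext a v
  cases v <;> rfl

/-- The maximum of the `d (e x) (e' x)`, with value `0` for the empty tuples. -/
noncomputable def maxDist (d : ∀ a, X a → X a → ℝ) :
    {Γ : List α} → (e e' : ∀ a, Var Γ a → X a) → ℝ
  | [], _, _ => 0
  | _ :: _, e, e' =>
      max (d _ (e _ zero) (e' _ zero)) (maxDist d (fun a x => e a x.succ) fun a x => e' a x.succ)

theorem maxDist_le_iff (d : ∀ a, X a → X a → ℝ) {r : ℝ} : {Γ : List α} →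
    (e e' : ∀ a, Var Γ a → X a) → (hr : 0 ≤ r) →
    (maxDist d e e' ≤ r ↔ ∀ a x, d a (e a x) (e' a x) ≤ r)
  | [], e, e', hr => ⟨fun _ a x => (nomatch x), fun _ => hr⟩
  | _ :: _, e, e', hr => by
    rw [maxDist, max_le_iff, maxDist_le_iff d _ _ hr]
    refine ⟨fun h a x => ?_, fun h => ⟨h _ _, fun a x => h _ _⟩⟩
    cases x with
    | zero => exact h.1
    | succ x => exact h.2 _ x

theorem maxDist_nonneg (d : ∀ a, X a → X a → ℝ) : {Γ : List α} →
    (e e' : ∀ a, Var Γ a → X a) → 0 ≤ maxDist d e e'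
  | [], _, _ => le_rfl
  | _ :: _, _, _ => le_max_of_le_right (maxDist_nonneg d _ _)

theorem le_maxDist (d : ∀ a, X a → X a → ℝ) {Γ : List α} (e e' : ∀ a, Var Γ a → X a) {a : α}
    (x : Var Γ a) : d a (e a x) (e' a x) ≤ maxDist d e e' :=
  (maxDist_le_iff d e e' (maxDist_nonneg d e e')).1 le_rfl a x

theorem maxDist_congr {Y : α → Type v} (d : ∀ a, X a → X a → ℝ) (d' : ∀ a, Y a → Y a → ℝ) :
    {Γ : List α} → (e e' : ∀ a, Var Γ a → X a) → (f f' : ∀ a, Var Γ a → Y a) →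
    (∀ a x, d a (e a x) (e' a x) = d' a (f a x) (f' a x)) → maxDist d e e' = maxDist d' f f'
  | [], _, _, _, _, _ => rfl
  | _ :: _, e, e', f, f', h => by
    rw [maxDist, maxDist, h, maxDist_congr d d' _ _ _ _ fun a x => h a x.succ]

end Var

/-! ### Values of formulas -/

section Realize

variable {L : Language.{u}} (M : Struc L)

theorem Term.realize_subst {Γ Δ : List L.Sorts} (σ : ∀ s, Var Γ s → Term L Δ s) (e : M.Tuple Δ)
    {s : L.Sorts} (t : Term L Γ s) :
    (t.subst σ).realize M e = t.realize M fun s x => (σ s x).realize M e := by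
  induction t with
  | var x => rfl
  | app f ts ih =>
    simp only [Term.subst, Term.realize]
    congr 1
    funext t x
    exact ih t x

theorem Term.realize_weaken {Γ : List L.Sorts} {b : L.Sorts} (a : M.carrier b) (e : M.Tuple Γ)
    {s : L.Sorts} (t : Term L Γ s) :
    (t.weaken (b := b)).realize M (Var.cons a e) = t.realize M e := by
  rw [Term.weaken, Term.realize_subst]
  rfl

theorem Formula.realize_subst {Γ Δ : List L.Sorts} (σ : ∀ s, Var Γ s → Term L Δ s)
    (φ : Formula L Γ) (e : M.Tuple Δ) :
    (φ.subst σ).realize M e = φ.realize M fun s x => (σ s x).realize M e := by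
  have key : ∀ {Γ Δ : List L.Sorts} (σ : ∀ s, Var Γ s → Term L Δ s) (e : M.Tuple Δ)
      (b : L.Sorts) (a : M.carrier b),
      (fun t x => Term.realize M (Var.cons (X := M.carrier) a e)
        (Var.cons (X := Term L (b :: Δ)) (.var .zero) (fun _ x => (σ _ x).weaken) t x)) =
      Var.cons (X := M.carrier) a (fun s x => (σ s x).realize M e) := by
    intro Γ Δ σ e b a
    funext t x
    cases x with
    | zero => rfl
    | succ x => exact Term.realize_weaken M a e (σ _ x)
  induction φ generalizing Δ with
  | rel R ts =>
    simp only [Formula.subst, Formula.realize]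
    congr 1
    funext t x
    exact Term.realize_subst M σ e _
  | conn n c φ ih =>
    simp only [Formula.subst, Formula.realize]
    congr 1
    funext i
    exact ih i σ e
  | all s φ ih =>
    simp only [Formula.subst, Formula.realize]
    refine iSup_congr fun a => ?_
    rw [ih, key]
  | ex s φ ih =>
    simp only [Formula.subst, Formula.realize]
    refine iInf_congr fun a => ?_
    rw [ih, key]

theorem Formula.sat_close {Γ : List L.Sorts} (φ : Formula L Γ) :
    M.Sat φ.close ↔ ∀ e, φ.realize M e = 0 := by
  induction Γ with
  | nil =>
    refine ⟨fun h e => ?_, fun h => h _⟩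
    rw [Var.eq_nil e]
    exact h
  | cons s Γ ih =>
    rw [Formula.close, ih, Var.forall_tuple_cons]
    have : ∀ e : M.Tuple Γ, (Formula.all s φ).realize M e = 0 ↔
        ∀ a, φ.realize M (Var.cons (X := M.carrier) a e) = 0 := by
      intro e
      rw [Formula.realize]
      exact iSup_eq_bot
    simp only [this]
    exact forall_comm

theorem Formula.realize_exBlock {Δ : List L.Sorts} (Γ : List L.Sorts) (φ : Formula L (Γ ++ Δ))
    (e : M.Tuple Δ) : (Formula.exBlock Γ φ).realize M e =
      ⨅ x : M.Tuple Γ, φ.realize M (Var.append (X := M.carrier) x e) := by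
  induction Γ with
  | nil =>
    have : Unique (M.Tuple []) := ⟨⟨Var.nil⟩, Var.eq_nil⟩
    rw [iInf_unique]
    rfl
  | cons s Γ ih =>
    rw [Formula.exBlock, ih]
    refine le_antisymm (le_iInf fun x => ?_) (le_iInf fun x => ?_)
    · refine (iInf_le _ fun a v => x a v.succ).trans ?_
      exact iInf_le (fun a : M.carrier s => φ.realize M _) (x _ .zero)
    · refine le_iInf fun a => ?_
      exact iInf_le (fun x : M.Tuple (s :: Γ) => φ.realize M (Var.append (X := M.carrier) x e))
        (Var.cons a x)

theorem Formula.realize_allBlock {Δ : List L.Sorts} (Γ : List L.Sorts) (φ : Formula L (Γ ++ Δ))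
    (e : M.Tuple Δ) : (Formula.allBlock Γ φ).realize M e =
      ⨆ x : M.Tuple Γ, φ.realize M (Var.append (X := M.carrier) x e) := by
  induction Γ with
  | nil =>
    have : Unique (M.Tuple []) := ⟨⟨Var.nil⟩, Var.eq_nil⟩
    rw [iSup_unique]
    rfl
  | cons s Γ ih =>
    rw [Formula.allBlock, ih]
    refine le_antisymm (iSup_le fun x => ?_) (iSup_le fun x => ?_)
    · refine iSup_le fun a => ?_
      exact le_iSup (fun x : M.Tuple (s :: Γ) => φ.realize M (Var.append (X := M.carrier) x e))
        (Var.cons a x)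
    · refine le_trans ?_ (le_iSup _ fun a v => x a v.succ)
      exact le_iSup (fun a : M.carrier s => φ.realize M (Var.cons (X := M.carrier) a
        (Var.append (X := M.carrier) (fun a v => x a v.succ) e))) (x _ .zero)

theorem Struc.nonempty_tuple (Γ : List L.Sorts) : Nonempty (M.Tuple Γ) :=
  ⟨fun s _ => (M.nonempty s).some⟩

variable {Γ Δ : List L.Sorts} (φ ψ : Formula L Γ) (e : M.Tuple Γ)

theorem Formula.realize_nonneg : 0 ≤ (φ.realize M e : ℝ) := (φ.realize M e).2.1

theorem Formula.realize_le_one : (φ.realize M e : ℝ) ≤ 1 := (φ.realize M e).2.2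

theorem Formula.realize_eq_zero_iff : φ.realize M e = 0 ↔ (φ.realize M e : ℝ) = 0 :=
  ⟨fun h => by rw [h]; rfl, fun h => Subtype.ext h⟩

theorem Connective.coe_ofReal {n : ℕ} {f : (Fin n → unitInterval) → ℝ} (hf : Continuous f)
    {a : Fin n → unitInterval} (h : f a ∈ Set.Icc (0 : ℝ) 1) :
    (Connective.ofReal f hf a : ℝ) = f a := by
  rw [Connective.ofReal]
  exact congrArg Subtype.val (Set.projIcc_of_mem zero_le_one h)

@[simp] theorem Formula.realize_const {r : ℝ} (h : r ∈ Set.Icc (0 : ℝ) 1) :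
    ((Formula.const r : Formula L Γ).realize M e : ℝ) = r := by
  rw [Formula.const, Formula.realize]
  exact Connective.coe_ofReal _ h

@[simp] theorem Formula.realize_max :
    ((φ.max ψ).realize M e : ℝ) = Max.max (φ.realize M e : ℝ) (ψ.realize M e) := by
  rw [Formula.max, Formula.realize, Connective.coe_ofReal] <;>
    simp [φ.realize_nonneg, φ.realize_le_one, ψ.realize_le_one]

@[simp] theorem Formula.realize_min :
    ((φ.min ψ).realize M e : ℝ) = Min.min (φ.realize M e : ℝ) (ψ.realize M e) := by
  rw [Formula.min, Formula.realize, Connective.coe_ofReal] <;>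
    simp [φ.realize_nonneg, φ.realize_le_one, ψ.realize_nonneg]

@[simp] theorem Formula.realize_absDiff :
    ((φ.absDiff ψ).realize M e : ℝ) = |(φ.realize M e : ℝ) - ψ.realize M e| := by
  have := φ.realize_nonneg M e
  have := ψ.realize_nonneg M e
  have := φ.realize_le_one M e
  have := ψ.realize_le_one M e
  rw [Formula.absDiff, Formula.realize, Connective.coe_ofReal]
  · simp
  · simp only [Matrix.cons_val_zero, Matrix.cons_val_one, Set.mem_Icc, abs_nonneg, true_and]
    rw [abs_le]
    constructor <;> linarith

theorem Formula.realize_absDiff_eq_zero :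
    (φ.absDiff ψ).realize M e = 0 ↔ φ.realize M e = ψ.realize M e := by
  rw [Formula.realize_eq_zero_iff, Formula.realize_absDiff, abs_eq_zero, sub_eq_zero,
    Subtype.ext_iff]

theorem Formula.realize_tsub_eq_zero :
    (φ.tsub ψ).realize M e = 0 ↔ (φ.realize M e : ℝ) ≤ ψ.realize M e := by
  rw [Formula.tsub, Formula.realize, Connective.ofReal]
  refine (Set.projIcc_eq_left zero_lt_one).trans ?_
  simp

@[simp] theorem Formula.realize_plus :
    ((φ.plus ψ).realize M e : ℝ) = Min.min ((φ.realize M e : ℝ) + ψ.realize M e) 1 := by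
  have := φ.realize_nonneg M e
  have := ψ.realize_nonneg M e
  rw [Formula.plus, Formula.realize, Connective.ofReal]
  refine (Set.coe_projIcc _ _ zero_le_one _).trans ?_
  rw [max_eq_right]
  · simp [min_comm]
  · refine le_min zero_le_one ?_
    simpa using add_nonneg ‹_› ‹0 ≤ (ψ.realize M e : ℝ)›

theorem sum_div_two_pow_le_one {n : ℕ} {a : Fin n → ℝ} (h : ∀ i, a i ≤ 1) :
    ∑ i, a i / 2 ^ ((i : ℕ) + 1) ≤ 1 := by
  have h1 : ∑ i : Fin n, a i / 2 ^ ((i : ℕ) + 1) ≤ ∑ i ∈ Finset.range n, (1 / 2 : ℝ) ^ (i + 1) := by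
    rw [← Fin.sum_univ_eq_sum_range fun i => (1 / 2 : ℝ) ^ (i + 1)]
    refine Finset.sum_le_sum fun i _ => ?_
    rw [one_div, inv_pow, div_eq_mul_inv]
    exact mul_le_of_le_one_left (by positivity) (h i)
  have h2 : ∀ n : ℕ, ∑ i ∈ Finset.range n, (1 / 2 : ℝ) ^ (i + 1) = 1 - (1 / 2) ^ n := by
    intro n
    induction n with
    | zero => simp
    | succ n ih => rw [Finset.sum_range_succ, ih]; ring
  rw [h2] at h1
  exact h1.trans (by simp)

@[simp] theorem Formula.realize_weightedSum {n : ℕ} (φ : Fin n → Formula L Γ) :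
    ((Formula.weightedSum φ).realize M e : ℝ) =
      ∑ i, ((φ i).realize M e : ℝ) / 2 ^ ((i : ℕ) + 1) := by
  rw [Formula.weightedSum, Formula.realize, Connective.coe_ofReal]
  exact ⟨Finset.sum_nonneg fun i _ => div_nonneg ((φ i).realize_nonneg M e) (by positivity),
    sum_div_two_pow_le_one fun i => (φ i).realize_le_one M e⟩

theorem Formula.realize_minList_eq_zero (l : List (Formula L Γ)) :
    (Formula.minList l).realize M e = 0 ↔ ∃ φ ∈ l, φ.realize M e = 0 := by
  induction l with
  | nil =>
    rw [Formula.minList, Formula.realize_eq_zero_iff, Formula.realize_const]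
    · simp
    · simp
  | cons φ l ih =>
    rw [Formula.minList, Formula.realize_eq_zero_iff, Formula.realize_min]
    rw [List.exists_mem_cons_iff, ← ih, Formula.realize_eq_zero_iff, Formula.realize_eq_zero_iff]
    have h1 := φ.realize_nonneg M e
    have h2 := (minList l).realize_nonneg M e
    constructor
    · intro h
      rcases min_choice (φ.realize M e : ℝ) ((minList l).realize M e) with h' | h'
      · exact Or.inl (h' ▸ h)
      · exact Or.inr (h' ▸ h)
    · rintro (h | h)
      · rw [h]; exact min_eq_left h2
      · rw [h]; exact min_eq_right h1

theorem Formula.realize_maxVars_le_iff {α : Type v} {r : ℝ} (hr : 0 ≤ r) : (l : List α) →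
    (F : ∀ a, Var l a → Formula L Γ) → (((Formula.maxVars l F).realize M e : ℝ) ≤ r ↔
      ∀ a x, ((F a x).realize M e : ℝ) ≤ r)
  | [], F => by
    rw [maxVars, realize_const M e (by simp)]
    exact ⟨fun _ a x => (nomatch x), fun _ => hr⟩
  | _ :: l, F => by
    rw [maxVars, realize_max, max_le_iff, Formula.realize_maxVars_le_iff hr l]
    refine ⟨fun h a x => ?_, fun h => ⟨h _ _, fun a x => h _ _⟩⟩
    cases x with
    | zero => exact h.1
    | succ x => exact h.2 _ x

@[simp] theorem Formula.realize_distTerm (d : ∀ s, Formula L [s, s]) {s : L.Sorts}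
    (t t' : Term L Γ s) : (Formula.distTerm d t t').realize M e =
      (d s).realize M (Var.pair (X := M.carrier) (t.realize M e) (t'.realize M e)) := by
  rw [distTerm, realize_subst]
  congr 1
  exact Var.map_pair (X := Term L Γ) (Y := M.carrier) (fun s t => t.realize M e) t t'

theorem Formula.realize_distTuple (d : ∀ s, Formula L [s, s]) : {Δ : List L.Sorts} →
    (σ τ : ∀ s, Var Δ s → Term L Γ s) → ((Formula.distTuple d σ τ).realize M e : ℝ) =
      Var.maxDist (X := M.carrier)
        (fun s a b => (d s).realize M (Var.pair (X := M.carrier) a b))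
        (fun s x => (σ s x).realize M e) (fun s x => (τ s x).realize M e)
  | [], σ, τ => by
    rw [distTuple, maxVars, realize_const M e (by simp)]
    rfl
  | _ :: _, σ, τ => by
    rw [distTuple, maxVars, realize_max, realize_distTerm]
    exact congrArg _ (Formula.realize_distTuple d (fun s x => σ s x.succ) fun s x => τ s x.succ)

end Realize

/-! ### The axioms of the expansion, read in a structure -/

theorem unitInterval_isLUB_iSup {ι : Type v} [Nonempty ι] (f : ι → unitInterval) :
    IsLUB (Set.range fun i => (f i : ℝ)) ((⨆ i, f i : unitInterval) : ℝ) := by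
  refine ⟨?_, fun r hr => ?_⟩
  · rintro _ ⟨i, rfl⟩
    exact le_iSup f i
  · have h0 : 0 ≤ r := (f (Classical.arbitrary ι)).2.1.trans (hr ⟨_, rfl⟩)
    by_cases h1 : r ≤ 1
    · exact (iSup_le (a := (⟨r, h0, h1⟩ : unitInterval)) fun i => hr ⟨i, rfl⟩ :)
    · exact (⨆ i, f i).2.2.trans (not_le.1 h1).le

theorem unitInterval_isGLB_iInf {ι : Type v} [Nonempty ι] (f : ι → unitInterval) :
    IsGLB (Set.range fun i => (f i : ℝ)) ((⨅ i, f i : unitInterval) : ℝ) := by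
  refine ⟨?_, fun r hr => ?_⟩
  · rintro _ ⟨i, rfl⟩
    exact iInf_le f i
  · have h1 : r ≤ 1 := (hr ⟨Classical.arbitrary ι, rfl⟩).trans (f (Classical.arbitrary ι)).2.2
    by_cases h0 : 0 ≤ r
    · exact (le_iInf (a := (⟨r, h0, h1⟩ : unitInterval)) fun i => hr ⟨i, rfl⟩ :)
    · exact (not_le.1 h0).le.trans (⨅ i, f i).2.1

theorem unitInterval_isLUB_iSup' {ι : Type v} [Nonempty ι] {f : ι → unitInterval} {g : ι → ℝ}
    (h : ∀ i, (f i : ℝ) = g i) : IsLUB (Set.range g) ((⨆ i, f i : unitInterval) : ℝ) :=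
  funext h ▸ unitInterval_isLUB_iSup f

theorem unitInterval_isGLB_iInf' {ι : Type v} [Nonempty ι] {f : ι → unitInterval} {g : ι → ℝ}
    (h : ∀ i, (f i : ℝ) = g i) : IsGLB (Set.range g) ((⨅ i, f i : unitInterval) : ℝ) :=
  funext h ▸ unitInterval_isGLB_iInf f

theorem unitInterval_eq_iSup_iff {ι : Type v} [Nonempty ι] {f : ι → unitInterval} {g : ι → ℝ}
    (h : ∀ i, (f i : ℝ) = g i) {a : unitInterval} :
    a = ⨆ i, f i ↔ IsLUB (Set.range g) (a : ℝ) :=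
  ⟨fun H => H ▸ unitInterval_isLUB_iSup' h, fun H =>
    Subtype.ext (H.unique (unitInterval_isLUB_iSup' h))⟩

theorem unitInterval_eq_iInf_iff {ι : Type v} [Nonempty ι] {f : ι → unitInterval} {g : ι → ℝ}
    (h : ∀ i, (f i : ℝ) = g i) {a : unitInterval} :
    a = ⨅ i, f i ↔ IsGLB (Set.range g) (a : ℝ) :=
  ⟨fun H => H ▸ unitInterval_isGLB_iInf' h, fun H =>
    Subtype.ext (H.unique (unitInterval_isGLB_iInf' h))⟩

theorem unitInterval_iInf_eq_zero_iff {ι : Type v} [Nonempty ι] (f : ι → unitInterval) :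
    ⨅ i, f i = 0 ↔ ∀ ε : ℝ, 0 < ε → ∃ i, (f i : ℝ) ≤ ε := by
  have h := unitInterval_isGLB_iInf f
  constructor
  · intro h0 ε hε
    rw [h0] at h
    obtain ⟨_, ⟨i, rfl⟩, hi⟩ := (isGLB_lt_iff h).1 hε
    exact ⟨i, hi.le⟩
  · intro H
    refine Subtype.ext (le_antisymm (le_of_forall_pos_le_add fun ε hε => ?_) (⨅ i, f i).2.1)
    obtain ⟨i, hi⟩ := H ε hε
    exact ((h.1 ⟨i, rfl⟩).trans hi).trans (by simp)

namespace NameSet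

variable {L : Language.{u}} {V : NameSet L} (M : Struc V.lang)

/-- The `n`-th projection of a product sort. -/
def projFn {S : V.Srt} (F : ℕ → V.Srt) (h : S.1 = Name.prod fun n => (F n).1) (n : ℕ)
    (z : M.carrier S) : M.carrier (F n) :=
  M.fn (Γ := [S]) (EqFunc.proj F h n) (Var.single (X := M.carrier) z)

/-- The inclusion of the sort of a definable set in the ambient tuples. -/
def inclFn {S : V.Srt} (Γ : List V.Srt) (A : FormulaName L) (h : S.1 = Name.defset (names Γ) A)
    (z : M.carrier S) : M.Tuple Γ :=
  fun _ x => M.fn (Γ := [S]) (EqFunc.incl Γ A h x) (Var.single (X := M.carrier) z)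

/-- The quotient map to a sort of canonical parameters. -/
def quotFn {S : V.Srt} (Γ Δ : List V.Srt) (φ : FormulaName L)
    (h : S.1 = Name.canon (names Γ) (names Δ) φ) (y : M.Tuple Δ) : M.carrier S :=
  M.fn (EqFunc.quot Γ Δ φ h) y

/-- The inclusion of a sort of canonical parameters in a union. -/
def injFn {S C : V.Srt} (Γ : List V.Srt) (n : ℕ) (Δ : Fin (n + 1) → List V.Srt)
    (φ : Fin (n + 1) → FormulaName L)
    (h : S.1 = Name.union (names Γ) n (fun j => names (Δ j)) φ) (j : Fin (n + 1))
    (hC : C.1 = Name.canon (names Γ) (names (Δ j)) (φ j)) (z : M.carrier C) : M.carrier S :=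
  M.fn (Γ := [C]) (EqFunc.inj Γ n Δ φ h j hC) (Var.single (X := M.carrier) z)

end NameSet

namespace Theory

open NameSet Formula

variable (P : Theory.{u}) {V : NameSet P.L} (M : Struc V.lang)

theorem dist_nonneg' (P : Theory.{u}) (M : Struc P.L) {s : P.L.Sorts} (a b : M.carrier s) :
    0 ≤ P.dist M a b := ((P.d s).realize M _).2.1

theorem dist_le_one' (P : Theory.{u}) (M : Struc P.L) {s : P.L.Sorts} (a b : M.carrier s) :
    P.dist M a b ≤ 1 := ((P.d s).realize M _).2.2

theorem realize_app1 {Γ : List V.Srt} {S S' : V.Srt} (f : V.EqFunc [S] S')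
    (t : Term V.lang Γ S) (e : M.Tuple Γ) : (app1 f t).realize M e =
      M.fn (Γ := [S]) (s := S') f (Var.single (X := M.carrier) (t.realize M e)) := by
  rw [app1, Term.realize]
  exact congrArg _ (Var.map_single (X := Term V.lang Γ) (Y := M.carrier)
    (fun s t => t.realize M e) t)

/-- The maximum metric on tuples. -/
noncomputable def tupDist (P : Theory.{u}) (M : Struc P.L) {Γ : List P.L.Sorts}
    (e e' : M.Tuple Γ) : ℝ :=
  Var.maxDist (fun _ a b => P.dist M a b) e e'

/-- The value `φ(x, z)` for an element `z` of the sort of canonical parameters of `φ(x, y)`. -/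
noncomputable def paramVal (Γ Δ : List V.Srt) (φ : Formula V.lang (Γ ++ Δ)) {C : V.Srt}
    (hC : C.1 = Name.canon (names Γ) (names Δ) φ.erase) (x : M.Tuple Γ) (z : M.carrier C) : ℝ :=
  ⨅ b : M.Tuple Δ, min ((φ.realize M (Var.append (X := M.carrier) x b) : ℝ) +
    (P.expansion V).dist M (quotFn M Γ Δ φ.erase hC b) z) 1

theorem isGLB_paramVal (Γ Δ : List V.Srt) (φ : Formula V.lang (Γ ++ Δ)) {C : V.Srt}
    (hC : C.1 = Name.canon (names Γ) (names Δ) φ.erase) (x : M.Tuple Γ) (z : M.carrier C) :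
    IsGLB (Set.range fun b : M.Tuple Δ =>
      min ((φ.realize M (Var.append (X := M.carrier) x b) : ℝ) +
        (P.expansion V).dist M (quotFn M Γ Δ φ.erase hC b) z) 1) (P.paramVal M Γ Δ φ hC x z) := by
  have := M.nonempty_tuple Δ
  refine isGLB_ciInf ⟨0, ?_⟩
  rintro _ ⟨b, rfl⟩
  exact le_min (add_nonneg (φ.realize_nonneg M _) (dist_nonneg' _ _ _ _)) zero_le_one

theorem realize_paramFormula {Θ : List V.Srt} (Γ Δ : List V.Srt) (φ : Formula V.lang (Γ ++ Δ))
    {C : V.Srt} (hC : C.1 = Name.canon (names Γ) (names Δ) φ.erase) (z : Term V.lang Θ C)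
    (x : M.Tuple Γ) (e : M.Tuple Θ) :
    ((paramFormula P Γ Δ φ hC z).realize M (Var.append (X := M.carrier) x e) : ℝ) =
      P.paramVal M Γ Δ φ hC x (z.realize M e) := by
  refine IsGLB.unique ?_ (P.isGLB_paramVal M Γ Δ φ hC x (z.realize M e))
  have := M.nonempty_tuple Δ
  rw [paramFormula, realize_exBlock]
  refine unitInterval_isGLB_iInf' fun b => ?_
  rw [realize_plus, realize_subst, realize_distTerm]
  congr 2
  · congr 2
    refine Var.append_ext (fun s v => ?_) fun s v => ?_
    · simp [Term.realize]
    · simp [Term.realize]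
  · rw [Term.realize_subst]
    simp only [Term.realize, quotTerm, Var.append_inl, Var.append_inr]
    rfl

/-- The meaning of the axioms of the expansion in a structure. -/
structure EqSpec : Prop where
  base : P.Holds (M.reduct V.baseHom)
  dist_self (S : V.Srt) (a : M.carrier S) : (P.expansion V).dist M a a = 0
  dist_comm (S : V.Srt) (a b : M.carrier S) :
    (P.expansion V).dist M a b = (P.expansion V).dist M b a
  dist_triangle (S : V.Srt) (a b c : M.carrier S) :
    (P.expansion V).dist M a c ≤ (P.expansion V).dist M a b + (P.expansion V).dist M b c
  prod_dense (S : V.Srt) (F : ℕ → V.Srt) (h : S.1 = Name.prod fun n => (F n).1) (n : ℕ)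
    (e : M.Tuple ((List.range n).map F)) (ε : ℝ) (hε : 0 < ε) :
    ∃ y : M.carrier S, ∀ i (x : Var (List.range n) i),
      (P.expansion V).dist M (projFn M F h i y) (e _ (x.map F)) ≤ ε
  prod_dist (S : V.Srt) (F : ℕ → V.Srt) (h : S.1 = Name.prod fun n => (F n).1) (n : ℕ)
    (a b : M.carrier S) :
    |(P.expansion V).dist M a b - ∑ i : Fin n,
      (P.expansion V).dist M (projFn M F h i a) (projFn M F h i b) / 2 ^ ((i : ℕ) + 1)| ≤ 1 / 2 ^ n
  defset_image (S : V.Srt) (Γ : List V.Srt) (A : Formula V.lang Γ)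
    (h : S.1 = Name.defset (names Γ) A.erase) (e : M.Tuple Γ) :
    IsGLB (Set.range fun y : M.carrier S =>
      (P.expansion V).tupDist M e (inclFn M Γ A.erase h y)) (A.realize M e)
  defset_dist (S : V.Srt) (Γ : List V.Srt) (A : Formula V.lang Γ)
    (h : S.1 = Name.defset (names Γ) A.erase) (a b : M.carrier S) :
    (P.expansion V).dist M a b =
      (P.expansion V).tupDist M (inclFn M Γ A.erase h a) (inclFn M Γ A.erase h b)
  canon_dist (C : V.Srt) (Γ Δ : List V.Srt) (φ : Formula V.lang (Γ ++ Δ))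
    (h : C.1 = Name.canon (names Γ) (names Δ) φ.erase) (b c : M.Tuple Δ) :
    IsLUB (Set.range fun x : M.Tuple Γ =>
      |(φ.realize M (Var.append (X := M.carrier) x b) : ℝ) -
        φ.realize M (Var.append (X := M.carrier) x c)|)
      ((P.expansion V).dist M (quotFn M Γ Δ φ.erase h b) (quotFn M Γ Δ φ.erase h c))
  canon_dense (C : V.Srt) (Γ Δ : List V.Srt) (φ : Formula V.lang (Γ ++ Δ))
    (h : C.1 = Name.canon (names Γ) (names Δ) φ.erase) (z : M.carrier C) (ε : ℝ) (hε : 0 < ε) :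
    ∃ b, (P.expansion V).dist M (quotFn M Γ Δ φ.erase h b) z ≤ ε
  union_cover (S : V.Srt) (Γ : List V.Srt) (n : ℕ) (Δ : Fin (n + 1) → List V.Srt)
    (φ : ∀ j, Formula V.lang (Γ ++ Δ j))
    (h : S.1 = Name.union (names Γ) n (fun j => names (Δ j)) (fun j => (φ j).erase))
    (C : Fin (n + 1) → V.Srt)
    (hC : ∀ j, (C j).1 = Name.canon (names Γ) (names (Δ j)) (φ j).erase) (x : M.carrier S) :
    ∃ j, ∀ ε : ℝ, 0 < ε → ∃ y, (P.expansion V).dist M x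
      (injFn M Γ n Δ (fun j => (φ j).erase) h j (hC j) y) ≤ ε
  union_dist (S : V.Srt) (Γ : List V.Srt) (n : ℕ) (Δ : Fin (n + 1) → List V.Srt)
    (φ : ∀ j, Formula V.lang (Γ ++ Δ j))
    (h : S.1 = Name.union (names Γ) n (fun j => names (Δ j)) (fun j => (φ j).erase))
    (C : Fin (n + 1) → V.Srt)
    (hC : ∀ j, (C j).1 = Name.canon (names Γ) (names (Δ j)) (φ j).erase) (j k : Fin (n + 1))
    (y : M.carrier (C j)) (z : M.carrier (C k)) :
    IsLUB (Set.range fun x : M.Tuple Γ =>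
      |P.paramVal M Γ (Δ j) (φ j) (hC j) x y - P.paramVal M Γ (Δ k) (φ k) (hC k) x z|)
      ((P.expansion V).dist M (injFn M Γ n Δ (fun j => (φ j).erase) h j (hC j) y)
        (injFn M Γ n Δ (fun j => (φ j).erase) h k (hC k) z))

variable {M}

theorem sat_map_base (σ : Sentence P.L) :
    M.Sat (σ.map V.baseHom) ↔ (M.reduct V.baseHom).Sat σ := by
  have h' := Formula.realize_map V.baseHom M σ Var.nil
  rw [Var.eq_nil (fun t (x : Var [] t) => Var.nil (X := M.carrier) _
    (x.map V.baseHom.onSort))] at h'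
  exact Eq.congr_left h'

theorem sat_dist_self (S : V.Srt) :
    M.Sat (close (Γ := [S]) (distTerm (P.eqDist V) (.var .zero) (.var .zero))) ↔
      ∀ a : M.carrier S, (P.expansion V).dist M a a = 0 := by
  rw [sat_close, Var.forall_tuple_single]
  refine forall_congr' fun a => ?_
  rw [realize_eq_zero_iff, realize_distTerm]
  rfl

theorem sat_dist_comm (S : V.Srt) :
    M.Sat (close (Γ := [S, S]) (absDiff
        (distTerm (P.eqDist V) (.var .zero) (.var (.succ .zero)))
        (distTerm (P.eqDist V) (.var (.succ .zero)) (.var .zero)))) ↔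
      ∀ a b : M.carrier S, (P.expansion V).dist M a b = (P.expansion V).dist M b a := by
  rw [sat_close, Var.forall_tuple_pair]
  refine forall_congr' fun a => forall_congr' fun b => ?_
  rw [realize_absDiff_eq_zero, realize_distTerm, realize_distTerm, Subtype.ext_iff]
  rfl

theorem sat_dist_triangle (S : V.Srt) :
    M.Sat (close (Γ := [S, S, S]) (tsub
        (distTerm (P.eqDist V) (.var .zero) (.var (.succ (.succ .zero))))
        (plus
          (distTerm (P.eqDist V) (.var .zero) (.var (.succ .zero)))
          (distTerm (P.eqDist V) (.var (.succ .zero)) (.var (.succ (.succ .zero))))))) ↔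
      ∀ a b c : M.carrier S, (P.expansion V).dist M a c ≤
        (P.expansion V).dist M a b + (P.expansion V).dist M b c := by
  rw [sat_close, Var.forall_tuple_cons]
  refine forall_congr' fun a => (Var.forall_tuple_pair (p := fun e => _)).trans ?_
  refine forall_congr' fun b => forall_congr' fun c => ?_
  rw [realize_tsub_eq_zero, realize_plus, realize_distTerm, realize_distTerm, realize_distTerm,
    le_min_iff]
  exact ⟨fun h => h.1, fun h => ⟨h, dist_le_one' (P.expansion V) M _ _⟩⟩

theorem sat_prod_dense (S : V.Srt) (F : ℕ → V.Srt) (h : S.1 = Name.prod fun n => (F n).1) (n : ℕ) :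
    M.Sat (close (Γ := (List.range n).map F) (.ex (L := V.lang) S
        (maxVars (List.range n) fun i x =>
          distTerm (P.eqDist V)
            (app1 (EqFunc.proj F h i) (.var .zero))
            (.var (.succ (x.map F)))))) ↔
      ∀ (e : M.Tuple ((List.range n).map F)) (ε : ℝ), 0 < ε → ∃ y : M.carrier S,
        ∀ i (x : Var (List.range n) i),
          (P.expansion V).dist M (projFn M F h i y) (e _ (x.map F)) ≤ ε := by
  rw [sat_close]
  refine forall_congr' fun e => ?_
  have := M.nonempty S
  rw [Formula.realize, unitInterval_iInf_eq_zero_iff]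
  refine forall_congr' fun ε => forall_congr' fun hε => exists_congr fun y => ?_
  rw [realize_maxVars_le_iff M _ hε.le]
  refine forall_congr' fun i => forall_congr' fun x => ?_
  rw [realize_distTerm, realize_app1]
  rfl

theorem sat_prod_dist (S : V.Srt) (F : ℕ → V.Srt) (h : S.1 = Name.prod fun n => (F n).1) (n : ℕ) :
    M.Sat (close (Γ := [S, S]) (tsub
        (absDiff
          (distTerm (P.eqDist V) (.var .zero) (.var (.succ .zero)))
          (weightedSum fun i : Fin n =>
            distTerm (P.eqDist V)
              (app1 (EqFunc.proj F h i) (.var .zero))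
              (app1 (EqFunc.proj F h i) (.var (.succ .zero)))))
        (const (1 / 2 ^ n)))) ↔
      ∀ a b : M.carrier S, |(P.expansion V).dist M a b - ∑ i : Fin n,
        (P.expansion V).dist M (projFn M F h i a) (projFn M F h i b) / 2 ^ ((i : ℕ) + 1)|
          ≤ 1 / 2 ^ n := by
  rw [sat_close, Var.forall_tuple_pair]
  refine forall_congr' fun a => forall_congr' fun b => ?_
  rw [realize_tsub_eq_zero, realize_const, realize_absDiff, realize_weightedSum, realize_distTerm]
  · simp only [realize_distTerm, realize_app1]
    rfl
  · refine ⟨by positivity, ?_⟩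
    rw [div_le_one (by positivity)]
    exact one_le_pow₀ one_le_two

theorem coe_realize_distTuple {Γ Δ : List V.Srt} (σ τ : ∀ s, Var Δ s → Term V.lang Γ s)
    (e : M.Tuple Γ) : ((distTuple (L := V.lang) (P.eqDist V) σ τ).realize M e : ℝ) =
      (P.expansion V).tupDist M (fun s x => (σ s x).realize M e)
        (fun s x => (τ s x).realize M e) :=
  realize_distTuple M e _ _ _

theorem sat_defset_image (S : V.Srt) (Γ : List V.Srt) (A : Formula V.lang Γ)
    (h : S.1 = Name.defset (names Γ) A.erase) :
    M.Sat (close (absDiff A (.ex (L := V.lang) S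
        (distTuple (L := V.lang) (Δ := Γ) (P.eqDist V)
          (fun _ x => .var x.succ)
          (fun _ x => app1 (EqFunc.incl Γ A.erase h x) (.var .zero)))))) ↔
      ∀ e : M.Tuple Γ, IsGLB (Set.range fun y : M.carrier S =>
        (P.expansion V).tupDist M e (inclFn M Γ A.erase h y)) (A.realize M e) := by
  rw [sat_close]
  refine forall_congr' fun e => ?_
  rw [realize_absDiff_eq_zero, Formula.realize]
  have := M.nonempty S
  refine unitInterval_eq_iInf_iff fun y => ?_
  simp only [coe_realize_distTuple, realize_app1]
  rfl

theorem sat_defset_dist (S : V.Srt) (Γ : List V.Srt) (A : Formula V.lang Γ)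
    (h : S.1 = Name.defset (names Γ) A.erase) :
    M.Sat (close (Γ := [S, S]) (absDiff
        (distTerm (P.eqDist V) (.var .zero) (.var (.succ .zero)))
        (distTuple (L := V.lang) (Δ := Γ) (P.eqDist V)
          (fun _ x => app1 (EqFunc.incl Γ A.erase h x) (.var .zero))
          (fun _ x => app1 (EqFunc.incl Γ A.erase h x) (.var (.succ .zero)))))) ↔
      ∀ a b : M.carrier S, (P.expansion V).dist M a b =
        (P.expansion V).tupDist M (inclFn M Γ A.erase h a) (inclFn M Γ A.erase h b) := by
  rw [sat_close, Var.forall_tuple_pair]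
  refine forall_congr' fun a => forall_congr' fun b => ?_
  rw [realize_absDiff_eq_zero, Subtype.ext_iff, coe_realize_distTuple, realize_distTerm]
  simp only [realize_app1]
  rfl

theorem sat_canon_dist (C : V.Srt) (Γ Δ : List V.Srt) (φ : Formula V.lang (Γ ++ Δ))
    (h : C.1 = Name.canon (names Γ) (names Δ) φ.erase) :
    M.Sat (close (Γ := Δ ++ Δ) (absDiff
        (distTerm (P.eqDist V)
          (quotTerm Γ Δ φ h fun _ y => .var y.inl)
          (quotTerm Γ Δ φ h fun _ y => .var (y.inr Δ)))
        (allBlock (L := V.lang) Γ (absDiff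
          (φ.subst (Var.append (X := Term V.lang (Γ ++ (Δ ++ Δ)))
            (fun _ x => .var x.inl) (fun _ y => .var ((y.inl).inr Γ))))
          (φ.subst (Var.append (X := Term V.lang (Γ ++ (Δ ++ Δ)))
            (fun _ x => .var x.inl) (fun _ y => .var ((y.inr Δ).inr Γ)))))))) ↔
      ∀ b c : M.Tuple Δ, IsLUB (Set.range fun x : M.Tuple Γ =>
        |(φ.realize M (Var.append (X := M.carrier) x b) : ℝ) -
          φ.realize M (Var.append (X := M.carrier) x c)|)
        ((P.expansion V).dist M (quotFn M Γ Δ φ.erase h b) (quotFn M Γ Δ φ.erase h c)) := by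
  rw [sat_close, Var.forall_tuple_append]
  refine forall_congr' fun b => forall_congr' fun c => ?_
  rw [realize_absDiff_eq_zero, realize_allBlock, realize_distTerm]
  have := M.nonempty_tuple Γ
  have hσ : ∀ (x : M.Tuple Γ) (τ : ∀ s, Var Δ s → Var (Δ ++ Δ) s),
      (φ.subst (Var.append (X := Term V.lang (Γ ++ (Δ ++ Δ)))
        (fun _ x => .var x.inl) (fun _ y => .var ((τ _ y).inr Γ)))).realize M
          (Var.append (X := M.carrier) x (Var.append (X := M.carrier) b c)) =
        φ.realize M (Var.append (X := M.carrier) x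
          fun s y => Var.append (X := M.carrier) b c s (τ s y)) := by
    intro x τ
    rw [realize_subst]
    congr 1
    exact Var.append_ext (fun s v => by simp [Term.realize]) fun s v => by simp [Term.realize]
  simp only [Term.realize, quotTerm, Var.append_inl, Var.append_inr]
  refine unitInterval_eq_iSup_iff fun x => ?_
  rw [realize_absDiff M]
  refine (congrArg₂ (fun p q : unitInterval => |(p : ℝ) - q|) (hσ x fun _ y => y.inl)
    (hσ x fun _ y => y.inr Δ)).trans ?_
  simp only [Var.append_inl, Var.append_inr]

theorem sat_canon_dense (C : V.Srt) (Γ Δ : List V.Srt) (φ : Formula V.lang (Γ ++ Δ))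
    (h : C.1 = Name.canon (names Γ) (names Δ) φ.erase) :
    M.Sat (close (Γ := [C]) (exBlock (L := V.lang) Δ
        (distTerm (P.eqDist V)
          (quotTerm Γ Δ φ h fun _ y => .var y.inl)
          (.var (Var.zero.inr Δ))))) ↔
      ∀ (z : M.carrier C) (ε : ℝ), 0 < ε →
        ∃ b, (P.expansion V).dist M (quotFn M Γ Δ φ.erase h b) z ≤ ε := by
  rw [sat_close, Var.forall_tuple_single]
  refine forall_congr' fun z => ?_
  have := M.nonempty_tuple Δ
  rw [realize_exBlock, unitInterval_iInf_eq_zero_iff]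
  refine forall_congr' fun ε => forall_congr' fun hε => exists_congr fun b => ?_
  rw [realize_distTerm]
  simp only [Term.realize, quotTerm, Var.append_inl, Var.append_inr]
  rfl

theorem sat_union_cover (S : V.Srt) (Γ : List V.Srt) (n : ℕ) (Δ : Fin (n + 1) → List V.Srt)
    (φ : ∀ j, Formula V.lang (Γ ++ Δ j))
    (h : S.1 = Name.union (names Γ) n (fun j => names (Δ j)) (fun j => (φ j).erase))
    (C : Fin (n + 1) → V.Srt)
    (hC : ∀ j, (C j).1 = Name.canon (names Γ) (names (Δ j)) (φ j).erase) :
    M.Sat (close (Γ := [S]) (minList (List.ofFn fun j : Fin (n + 1) =>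
        .ex (L := V.lang) (C j) (distTerm (P.eqDist V)
          (.var (.succ .zero))
          (app1 (EqFunc.inj Γ n Δ (fun j => (φ j).erase) h j (hC j)) (.var .zero)))))) ↔
      ∀ x : M.carrier S, ∃ j, ∀ ε : ℝ, 0 < ε → ∃ y, (P.expansion V).dist M x
        (injFn M Γ n Δ (fun j => (φ j).erase) h j (hC j) y) ≤ ε := by
  rw [sat_close, Var.forall_tuple_single]
  refine forall_congr' fun x => ?_
  rw [realize_minList_eq_zero]
  have key : ∀ j : Fin (n + 1), (Formula.ex (L := V.lang) (C j) (distTerm (P.eqDist V)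
          (.var (.succ .zero))
          (app1 (EqFunc.inj Γ n Δ (fun j => (φ j).erase) h j (hC j)) (.var .zero)))).realize M
        (Var.single (X := M.carrier) x) = 0 ↔ ∀ ε : ℝ, 0 < ε → ∃ y, (P.expansion V).dist M x
        (injFn M Γ n Δ (fun j => (φ j).erase) h j (hC j) y) ≤ ε := by
    intro j
    have := M.nonempty (C j)
    rw [Formula.realize, unitInterval_iInf_eq_zero_iff]
    refine forall_congr' fun ε => forall_congr' fun hε => exists_congr fun b => ?_
    rw [realize_distTerm, realize_app1]
    rfl
  constructor
  · rintro ⟨ψ, hψ, h0⟩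
    obtain ⟨j, rfl⟩ := (List.mem_ofFn' _ _).1 hψ
    exact ⟨j, (key j).1 h0⟩
  · rintro ⟨j, hj⟩
    exact ⟨_, (List.mem_ofFn' _ _).2 ⟨j, rfl⟩, (key j).2 hj⟩

theorem sat_union_dist (S : V.Srt) (Γ : List V.Srt) (n : ℕ) (Δ : Fin (n + 1) → List V.Srt)
    (φ : ∀ j, Formula V.lang (Γ ++ Δ j))
    (h : S.1 = Name.union (names Γ) n (fun j => names (Δ j)) (fun j => (φ j).erase))
    (C : Fin (n + 1) → V.Srt)
    (hC : ∀ j, (C j).1 = Name.canon (names Γ) (names (Δ j)) (φ j).erase) (j k : Fin (n + 1)) :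
    M.Sat (close (Γ := [C j, C k]) (absDiff
        (distTerm (P.eqDist V)
          (app1 (EqFunc.inj Γ n Δ (fun j => (φ j).erase) h j (hC j)) (.var .zero))
          (app1 (EqFunc.inj Γ n Δ (fun j => (φ j).erase) h k (hC k)) (.var (.succ .zero))))
        (allBlock (L := V.lang) Γ (absDiff
          (paramFormula P Γ (Δ j) (φ j) (hC j) (.var .zero))
          (paramFormula P Γ (Δ k) (φ k) (hC k) (.var (.succ .zero))))))) ↔
      ∀ (y : M.carrier (C j)) (z : M.carrier (C k)), IsLUB (Set.range fun x : M.Tuple Γ =>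
        |P.paramVal M Γ (Δ j) (φ j) (hC j) x y - P.paramVal M Γ (Δ k) (φ k) (hC k) x z|)
        ((P.expansion V).dist M (injFn M Γ n Δ (fun j => (φ j).erase) h j (hC j) y)
          (injFn M Γ n Δ (fun j => (φ j).erase) h k (hC k) z)) := by
  rw [sat_close, Var.forall_tuple_pair]
  refine forall_congr' fun y => forall_congr' fun z => ?_
  rw [realize_absDiff_eq_zero, realize_allBlock, realize_distTerm, realize_app1, realize_app1]
  have := M.nonempty_tuple Γ
  refine unitInterval_eq_iSup_iff fun x => ?_
  rw [realize_absDiff M]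
  exact congrArg₂ (fun p q : ℝ => |p - q|) (realize_paramFormula ..) (realize_paramFormula ..)

variable (M) in
theorem expansion_holds_iff : (P.expansion V).Holds M ↔ P.EqSpec M := by
  constructor
  · intro H
    exact
    { base := fun σ hσ => (P.sat_map_base σ).1 (H _ (EqAxiom.base σ hσ))
      dist_self := fun S => (P.sat_dist_self S).1 (H _ (.dist_self S))
      dist_comm := fun S => (P.sat_dist_comm S).1 (H _ (.dist_comm S))
      dist_triangle := fun S => (P.sat_dist_triangle S).1 (H _ (.dist_triangle S))
      prod_dense := fun S F h n => (P.sat_prod_dense S F h n).1 (H _ (.prod_dense S F h n))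
      prod_dist := fun S F h n => (P.sat_prod_dist S F h n).1 (H _ (.prod_dist S F h n))
      defset_image := fun S Γ A h => (P.sat_defset_image S Γ A h).1 (H _ (.defset_image S Γ A h))
      defset_dist := fun S Γ A h => (P.sat_defset_dist S Γ A h).1 (H _ (.defset_dist S Γ A h))
      canon_dist := fun C Γ Δ φ h => (P.sat_canon_dist C Γ Δ φ h).1 (H _ (.canon_dist C Γ Δ φ h))
      canon_dense := fun C Γ Δ φ h =>
        (P.sat_canon_dense C Γ Δ φ h).1 (H _ (.canon_dense C Γ Δ φ h))
      union_cover := fun S Γ n Δ φ h C hC =>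
        (P.sat_union_cover S Γ n Δ φ h C hC).1 (H _ (.union_cover S Γ n Δ φ h C hC))
      union_dist := fun S Γ n Δ φ h C hC j k =>
        (P.sat_union_dist S Γ n Δ φ h C hC j k).1 (H _ (.union_dist S Γ n Δ φ h C hC j k)) }
  · intro H σ hσ
    cases hσ with
    | base σ hσ => exact (P.sat_map_base σ).2 (H.base σ hσ)
    | dist_self S => exact (P.sat_dist_self S).2 (H.dist_self S)
    | dist_comm S => exact (P.sat_dist_comm S).2 (H.dist_comm S)
    | dist_triangle S => exact (P.sat_dist_triangle S).2 (H.dist_triangle S)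
    | prod_dense S F h n => exact (P.sat_prod_dense S F h n).2 (H.prod_dense S F h n)
    | prod_dist S F h n => exact (P.sat_prod_dist S F h n).2 (H.prod_dist S F h n)
    | defset_image S Γ A h => exact (P.sat_defset_image S Γ A h).2 (H.defset_image S Γ A h)
    | defset_dist S Γ A h => exact (P.sat_defset_dist S Γ A h).2 (H.defset_dist S Γ A h)
    | canon_dist C Γ Δ φ h => exact (P.sat_canon_dist C Γ Δ φ h).2 (H.canon_dist C Γ Δ φ h)
    | canon_dense C Γ Δ φ h => exact (P.sat_canon_dense C Γ Δ φ h).2 (H.canon_dense C Γ Δ φ h)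
    | union_cover S Γ n Δ φ h C hC =>
      exact (P.sat_union_cover S Γ n Δ φ h C hC).2 (H.union_cover S Γ n Δ φ h C hC)
    | union_dist S Γ n Δ φ h C hC j k =>
      exact (P.sat_union_dist S Γ n Δ φ h C hC j k).2 (H.union_dist S Γ n Δ φ h C hC j k)

end Theory

/-! ### Restriction to fewer imaginary sorts -/

namespace Var

variable {α : Type u} {β : Type v}

theorem map_cases (f : α → β) : {Γ : List α} → {p : ∀ b, Var (Γ.map f) b → Prop} →
    (∀ {a} (x : Var Γ a), p _ (x.map f)) → ∀ b x, p b x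
  | [], _, _, _, x => nomatch x
  | _ :: _, _, h, _, zero => h zero
  | _ :: _, p, h, b, succ x =>
      map_cases f (p := fun b x => p b x.succ) (fun x => h x.succ) b x

theorem mapElim_eta (f : α → β) {X : β → Type w} {Γ : List α} (e : ∀ b, Var (Γ.map f) b → X b) :
    mapElim f (X := X) Γ (fun _ x => e _ (x.map f)) = e := by
  funext b x
  refine map_cases f (p := fun b x => mapElim f (X := X) Γ (fun a x => e _ (x.map f)) b x = e b x)
    (fun x => ?_) b x
  rw [mapElim_map]

theorem mapElim_surjective (f : α → β) {X : β → Type w} (Γ : List α) :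
    Function.Surjective (mapElim f (X := X) Γ) := fun e => ⟨_, mapElim_eta f e⟩

theorem mapElim_single (f : α → β) {X : β → Type w} {a : α} (x : X (f a)) :
    mapElim f (X := X) [a] (single (X := fun a => X (f a)) x) = single x := by
  funext b y
  cases y with
  | zero => rfl
  | succ y => cases y

theorem all_map_mapElim (f : α → β) {X : β → Type w} {Y : Type*} (G : ∀ b, X b → Y) :
    (Γ : List α) → (e : ∀ a, Var Γ a → X (f a)) →
    (all (Γ.map f)).map (fun p => G p.1 (mapElim f (X := X) Γ e p.1 p.2)) =
      (all Γ).map fun p => G (f p.1) (e p.1 p.2)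
  | [], _ => rfl
  | b :: Γ, e => by
    have ih := all_map_mapElim f G Γ fun a x => e a x.succ
    have h₁ : ∀ (g : (Σ a, Var (f b :: Γ.map f) a) → Y),
        (all (f b :: Γ.map f)).map g =
          g ⟨f b, zero⟩ :: (all (Γ.map f)).map fun p => g ⟨p.1, p.2.succ⟩ := by
      intro g
      rw [all, List.map_cons, List.map_map]
      rfl
    have h₂ : ∀ g : (Σ a, Var (b :: Γ) a) → Y,
        (all (b :: Γ)).map g = g ⟨b, zero⟩ :: (all Γ).map fun p => g ⟨p.1, p.2.succ⟩ := by
      intro g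
      rw [all, List.map_cons, List.map_map]
      rfl
    rw [h₂]
    exact (h₁ _).trans (congrArg (_ :: ·) ih)

@[simp] theorem idx_map (f : α → β) {a : α} : {Γ : List α} → (x : Var Γ a) →
    (x.map f).idx = x.idx
  | _, zero => rfl
  | _, succ x => congrArg (· + 1) (idx_map f x)

theorem maxDist_mapElim (f : α → β) {X : β → Type w} (d : ∀ b, X b → X b → ℝ) :
    (Γ : List α) → (e e' : ∀ a, Var Γ a → X (f a)) →
    maxDist d (mapElim f (X := X) Γ e) (mapElim f (X := X) Γ e') =
      maxDist (X := fun a => X (f a)) (fun a => d (f a)) e e'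
  | [], _, _ => rfl
  | _ :: Γ, _, _ => congrArg (max _) (maxDist_mapElim f d Γ _ _)

/-- Images of concatenated or composed contexts under `List.map` are equal but not always by
definition; this lemma and the following ones move variables across such equalities. -/
theorem cast_succ {a b : α} {Γ Γ' : List α} (h : Γ = Γ') (h' : b :: Γ = b :: Γ') (x : Var Γ a) :
    h' ▸ x.succ = (h ▸ x).succ := by
  subst h
  rfl

theorem cast_map_inl (f : α → β) {a : α} {Δ : List α} : {Γ : List α} → (x : Var Γ a) →
    (h : (Γ ++ Δ).map f = Γ.map f ++ Δ.map f) →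
    h ▸ (x.inl (Δ := Δ)).map f = (x.map f).inl (Δ := Δ.map f)
  | _ :: Γ, zero, h => by
    have : ∀ {Δ Δ' : List β} (h : Δ = Δ') (h' : f a :: Δ = f a :: Δ'),
        h' ▸ (zero : Var (f a :: Δ) (f a)) = zero := by
      intro Δ Δ' h h'
      subst h
      rfl
    exact this List.map_append h
  | b :: Γ, succ x, h => by
    refine (cast_succ (b := f b) (List.map_append (l₁ := Γ)) h _).trans ?_
    exact congrArg succ (cast_map_inl f x _)

theorem cast_map_inr (f : α → β) {a : α} {Δ : List α} : (Γ : List α) → (x : Var Δ a) →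
    (h : (Γ ++ Δ).map f = Γ.map f ++ Δ.map f) → h ▸ (x.inr Γ).map f = (x.map f).inr (Γ.map f)
  | [], _, _ => rfl
  | b :: Γ, x, h => by
    refine (cast_succ (b := f b) (List.map_append (l₁ := Γ)) h _).trans ?_
    exact congrArg succ (cast_map_inr f Γ x _)

theorem cast_map_map {γ : Type w} (f : α → β) (g : β → γ) {a : α} : {Γ : List α} →
    (x : Var Γ a) → (h : (Γ.map f).map g = Γ.map fun a => g (f a)) →
    h ▸ (x.map f).map g = x.map fun a => g (f a)
  | _ :: Γ, zero, h => by
    have : ∀ {Δ Δ' : List γ} (h : Δ = Δ') (h' : g (f a) :: Δ = g (f a) :: Δ'),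
        h' ▸ (zero : Var (g (f a) :: Δ) (g (f a))) = zero := by
      intro Δ Δ' h h'
      subst h
      rfl
    exact this List.map_map h
  | b :: Γ, succ x, h => by
    refine (cast_succ (b := g (f b)) (List.map_map (l := Γ)) h _).trans ?_
    exact congrArg succ (cast_map_map f g x _)

theorem mapElim_mapElim {γ : Type*} (f : α → β) (g : β → γ) {X : γ → Type w} {Γ : List α}
    (e : ∀ a, Var Γ a → X (g (f a))) (h : (Γ.map f).map g = Γ.map fun a => g (f a)) (c : γ)
    (x : Var ((Γ.map f).map g) c) :
    mapElim (fun a => g (f a)) (X := X) Γ e c (h ▸ x) =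
      mapElim g (X := X) (Γ.map f) (mapElim f (X := fun b => X (g b)) Γ e) c x := by
  refine map_cases g (p := fun c x => mapElim (fun a => g (f a)) (X := X) Γ e c (h ▸ x) =
      mapElim g (X := X) (Γ.map f) (mapElim f (X := fun b => X (g b)) Γ e) c x)
    (fun {b} y => ?_) c x
  refine map_cases f (p := fun b y => mapElim (fun a => g (f a)) (X := X) Γ e (g b)
      (h ▸ y.map g) = mapElim g (X := X) (Γ.map f) (mapElim f (X := fun b => X (g b)) Γ e) (g b)
        (y.map g)) (fun {a} x => ?_) b y
  rw [mapElim_map, mapElim_map, cast_map_map]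
  exact mapElim_map (fun a => g (f a)) (X := X) Γ e a x

end Var

/-- A surjective family of maps that commutes with the function symbols and preserves the values of
the relation symbols preserves the values of all formulas. -/
theorem Formula.realize_of_surjective {L : Language.{u}} {M N : Struc L}
    (q : ∀ s, M.carrier s → N.carrier s) (hq : ∀ s, Function.Surjective (q s))
    (hfn : ∀ {Γ : List L.Sorts} {s : L.Sorts} (f : L.Func Γ s) (e : M.Tuple Γ),
      q s (M.fn f e) = N.fn f fun t x => q t (e t x))
    (hrel : ∀ {Γ : List L.Sorts} (R : L.Rel Γ) (e : M.Tuple Γ),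
      N.rel R (fun t x => q t (e t x)) = M.rel R e)
    {Γ : List L.Sorts} (φ : Formula L Γ) (e : M.Tuple Γ) :
    φ.realize N (fun t x => q t (e t x)) = φ.realize M e := by
  have hterm : ∀ {Γ : List L.Sorts} {s : L.Sorts} (t : Term L Γ s) (e : M.Tuple Γ),
      t.realize N (fun t x => q t (e t x)) = q s (t.realize M e) := by
    intro Γ s t e
    induction t with
    | var x => rfl
    | app f ts ih =>
      rw [Term.realize, Term.realize, hfn]
      congr 1
      funext t x
      exact ih t x
  induction φ with
  | rel R ts =>
    rw [Formula.realize, Formula.realize, ← hrel]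
    congr 1
    funext t x
    exact hterm _ e
  | conn n c φ ih =>
    rw [Formula.realize, Formula.realize]
    congr 1
    funext i
    exact ih i e
  | all s φ ih =>
    rw [Formula.realize, Formula.realize, ← (hq s).iSup_comp]
    refine iSup_congr fun a => ?_
    rw [← ih, Var.map_cons (Y := N.carrier) q]
  | ex s φ ih =>
    rw [Formula.realize, Formula.realize, ← (hq s).iInf_comp]
    refine iInf_congr fun a => ?_
    rw [← ih, Var.map_cons (Y := N.carrier) q]

/-- All sorts of the function symbols in a term satisfy `Q`. -/
def Term.SortsIn {L : Language.{u}} (Q : L.Sorts → Prop) {Γ : List L.Sorts} :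
    {s : L.Sorts} → Term L Γ s → Prop
  | _, .var _ => True
  | s, .app _ ts => Q s ∧ ∀ t x, (ts t x).SortsIn Q

/-- All sorts that occur in a formula, except perhaps those of its free variables, satisfy `Q`. -/
def Formula.SortsIn {L : Language.{u}} (Q : L.Sorts → Prop) :
    {Γ : List L.Sorts} → Formula L Γ → Prop
  | _, .rel (Δ := Δ) _ ts => (∀ s, Var Δ s → Q s) ∧ ∀ s x, (ts s x).SortsIn Q
  | _, .conn _ _ φ => ∀ i, (φ i).SortsIn Q
  | _, .all s φ => Q s ∧ φ.SortsIn Q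
  | _, .ex s φ => Q s ∧ φ.SortsIn Q

theorem Term.sortsIn_map {L L' : Language.{u}} (h : LHom L L') {Q : L'.Sorts → Prop}
    (hQ : ∀ s, Q (h.onSort s)) {Γ : List L.Sorts} {s : L.Sorts} (t : Term L Γ s) :
    (t.map h).SortsIn Q := by
  induction t with
  | var x => trivial
  | app f ts ih =>
    refine ⟨hQ _, Var.map_cases h.onSort fun x => ?_⟩
    rw [Var.mapElim_map]
    exact ih _ x

theorem Formula.sortsIn_map {L L' : Language.{u}} (h : LHom L L') {Q : L'.Sorts → Prop}
    (hQ : ∀ s, Q (h.onSort s)) {Γ : List L.Sorts} (φ : Formula L Γ) : (φ.map h).SortsIn Q := by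
  induction φ with
  | rel R ts =>
    refine ⟨Var.map_cases h.onSort fun _ => hQ _, Var.map_cases h.onSort fun x => ?_⟩
    rw [Var.mapElim_map]
    exact Term.sortsIn_map h hQ _
  | conn n c φ ih => exact ih
  | all s φ ih => exact ⟨hQ s, ih⟩
  | ex s φ ih => exact ⟨hQ s, ih⟩

namespace NameSet

variable {L : Language.{u}} {V V' : NameSet L} (hV : V.carrier ⊆ V'.carrier)

/-- The inclusion of the sorts of a smaller set of names. -/
def inc (S : V.Srt) : V'.Srt := ⟨S.1, hV S.2⟩

theorem names_map_inc (Γ : List V.Srt) : names (Γ.map (inc hV)) = names Γ := by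
  rw [names, List.map_map]
  rfl

/-- The inclusion of the expansion by fewer imaginary sorts. -/
abbrev incHom : LHom V.lang V'.lang where
  onSort := inc hV
  onFunc
    | .base f hΔ hS => .base f ((names_map_inc hV _).trans hΔ) hS
    | .proj F h n => .proj (fun n => inc hV (F n)) h n
    | .incl Γ A h i => .incl (Γ.map (inc hV)) A (by rw [names_map_inc]; exact h) (i.map (inc hV))
    | .quot Γ Δ φ h => .quot (Γ.map (inc hV)) (Δ.map (inc hV)) φ
        (by rw [names_map_inc, names_map_inc]; exact h)
    | .inj Γ n Δ φ h j hC => .inj (Γ.map (inc hV)) n (fun j => (Δ j).map (inc hV)) φ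
        (by simp only [names_map_inc]; exact h) j
        (by rw [names_map_inc, names_map_inc]; exact hC)
  onRel
    | .base R hΔ => .base R ((names_map_inc hV _).trans hΔ)
    | .dist S h => .dist (inc hV S) h

theorem erase_map_incHom_term {Γ : List V.lang.Sorts} {s : V.lang.Sorts} (t : Term V.lang Γ s) :
    (t.map (incHom hV)).erase = t.erase := by
  induction t with
  | var x => exact congrArg TermName.var (Var.idx_map _ x)
  | @app Δ s f ts ih =>
    have hargs : (Var.all (Δ.map (inc hV))).map (fun p =>
        (Var.mapElim (inc hV) (X := Term V'.lang (Γ.map (inc hV))) Δ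
          (fun t x => (ts t x).map (incHom hV)) p.1 p.2).erase) =
        (Var.all Δ).map fun p => (ts p.1 p.2).erase := by
      rw [Var.all_map_mapElim (inc hV) (X := Term V'.lang (Γ.map (inc hV)))
        (fun b t => t.erase)]
      exact List.map_congr_left fun p _ => ih p.1 p.2
    cases f with
    | base f hΔ hS => exact congrArg (TermName.baseFn f) hargs
    | proj F h n => exact congrArg (TermName.newFn _ n) hargs
    | incl Γ A h i =>
      refine congr (congr (congrArg TermName.newFn ?_) (Var.idx_map _ i)) hargs
      rw [names_map_inc]
    | quot Γ Δ φ h =>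
      refine congr (congr (congrArg TermName.newFn ?_) rfl) hargs
      rw [names_map_inc, names_map_inc]
    | inj Γ n Δ φ h j hC =>
      refine congr (congr (congrArg TermName.newFn ?_) rfl) hargs
      simp only [names_map_inc]

/-- The name of a formula does not depend on the set of imaginary sorts over which it is built. -/
theorem erase_map_incHom {Γ : List V.lang.Sorts} (φ : Formula V.lang Γ) :
    (φ.map (incHom hV)).erase = φ.erase := by
  induction φ with
  | @rel Γ Δ R ts =>
    have hargs : (Var.all (Δ.map (inc hV))).map (fun p =>
        (Var.mapElim (inc hV) (X := Term V'.lang (Γ.map (inc hV))) Δ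
          (fun t x => (ts t x).map (incHom hV)) p.1 p.2).erase) =
        (Var.all Δ).map fun p => (ts p.1 p.2).erase := by
      rw [Var.all_map_mapElim (inc hV) (X := Term V'.lang (Γ.map (inc hV)))
        (fun b t => t.erase)]
      exact List.map_congr_left fun p _ => erase_map_incHom_term hV _
    cases R with
    | base R hΔ => exact congrArg (FormulaName.baseRel R) hargs
    | dist S h => exact congrArg (FormulaName.newDist S.1) hargs
  | conn n c φ ih => exact congrArg (FormulaName.conn n c) (funext ih)
  | all s φ ih => exact congrArg (FormulaName.all s.1) ih
  | ex s φ ih => exact congrArg (FormulaName.ex s.1) ih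

/-- A formula over a smaller set of names, in a context that is equal, perhaps not by definition, to
the image of its own. -/
theorem exists_map_inc {Γ : List V.Srt} (φ : Formula V.lang Γ) {Γ' : List V'.Srt}
    (hΓ : Γ.map (inc hV) = Γ') : ∃ φ' : Formula V'.lang Γ', φ'.erase = φ.erase ∧
      (∀ Q : V'.Srt → Prop, (∀ S : V.Srt, Q (inc hV S)) → φ'.SortsIn Q) ∧
      ∀ (M : Struc V'.lang) (e : (M.reduct (incHom hV)).Tuple Γ) (e' : M.Tuple Γ'),
        (∀ s x, e' _ (hΓ ▸ x.map (inc hV)) = e s x) →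
          φ'.realize M e' = φ.realize (M.reduct (incHom hV)) e := by
  subst hΓ
  refine ⟨φ.map (incHom hV), erase_map_incHom hV φ, fun Q hQ => φ.sortsIn_map _ hQ,
    fun M e e' h => ?_⟩
  rw [Formula.realize_map]
  congr 1
  funext s x
  exact h s x

theorem exists_map_inc_append {Γ Δ : List V.Srt} (φ : Formula V.lang (Γ ++ Δ)) :
    ∃ φ' : Formula V'.lang (Γ.map (inc hV) ++ Δ.map (inc hV)), φ'.erase = φ.erase ∧
      (∀ Q : V'.Srt → Prop, (∀ S : V.Srt, Q (inc hV S)) → φ'.SortsIn Q) ∧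
      ∀ (M : Struc V'.lang) (x : (M.reduct (incHom hV)).Tuple Γ)
        (y : (M.reduct (incHom hV)).Tuple Δ),
        φ'.realize M (Var.append (X := M.carrier) (Var.mapElim (inc hV) (X := M.carrier) Γ x)
          (Var.mapElim (inc hV) (X := M.carrier) Δ y)) =
        φ.realize (M.reduct (incHom hV))
          (Var.append (X := (M.reduct (incHom hV)).carrier) x y) := by
  obtain ⟨φ', h₁, h₂, h₃⟩ := exists_map_inc hV φ List.map_append
  refine ⟨φ', h₁, h₂, fun M x y => h₃ M _ _ fun s => Var.append_cases Γ (fun v => ?_) fun v => ?_⟩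
  · rw [Var.cast_map_inl, Var.append_inl, Var.append_inl]
    exact Var.mapElim_map (inc hV) (X := M.carrier) Γ x s v
  · rw [Var.cast_map_inr, Var.append_inr, Var.append_inr]
    exact Var.mapElim_map (inc hV) (X := M.carrier) Δ y s v

end NameSet

namespace Theory

open NameSet Formula

variable (P : Theory.{u}) {V V' : NameSet P.L} (hV : V.carrier ⊆ V'.carrier) (M : Struc V'.lang)

/-- The reducts to the base language agree. -/
theorem realize_reduct_reduct {Γ : List P.L.Sorts} (φ : Formula P.L Γ)
    (e : (M.reduct V'.baseHom).Tuple Γ) :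
    φ.realize ((M.reduct (incHom hV)).reduct V.baseHom) e =
      φ.realize (M.reduct V'.baseHom) e := by
  refine realize_of_surjective (M := M.reduct V'.baseHom)
    (N := (M.reduct (incHom hV)).reduct V.baseHom) (fun s a => a)
    (fun s => Function.surjective_id) ?_ ?_ φ e
  · intro Γ s f e
    have key : ∀ {Δ Δ' : List V'.Srt} (h : Δ = Δ') (e : M.Tuple Δ) (e' : M.Tuple Δ')
        (hΔ : names Δ = Γ.map Name.base) (hΔ' : names Δ' = Γ.map Name.base),
        (∀ s x, e' s (h ▸ x) = e s x) → M.fn (EqFunc.base f hΔ' (S := V'.base s) rfl) e' =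
          M.fn (EqFunc.base f hΔ (S := V'.base s) rfl) e := by
      intro Δ Δ' h e e' hΔ hΔ' he
      subst h
      congr 1
      funext s x
      exact he s x
    refine key (List.map_map (f := V.base) (g := inc hV) (l := Γ)) _
      (Var.mapElim V'.base (X := M.carrier) Γ e) _ (V'.names_map_base Γ) ?_
    exact Var.mapElim_mapElim V.base (inc hV) (X := M.carrier) (Γ := Γ) e _
  · intro Γ R e
    have key : ∀ {Δ Δ' : List V'.Srt} (h : Δ = Δ') (e : M.Tuple Δ) (e' : M.Tuple Δ')
        (hΔ : names Δ = Γ.map Name.base) (hΔ' : names Δ' = Γ.map Name.base),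
        (∀ s x, e' s (h ▸ x) = e s x) → M.rel (EqRel.base R hΔ) e =
          M.rel (EqRel.base R hΔ') e' := by
      intro Δ Δ' h e e' hΔ hΔ' he
      subst h
      congr 1
      funext s x
      exact (he s x).symm
    refine key (List.map_map (f := V.base) (g := inc hV) (l := Γ)) _
      (Var.mapElim V'.base (X := M.carrier) Γ e) _ (V'.names_map_base Γ) ?_
    exact Var.mapElim_mapElim V.base (inc hV) (X := M.carrier) (Γ := Γ) e _

theorem dist_reduct_incHom {S : V.Srt} (a b : (M.reduct (incHom hV)).carrier S) :
    (P.expansion V).dist (M.reduct (incHom hV)) a b =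
      (P.expansion V').dist M (s := inc hV S) a b := by
  have key : ∀ (S : V.Srt) (hS : S.1.IsNew) (a b : (M.reduct (incHom hV)).carrier S),
      (M.reduct (incHom hV)).rel (EqRel.dist S hS)
        (Var.pair (X := (M.reduct (incHom hV)).carrier) a b) =
      M.rel (EqRel.dist (inc hV S) hS)
        (Var.pair (X := M.carrier) (a := inc hV S) (b := inc hV S) a b) := by
    intro S hS a b
    refine congrArg (M.rel (EqRel.dist (inc hV S) hS)) ?_
    funext T x
    refine Var.map_cases (inc hV) (Γ := [S, S]) (p := fun T x =>
      Var.mapElim (inc hV) (X := M.carrier) [S, S]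
        (Var.pair (X := fun S => M.carrier (inc hV S)) a b) T x =
          Var.pair (X := M.carrier) (a := inc hV S) (b := inc hV S) a b T x) (fun {T} x => ?_) T x
    refine (Var.mapElim_map (inc hV) (X := M.carrier) [S, S] _ _ x).trans ?_
    cases x with
    | zero => rfl
    | succ x =>
      cases x with
      | zero => rfl
      | succ x => cases x
  obtain ⟨S, hS⟩ := S
  cases S with
  | base s =>
    have h1 := P.dist_reduct V (M.reduct (incHom hV)) s a b
    have h2 := P.dist_reduct V' M s a b
    refine h1.symm.trans (Eq.trans ?_ h2)
    exact congrArg Subtype.val (P.realize_reduct_reduct hV M (P.d s) _)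
  | prod F => exact congrArg Subtype.val (key ⟨.prod F, hS⟩ trivial a b)
  | defset Γ A => exact congrArg Subtype.val (key ⟨.defset Γ A, hS⟩ trivial a b)
  | canon Γ Δ φ => exact congrArg Subtype.val (key ⟨.canon Γ Δ φ, hS⟩ trivial a b)
  | union Γ n Δ φ => exact congrArg Subtype.val (key ⟨.union Γ n Δ φ, hS⟩ trivial a b)

end Theory

/-! ### Reducts, definable sets, and induction on imaginary sorts -/

namespace Theory

open NameSet Formula

section Restrict

variable (P : Theory.{u}) {V V' : NameSet P.L} (hV : V.carrier ⊆ V'.carrier) (M : Struc V'.lang)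

theorem reduct_incHom_fn_single {S T : V.Srt} (f : V.EqFunc [S] T)
    (z : (M.reduct (incHom hV)).carrier S) :
    (M.reduct (incHom hV)).fn (Γ := [S]) (s := T) f
        (Var.single (X := (M.reduct (incHom hV)).carrier) z) =
      M.fn (Γ := [inc hV S]) (s := inc hV T) ((incHom hV).onFunc f)
        (Var.single (X := M.carrier) (a := inc hV S) z) :=
  congrArg (M.fn (Γ := [inc hV S]) ((incHom hV).onFunc f))
    (Var.mapElim_single (inc hV) (X := M.carrier) z)

theorem tupDist_reduct_incHom {Γ : List V.Srt} (e e' : (M.reduct (incHom hV)).Tuple Γ) :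
    (P.expansion V).tupDist (M.reduct (incHom hV)) e e' =
      (P.expansion V').tupDist M (Var.mapElim (inc hV) (X := M.carrier) Γ e)
        (Var.mapElim (inc hV) (X := M.carrier) Γ e') := by
  refine Eq.trans ?_ (Var.maxDist_mapElim (inc hV) (X := M.carrier)
    (fun _ a b => (P.expansion V').dist M a b) Γ e e').symm
  exact Var.maxDist_congr _ _ _ _ _ _ fun s x => P.dist_reduct_incHom hV M _ _

theorem paramVal_reduct_incHom {Γ Δ : List V.Srt} (φ : Formula V.lang (Γ ++ Δ))
    (φ' : Formula V'.lang (Γ.map (inc hV) ++ Δ.map (inc hV)))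
    (hφ : ∀ (x : (M.reduct (incHom hV)).Tuple Γ) (y : (M.reduct (incHom hV)).Tuple Δ),
        φ'.realize M (Var.append (X := M.carrier) (Var.mapElim (inc hV) (X := M.carrier) Γ x)
          (Var.mapElim (inc hV) (X := M.carrier) Δ y)) =
        φ.realize (M.reduct (incHom hV))
          (Var.append (X := (M.reduct (incHom hV)).carrier) x y))
    (he : φ'.erase = φ.erase) {C : V.Srt} (hC : C.1 = Name.canon (names Γ) (names Δ) φ.erase)
    (hC' : (inc hV C).1 = Name.canon (names (Γ.map (inc hV))) (names (Δ.map (inc hV))) φ'.erase)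
    (x : (M.reduct (incHom hV)).Tuple Γ) (z : (M.reduct (incHom hV)).carrier C) :
    P.paramVal (M.reduct (incHom hV)) Γ Δ φ hC x z =
      P.paramVal M (Γ.map (inc hV)) (Δ.map (inc hV)) φ' hC'
        (Var.mapElim (inc hV) (X := M.carrier) Γ x) z := by
  refine Eq.trans ?_ ((Var.mapElim_surjective (inc hV) (X := M.carrier) Δ).iInf_comp _)
  refine iInf_congr fun y => ?_
  refine Eq.trans ?_ (congrArg (fun r : unitInterval => min ((r : ℝ) + _) 1) (hφ x y).symm)
  refine congrArg (fun r => min (_ + r) 1) ?_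
  rw [P.dist_reduct_incHom hV M]
  simp only [he]
  rfl

/-- The axioms of the expansion by the sorts in `V'` contain those of the expansion by the sorts in
`V ⊆ V'`. The quantitative form `EqSpec` of the axioms is used, since the two languages have
different sets of sorts, and the formulas that occur in the axioms are compared by their values. -/
theorem EqSpec.reduct {M : Struc V'.lang} (H : P.EqSpec M) :
    P.EqSpec (M.reduct (incHom hV)) where
  base σ hσ := by
    rw [Struc.Sat]
    exact (P.realize_reduct_reduct hV M σ Var.nil).trans (H.base σ hσ)
  dist_self S a := (P.dist_reduct_incHom hV M a a).trans (H.dist_self _ _)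
  dist_comm S a b := by
    rw [P.dist_reduct_incHom hV M, P.dist_reduct_incHom hV M]
    exact H.dist_comm _ _ _
  dist_triangle S a b c := by
    rw [P.dist_reduct_incHom hV M, P.dist_reduct_incHom hV M, P.dist_reduct_incHom hV M]
    exact H.dist_triangle _ _ _ _
  prod_dense S F h n e ε hε := by
    obtain ⟨y, hy⟩ := H.prod_dense (inc hV S) (fun n => inc hV (F n)) h n
      (Var.mapElim (fun n => inc hV (F n)) (X := M.carrier) (List.range n)
        fun i x => e _ (x.map F)) ε hε
    refine ⟨y, fun i x => ?_⟩
    have := hy i x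
    have h' := Var.mapElim_map (fun n => inc hV (F n)) (X := M.carrier) (List.range n)
      (fun i x => e _ (x.map F)) i x
    rw [P.dist_reduct_incHom hV M]
    refine le_of_eq_of_le (congrArg₂ ((P.expansion V').dist M (s := inc hV (F i))) ?_ h'.symm) this
    exact reduct_incHom_fn_single P hV M (EqFunc.proj F h i) y
  prod_dist S F h n a b := by
    refine le_of_eq_of_le ?_ (H.prod_dist (inc hV S) (fun n => inc hV (F n)) h n a b)
    rw [P.dist_reduct_incHom hV M]
    refine congrArg (fun r => |_ - r|) (Finset.sum_congr rfl fun i _ => ?_)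
    rw [P.dist_reduct_incHom hV M]
    exact congrArg (· / _) (congrArg₂ ((P.expansion V').dist M (s := inc hV (F i)))
      (reduct_incHom_fn_single P hV M (EqFunc.proj F h i) a).symm
      (reduct_incHom_fn_single P hV M (EqFunc.proj F h i) b).symm)
  defset_image S Γ A h e := by
    obtain ⟨A', hA', -, hA⟩ := exists_map_inc hV A rfl
    have h' : (inc hV S).1 = Name.defset (names (Γ.map (inc hV))) A'.erase := by
      rw [hA', names_map_inc]
      exact h
    have key := H.defset_image (inc hV S) _ A' h' (Var.mapElim (inc hV) (X := M.carrier) Γ e)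
    rw [hA M e _ fun s x => Var.mapElim_map (inc hV) (X := M.carrier) Γ e s x] at key
    refine Eq.mp (congrArg₂ IsGLB (congrArg Set.range (funext fun y => ?_)) rfl) key
    rw [P.tupDist_reduct_incHom hV M]
    refine congrArg ((P.expansion V').tupDist M _) ?_
    rw [← Var.mapElim_eta (inc hV) (X := M.carrier) (inclFn M _ A'.erase h' y)]
    congr 1
    funext s x
    refine Eq.trans ?_ (reduct_incHom_fn_single P hV M _ y).symm
    simp only [inclFn, hA']
  defset_dist S Γ A h a b := by
    obtain ⟨A', hA', -, hA⟩ := exists_map_inc hV A rfl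
    have h' : (inc hV S).1 = Name.defset (names (Γ.map (inc hV))) A'.erase := by
      rw [hA', names_map_inc]
      exact h
    have key : ∀ y, inclFn M _ A'.erase h' y = Var.mapElim (inc hV) (X := M.carrier) Γ
        (inclFn (M.reduct (incHom hV)) Γ A.erase h y) := by
      intro y
      rw [← Var.mapElim_eta (inc hV) (X := M.carrier) (inclFn M _ A'.erase h' y)]
      congr 1
      funext s x
      refine Eq.trans ?_ (reduct_incHom_fn_single P hV M _ y).symm
      simp only [inclFn, hA']
    rw [P.dist_reduct_incHom hV M, P.tupDist_reduct_incHom hV M]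
    refine (H.defset_dist (inc hV S) _ A' h' a b).trans ?_
    exact congrArg₂ _ (key a) (key b)
  canon_dist C Γ Δ φ h b c := by
    obtain ⟨φ', hφ', -, hφ⟩ := exists_map_inc_append hV φ
    have h' : (inc hV C).1 =
        Name.canon (names (Γ.map (inc hV))) (names (Δ.map (inc hV))) φ'.erase := by
      rw [hφ', names_map_inc, names_map_inc]
      exact h
    have key := H.canon_dist (inc hV C) _ _ φ' h' (Var.mapElim (inc hV) (X := M.carrier) Δ b)
      (Var.mapElim (inc hV) (X := M.carrier) Δ c)
    rw [← (Var.mapElim_surjective (inc hV) (X := M.carrier) Γ).range_comp] at key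
    rw [P.dist_reduct_incHom hV M]
    refine Eq.mp (congrArg₂ IsLUB (congrArg Set.range (funext fun x => ?_)) ?_) key
    · simp only [Function.comp, hφ]
    · simp only [hφ']
      rfl
  canon_dense C Γ Δ φ h z ε hε := by
    obtain ⟨φ', hφ', -, hφ⟩ := exists_map_inc_append hV φ
    have h' : (inc hV C).1 =
        Name.canon (names (Γ.map (inc hV))) (names (Δ.map (inc hV))) φ'.erase := by
      rw [hφ', names_map_inc, names_map_inc]
      exact h
    obtain ⟨b, hb⟩ := H.canon_dense (inc hV C) _ _ φ' h' z ε hε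
    obtain ⟨b, rfl⟩ := Var.mapElim_surjective (inc hV) (X := M.carrier) Δ b
    refine ⟨b, ?_⟩
    rw [P.dist_reduct_incHom hV M]
    simp only [hφ'] at hb
    exact hb
  union_cover S Γ n Δ φ h C hC x := by
    choose φ' hφ' _ hφ using fun j => exists_map_inc_append hV (φ j)
    have h' : (inc hV S).1 = Name.union (names (Γ.map (inc hV))) n
        (fun j => names ((Δ j).map (inc hV))) (fun j => (φ' j).erase) := by
      simp only [hφ', names_map_inc]
      exact h
    have hC' : ∀ j, (inc hV (C j)).1 = Name.canon (names (Γ.map (inc hV)))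
        (names ((Δ j).map (inc hV))) (φ' j).erase := by
      intro j
      rw [hφ', names_map_inc, names_map_inc]
      exact hC j
    obtain ⟨j, hj⟩ := H.union_cover (inc hV S) _ n _ φ' h' (fun j => inc hV (C j)) hC' x
    refine ⟨j, fun ε hε => ?_⟩
    obtain ⟨y, hy⟩ := hj ε hε
    refine ⟨y, ?_⟩
    rw [P.dist_reduct_incHom hV M]
    refine le_of_eq_of_le (congrArg ((P.expansion V').dist M (s := inc hV S) x) ?_) hy
    refine (reduct_incHom_fn_single P hV M _ y).trans ?_
    simp only [hφ']
    rfl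
  union_dist S Γ n Δ φ h C hC j k y z := by
    choose φ' hφ' _ hφ using fun j => exists_map_inc_append hV (φ j)
    have h' : (inc hV S).1 = Name.union (names (Γ.map (inc hV))) n
        (fun j => names ((Δ j).map (inc hV))) (fun j => (φ' j).erase) := by
      simp only [hφ', names_map_inc]
      exact h
    have hC' : ∀ j, (inc hV (C j)).1 = Name.canon (names (Γ.map (inc hV)))
        (names ((Δ j).map (inc hV))) (φ' j).erase := by
      intro j
      rw [hφ', names_map_inc, names_map_inc]
      exact hC j
    have key := H.union_dist (inc hV S) _ n _ φ' h' (fun j => inc hV (C j)) hC' j k y z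
    rw [← (Var.mapElim_surjective (inc hV) (X := M.carrier) Γ).range_comp] at key
    rw [P.dist_reduct_incHom hV M]
    refine Eq.mp (congrArg₂ IsLUB (congrArg Set.range (funext fun x => ?_)) ?_) key
    · rw [P.paramVal_reduct_incHom hV M (φ j) (φ' j) (hφ j M) (hφ' j) (hC j) (hC' j),
        P.paramVal_reduct_incHom hV M (φ k) (φ' k) (hφ k M) (hφ' k) (hC k) (hC' k)]
      rfl
    · simp only [hφ']
      exact congrArg₂ ((P.expansion V').dist M (s := inc hV S))
        (reduct_incHom_fn_single P hV M (EqFunc.inj Γ n Δ (fun j => (φ j).erase) h j (hC j)) y).symm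
        (reduct_incHom_fn_single P hV M (EqFunc.inj Γ n Δ (fun j => (φ j).erase) h k (hC k)) z).symm

end Restrict

/-- The meaning of definability of a set in a structure. -/
structure DefinableIn (P : Theory.{u}) (M : Struc P.L) {Γ : List P.L.Sorts}
    (A : Formula P.L Γ) : Prop where
  exists_near (x : M.Tuple Γ) (ε : ℝ) (hε : 0 < ε) :
    ∃ y, (A.realize M y : ℝ) ≤ ε ∧ |(A.realize M x : ℝ) - P.tupDist M x y| ≤ ε
  isGLB (x : M.Tuple Γ) :
    IsGLB (Set.range fun y => min ((A.realize M y : ℝ) + P.tupDist M x y) 1) (A.realize M x)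

theorem isDefinableSet_iff (P : Theory.{u}) {Γ : List P.L.Sorts} (A : Formula P.L Γ) :
    P.IsDefinableSet A ↔ ∀ M, P.Holds M → P.DefinableIn M A := by
  have key : ∀ M : Struc P.L, (M.Sat (Formula.close (Formula.exBlock Γ
      (.max (A.subst fun _ v => .var v.inl) (.absDiff (A.subst fun _ v => .var (v.inr Γ))
        (.distTuple P.d (fun _ v => .var (v.inr Γ)) fun _ v => .var v.inl))))) ∧
      M.Sat (Formula.close (.absDiff A (Formula.exBlock Γ
        (.plus (A.subst fun _ v => .var v.inl)
          (.distTuple P.d (fun _ v => .var (v.inr Γ)) fun _ v => .var v.inl)))))) ↔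
      P.DefinableIn M A := by
    intro M
    have hl : ∀ x y : M.Tuple Γ, (A.subst fun _ v => .var v.inl).realize M
        (Var.append (X := M.carrier) y x) = A.realize M y := by
      intro x y
      rw [realize_subst]
      simp only [Term.realize, Var.append_inl]
    have hr : ∀ x y : M.Tuple Γ, (A.subst fun _ v => .var (v.inr Γ)).realize M
        (Var.append (X := M.carrier) y x) = A.realize M x := by
      intro x y
      rw [realize_subst]
      simp only [Term.realize, Var.append_inr]
    have hd : ∀ x y : M.Tuple Γ,
        ((distTuple P.d (fun _ v => .var (v.inr Γ)) fun _ v => .var v.inl).realize M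
        (Var.append (X := M.carrier) y x) : ℝ) = P.tupDist M x y := by
      intro x y
      rw [realize_distTuple]
      simp only [Term.realize, Var.append_inl, Var.append_inr]
      rfl
    have := M.nonempty_tuple Γ
    constructor
    · rintro ⟨h₁, h₂⟩
      rw [sat_close] at h₁ h₂
      refine ⟨fun x ε hε => ?_, fun x => ?_⟩
      · have := h₁ x
        rw [realize_exBlock, unitInterval_iInf_eq_zero_iff] at this
        obtain ⟨y, hy⟩ := this ε hε
        rw [realize_max, realize_absDiff, hl, hr, hd, max_le_iff] at hy
        exact ⟨y, hy⟩
      · have := h₂ x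
        rw [realize_absDiff_eq_zero, realize_exBlock] at this
        refine (unitInterval_eq_iInf_iff fun y => ?_).1 this
        rw [realize_plus, hl, hd]
    · rintro ⟨h₁, h₂⟩
      rw [sat_close, sat_close]
      refine ⟨fun x => ?_, fun x => ?_⟩
      · rw [realize_exBlock, unitInterval_iInf_eq_zero_iff]
        intro ε hε
        obtain ⟨y, hy⟩ := h₁ x ε hε
        refine ⟨y, ?_⟩
        rw [realize_max, realize_absDiff, hl, hr, hd, max_le_iff]
        exact hy
      · rw [realize_absDiff_eq_zero, realize_exBlock]
        refine (unitInterval_eq_iInf_iff fun y => ?_).2 (h₂ x)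
        rw [realize_plus, hl, hd]
  rw [IsDefinableSet]
  constructor
  · rintro ⟨h₁, h₂⟩ M hM
    exact (key M).1 ⟨h₁ M hM, h₂ M hM⟩
  · intro h
    exact ⟨fun M hM => ((key M).2 (h M hM)).1, fun M hM => ((key M).2 (h M hM)).2⟩

variable (P : Theory.{u})

theorem DefinableIn.of_surjective {P P' : Theory.{u}} {M : Struc P.L} {M' : Struc P'.L}
    {Γ : List P.L.Sorts} {Γ' : List P'.L.Sorts} {A : Formula P.L Γ} {A' : Formula P'.L Γ'}
    (h : P.DefinableIn M A) (q : M.Tuple Γ → M'.Tuple Γ') (hq : Function.Surjective q)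
    (hA : ∀ e, A'.realize M' (q e) = A.realize M e)
    (hd : ∀ e e', P'.tupDist M' (q e) (q e') = P.tupDist M e e') : P'.DefinableIn M' A' where
  exists_near x ε hε := by
    obtain ⟨x, rfl⟩ := hq x
    obtain ⟨y, hy⟩ := h.exists_near x ε hε
    refine ⟨q y, ?_⟩
    rw [hA, hA, hd]
    exact hy
  isGLB x := by
    obtain ⟨x, rfl⟩ := hq x
    rw [← hq.range_comp]
    simp only [Function.comp_def, hA, hd]
    exact h.isGLB x

/-- A set that is definable over some imaginary sorts stays so over more of them. -/
theorem isDefinableSet_of_subset {V V' : NameSet P.L} (hV : V.carrier ⊆ V'.carrier)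
    {Γ : List V.Srt} {A : Formula V.lang Γ} (hA : (P.expansion V).IsDefinableSet A)
    {A' : Formula V'.lang (Γ.map (inc hV))}
    (hA' : ∀ (M : Struc V'.lang) (e : (M.reduct (incHom hV)).Tuple Γ)
      (e' : M.Tuple (Γ.map (inc hV))), (∀ s x, e' _ (x.map (inc hV)) = e s x) →
        A'.realize M e' = A.realize (M.reduct (incHom hV)) e) :
    (P.expansion V').IsDefinableSet A' := by
  rw [isDefinableSet_iff] at hA ⊢
  intro M hM
  have hM' := (P.expansion_holds_iff _).2 (EqSpec.reduct P hV ((P.expansion_holds_iff M).1 hM))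
  have hr : ∀ e : (M.reduct (incHom hV)).Tuple Γ,
      A'.realize M (Var.mapElim (inc hV) (X := M.carrier) Γ e) =
        A.realize (M.reduct (incHom hV)) e :=
    fun e => hA' M _ _ fun s x => Var.mapElim_map (inc hV) (X := M.carrier) Γ e s x
  have hd : ∀ e e' : (M.reduct (incHom hV)).Tuple Γ, (P.expansion V').tupDist M
      (Var.mapElim (inc hV) (X := M.carrier) Γ e) (Var.mapElim (inc hV) (X := M.carrier) Γ e') =
      (P.expansion V).tupDist (M.reduct (incHom hV)) e e' :=
    fun e e' => (P.tupDist_reduct_incHom hV M e e').symm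
  have h := hA _ hM'
  exact h.of_surjective (fun e : (M.reduct (incHom hV)).Tuple Γ =>
    Var.mapElim (inc hV) (X := M.carrier) Γ e)
    (Var.mapElim_surjective (inc hV) (X := M.carrier) Γ) hr hd

theorem eqSorts_subset {V : NameSet P.L} (hV : P.IsClosed V) :
    P.eqSorts.carrier ⊆ V.carrier := fun _ hS => hS V hV

theorem defset_mem_of_subset {V V' : NameSet P.L} (hV : V.carrier ⊆ V'.carrier)
    (hV' : P.IsClosed V') {Γ : List V.Srt} {A : Formula V.lang Γ}
    (hA : (P.expansion V).IsDefinableSet A) : Name.defset (names Γ) A.erase ∈ V'.carrier := by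
  obtain ⟨A', he, -, hr⟩ := exists_map_inc hV A rfl
  rw [← names_map_inc hV, ← he]
  exact hV'.defset_mem _ A' (P.isDefinableSet_of_subset hV hA hr)

/-- The least closed set of sorts is closed. -/
theorem isClosed_eqSorts : P.IsClosed P.eqSorts where
  prod_mem F V hV := hV.prod_mem fun n => inc (P.eqSorts_subset hV) (F n)
  defset_mem Γ A hA V hV := P.defset_mem_of_subset (P.eqSorts_subset hV) hV hA
  canon_mem Γ Δ φ V hV := by
    obtain ⟨φ', he, -⟩ := exists_map_inc_append (P.eqSorts_subset hV) φ
    rw [← names_map_inc (P.eqSorts_subset hV) Γ, ← names_map_inc (P.eqSorts_subset hV) Δ, ← he]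
    exact hV.canon_mem _ _ φ'
  union_mem Γ n Δ φ V hV := by
    choose φ' he _ using fun j => exists_map_inc_append (P.eqSorts_subset hV) (φ j)
    simp only [← names_map_inc (P.eqSorts_subset hV), ← he]
    exact hV.union_mem _ n _ φ'

/-- Induction on imaginary sorts: every sort of the expansion is built by the four constructions,
from sorts and formulas built before. The sorts that satisfy `Q` form a set of names which is closed
under the constructions, so it contains the least such set. -/
theorem eqSorts_induction {Q : P.eqSorts.Srt → Prop}
    (base : ∀ s, Q (P.eqSorts.base s))
    (prod : ∀ (S : P.eqSorts.Srt) (F : ℕ → P.eqSorts.Srt) (_ : S.1 = Name.prod fun n => (F n).1),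
      (∀ n, Q (F n)) → Q S)
    (defset : ∀ (S : P.eqSorts.Srt) (Γ : List P.eqSorts.Srt) (A : Formula P.eqSorts.lang Γ)
      (_ : S.1 = Name.defset (names Γ) A.erase), P.eq.IsDefinableSet A →
      (∀ s, Var Γ s → Q s) → A.SortsIn Q → Q S)
    (canon : ∀ (C : P.eqSorts.Srt) (Γ Δ : List P.eqSorts.Srt)
      (φ : Formula P.eqSorts.lang (Γ ++ Δ)) (_ : C.1 = Name.canon (names Γ) (names Δ) φ.erase),
      (∀ s, Var Γ s → Q s) → (∀ s, Var Δ s → Q s) → φ.SortsIn Q → Q C)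
    (union : ∀ (S : P.eqSorts.Srt) (Γ : List P.eqSorts.Srt) (n : ℕ)
      (Δ : Fin (n + 1) → List P.eqSorts.Srt) (φ : ∀ j, Formula P.eqSorts.lang (Γ ++ Δ j))
      (_ : S.1 = Name.union (names Γ) n (fun j => names (Δ j)) (fun j => (φ j).erase))
      (C : Fin (n + 1) → P.eqSorts.Srt)
      (_ : ∀ j, (C j).1 = Name.canon (names Γ) (names (Δ j)) (φ j).erase),
      (∀ s, Var Γ s → Q s) → (∀ j s, Var (Δ j) s → Q s) → (∀ j, (φ j).SortsIn Q) →
      (∀ j, Q (C j)) → Q S)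
    (S : P.eqSorts.Srt) : Q S := by
  let W : NameSet P.L :=
    { carrier := {S | ∃ h : S ∈ P.eqSorts.carrier, Q ⟨S, h⟩}
      base_mem := fun s => ⟨P.eqSorts.base_mem s, base s⟩ }
  have hW : W.carrier ⊆ P.eqSorts.carrier := fun S hS => hS.1
  have hQ : ∀ S : W.Srt, Q (inc hW S) := fun S => S.2.2
  have hctx : ∀ (Γ : List W.Srt) s, Var (Γ.map (inc hW)) s → Q s :=
    fun Γ s x => Var.map_cases (inc hW) (p := fun s _ => Q s) (fun _ => hQ _) s x
  have canon' : ∀ (Γ Δ : List W.Srt) (φ : Formula W.lang (Γ ++ Δ)),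
      Name.canon (names Γ) (names Δ) φ.erase ∈ W.carrier := by
    intro Γ Δ φ
    obtain ⟨φ', he, hs, -⟩ := exists_map_inc_append hW φ
    rw [← names_map_inc hW Γ, ← names_map_inc hW Δ, ← he]
    exact ⟨P.isClosed_eqSorts.canon_mem _ _ φ', canon _ _ _ φ' rfl (hctx Γ) (hctx Δ) (hs Q hQ)⟩
  have hcl : P.IsClosed W :=
    { prod_mem := fun F =>
        ⟨P.isClosed_eqSorts.prod_mem fun n => inc hW (F n),
          prod _ (fun n => inc hW (F n)) rfl fun n => hQ _⟩
      defset_mem := fun Γ A hA => by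
        obtain ⟨A', he, hs, hr⟩ := exists_map_inc hW A rfl
        have hA' := P.isDefinableSet_of_subset hW hA hr
        rw [← names_map_inc hW Γ, ← he]
        exact ⟨P.isClosed_eqSorts.defset_mem _ A' hA',
          defset _ _ A' rfl hA' (hctx Γ) (hs Q hQ)⟩
      canon_mem := canon'
      union_mem := fun Γ n Δ φ => by
        choose φ' he hs _ using fun j => exists_map_inc_append hW (φ j)
        have hmem := P.isClosed_eqSorts.union_mem _ n _ φ'
        simp only [← names_map_inc hW, ← he]
        refine ⟨hmem, union ⟨_, hmem⟩ (Γ.map (inc hW)) n (fun j => (Δ j).map (inc hW)) φ' rfl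
          (fun j => inc hW ⟨_, canon' Γ (Δ j) (φ j)⟩) (fun j => ?_) (hctx Γ)
          (fun j => hctx (Δ j)) (fun j => hs j Q hQ) fun j => hQ _⟩
        rw [names_map_inc, names_map_inc, he]
        rfl }
  exact (P.eqSorts_subset hcl S.2).2

end Theory

/-! ### Complete metrics -/

section Metric

variable {X : Type u} {d : X → X → ℝ}

theorem IsCompleteMetric.nonneg (h : IsCompleteMetric d) (a b : X) : 0 ≤ d a b := by
  obtain ⟨m, hm, -⟩ := h
  rw [← hm]
  exact dist_nonneg

theorem IsCompleteMetric.self (h : IsCompleteMetric d) (a : X) : d a a = 0 := by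
  obtain ⟨m, hm, -⟩ := h
  rw [← hm]
  exact m.dist_self a

theorem IsCompleteMetric.eq_of_eq_zero (h : IsCompleteMetric d) {a b : X} (hab : d a b = 0) :
    a = b := by
  obtain ⟨m, hm, -⟩ := h
  rw [← hm] at hab
  exact m.eq_of_dist_eq_zero hab

theorem IsCompleteMetric.comm (h : IsCompleteMetric d) (a b : X) : d a b = d b a := by
  obtain ⟨m, hm, -⟩ := h
  rw [← hm, ← hm]
  exact m.dist_comm a b

theorem IsCompleteMetric.triangle (h : IsCompleteMetric d) (a b c : X) :
    d a c ≤ d a b + d b c := by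
  obtain ⟨m, hm, -⟩ := h
  rw [← hm, ← hm, ← hm]
  exact m.dist_triangle a b c

theorem IsCompleteMetric.exists_lim (h : IsCompleteMetric d) (x : ℕ → X)
    (hx : ∀ ε : ℝ, 0 < ε → ∃ N, ∀ m ≥ N, ∀ n ≥ N, d (x m) (x n) ≤ ε) :
    ∃ a, ∀ ε : ℝ, 0 < ε → ∃ N, ∀ n ≥ N, d (x n) a ≤ ε := by
  obtain ⟨m, hm, hc⟩ := h
  have hcs : CauchySeq x := by
    rw [Metric.cauchySeq_iff]
    intro ε hε
    obtain ⟨N, hN⟩ := hx (ε / 2) (half_pos hε)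
    refine ⟨N, fun m hm' n hn => ?_⟩
    refine (hm _ _).trans_lt ((hN m hm' n hn).trans_lt (half_lt_self hε))
  obtain ⟨a, ha⟩ := cauchySeq_tendsto_of_complete hcs
  rw [Metric.tendsto_atTop] at ha
  refine ⟨a, fun ε hε => ?_⟩
  obtain ⟨N, hN⟩ := ha ε hε
  exact ⟨N, fun n hn => (hm _ _).symm.trans_le (hN n hn).le⟩

theorem IsCompleteMetric.of_exists_lim (h₀ : ∀ a, d a a = 0) (h₁ : ∀ a b, d a b = 0 → a = b)
    (h₂ : ∀ a b, d a b = d b a) (h₃ : ∀ a b c, d a c ≤ d a b + d b c)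
    (h₄ : ∀ x : ℕ → X, (∀ ε : ℝ, 0 < ε → ∃ N, ∀ m ≥ N, ∀ n ≥ N, d (x m) (x n) ≤ ε) →
      ∃ a, ∀ ε : ℝ, 0 < ε → ∃ N, ∀ n ≥ N, d (x n) a ≤ ε) : IsCompleteMetric d := by
  let m : MetricSpace X :=
    { dist := d
      dist_self := h₀
      dist_comm := h₂
      dist_triangle := h₃
      eq_of_dist_eq_zero := fun {a b} => h₁ a b }
  refine ⟨m, fun _ _ => rfl, ?_⟩
  refine Metric.complete_of_cauchySeq_tendsto fun x hx => ?_
  rw [Metric.cauchySeq_iff] at hx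
  obtain ⟨a, ha⟩ := h₄ x fun ε hε => by
    obtain ⟨N, hN⟩ := hx ε hε
    exact ⟨N, fun m hm n hn => (hN m hm n hn).le⟩
  refine ⟨a, Metric.tendsto_atTop.2 fun ε hε => ?_⟩
  obtain ⟨N, hN⟩ := ha (ε / 2) (half_pos hε)
  exact ⟨N, fun n hn => (hN n hn).trans_lt (half_lt_self hε)⟩

theorem IsCompleteMetric.comp_equiv {Y : Type u} (h : IsCompleteMetric d) (e : Y ≃ X) :
    IsCompleteMetric fun a b => d (e a) (e b) := by
  refine .of_exists_lim (fun a => h.self _) (fun a b hab => e.injective (h.eq_of_eq_zero hab))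
    (fun a b => h.comm _ _) (fun a b c => h.triangle _ _ _) fun x hx => ?_
  obtain ⟨a, ha⟩ := h.exists_lim (fun n => e (x n)) hx
  refine ⟨e.symm a, ?_⟩
  simpa using ha

end Metric

/-- A wrapper for points that are identified with functions `J → [0,1]`. -/
structure FamPoint {X J : Type u} (F : X → J → unitInterval) : Type u where
  pt : X

section Family

variable {X J : Type u} (F : X → J → unitInterval)

theorem abs_sub_le_one_of_unitInterval (a b : unitInterval) : |(a : ℝ) - b| ≤ 1 := by
  rw [abs_le]
  constructor <;> linarith [a.2.1, a.2.2, b.2.1, b.2.2]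

theorem bddAbove_range_abs_sub (a b : J → unitInterval) :
    BddAbove (Set.range fun j => |(a j : ℝ) - b j|) := by
  refine ⟨1, ?_⟩
  rintro _ ⟨j, rfl⟩
  exact abs_sub_le_one_of_unitInterval _ _

/-- The supremum distance of functions `J → [0,1]`, as a pseudo-metric on a set of parameters. -/
noncomputable instance : PseudoMetricSpace (FamPoint F) where
  dist b c := ⨆ j, |(F b.pt j : ℝ) - F c.pt j|
  dist_self b := by simp
  dist_comm b c := by simp only [abs_sub_comm]
  dist_triangle a b c := by
    rcases isEmpty_or_nonempty J with h | h
    · simp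
    · refine ciSup_le fun j => (abs_sub_le _ (F b.pt j : ℝ) _).trans (add_le_add ?_ ?_)
      · exact le_ciSup (bddAbove_range_abs_sub (F a.pt) (F b.pt)) j
      · exact le_ciSup (bddAbove_range_abs_sub (F b.pt) (F c.pt)) j

theorem FamPoint.dist_le_one (b c : FamPoint F) : dist b c ≤ 1 :=
  Real.iSup_le (fun _ => abs_sub_le_one_of_unitInterval _ _) zero_le_one

theorem FamPoint.isLUB_dist [Nonempty J] (b c : FamPoint F) :
    IsLUB (Set.range fun j => |(F b.pt j : ℝ) - F c.pt j|) (dist b c) :=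
  isLUB_ciSup (bddAbove_range_abs_sub _ _)

open UniformSpace in
theorem FamPoint.dist_completion_le_one (a b : Completion (FamPoint F)) : dist a b ≤ 1 := by
  refine Completion.induction_on₂ a b (p := fun a b => dist a b ≤ 1)
    (isClosed_le continuous_dist continuous_const) fun a b => ?_
  rw [Completion.dist_eq]
  exact FamPoint.dist_le_one F a b

open UniformSpace in
theorem exists_seq_tendsto_completion (a : Completion (FamPoint F)) :
    ∃ s : ℕ → X, Filter.Tendsto (fun n => ((⟨s n⟩ : FamPoint F) : Completion (FamPoint F)))
      Filter.atTop (nhds a) := by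
  have := Completion.denseRange_coe (α := FamPoint F) a
  obtain ⟨x, hx, hlim⟩ := mem_closure_iff_seq_limit.1 this
  choose s hs using hx
  refine ⟨fun n => (s n).pt, ?_⟩
  simpa only [hs] using hlim

end Family

/-! ### The canonical interpretation of names -/

/-- A large set of values, which contains all elements of the imaginary sorts over `M`: elements of
`M`, sequences, finite tuples and tagged values. -/
inductive Val {L : Language.{u}} (M : Struc L) : Type u
  | base (s : L.Sorts) (a : M.carrier s)
  | seq (f : ℕ → Val M)
  | tup (l : List (Val M))
  | tag (j : ℕ) (v : Val M)

/-- The interpretation of the name of a sort: the set of its elements, its metric, and the functions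
that belong to it. -/
structure Interp (X : Type u) where
  dom : Set X
  dist : X → X → unitInterval
  fn : ℕ → List X → X

/-- The tuples of elements of given sorts. -/
def TupDom {X : Type u} (Γ : List (Interp X)) : Set (List X) :=
  {l | List.Forall₂ (fun v D => v ∈ D.dom) l Γ}

/-- The maximum metric on tuples. -/
noncomputable def listDist {X : Type u} : List (Interp X) → List X → List X → unitInterval
  | D :: Γ, v :: l, w :: m => max (D.dist v w) (listDist Γ l m)
  | _, _, _ => 0

section Interp

variable {L : Language.{u}} {M : Struc L}

/-- The entries of a sequence or a tuple. -/
def Val.nth : Val M → ℕ → Val M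
  | .seq f, n => f n
  | .tup l, n => l.getD n (.tup [])
  | v, _ => v

/-- The list of entries of a tuple. -/
def Val.toList : Val M → List (Val M)
  | .tup l => l
  | _ => []

open Classical in
/-- The element of `M` coded by a value; an arbitrary one for values that do not code any. -/
noncomputable def Val.decode (s : L.Sorts) (v : Val M) : M.carrier s :=
  if h : ∃ a, v = .base s a then h.choose else (M.nonempty s).some

@[simp] theorem Val.decode_base (s : L.Sorts) (a : M.carrier s) :
    (Val.base s a).decode s = a := by
  have h : ∃ b, Val.base s a = .base s b := ⟨a, rfl⟩
  rw [Val.decode, dif_pos h]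
  have := h.choose_spec
  injection this with _ h'
  exact h'.symm

open UniformSpace in
/-- The code of a point of the completion of `X`, for the supremum metric of a family of functions
`J → [0,1]` that is parametrized by `X`: a chosen sequence in `X` which converges to it, itself
coded by means of `κ`. -/
noncomputable def famCode {X J : Type u} (F : X → J → unitInterval) (κ : (ℕ → X) → Val M)
    (a : Completion (FamPoint F)) : Val M :=
  κ (exists_seq_tendsto_completion F a).choose

open UniformSpace Classical in
/-- The sort of canonical parameters of a family `F` of functions `J → [0,1]` that is parametrized
by `X`: the codes of the points of the completion of `X` for the supremum metric, with the distance
`0` by convention for values that are not codes. The functions of the sort are given by `fn` in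
terms of the map `X → Val M` that sends a parameter to its code. -/
noncomputable def famInterp {X J : Type u} (F : X → J → unitInterval) (κ : (ℕ → X) → Val M)
    (fn : (X → Val M) → ℕ → List (Val M) → Val M) : Interp (Val M) where
  dom := Set.range (famCode F κ)
  dist v w :=
    if h : v ∈ Set.range (famCode F κ) ∧ w ∈ Set.range (famCode F κ) then
      ⟨Dist.dist h.1.choose h.2.choose, dist_nonneg, FamPoint.dist_completion_le_one F _ _⟩
    else 0
  fn := fn fun x => famCode F κ ((⟨x⟩ : FamPoint F) : Completion (FamPoint F))

section

variable {X J : Type u} (F : X → J → unitInterval) {κ : (ℕ → X) → Val M}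
  (hκ : Function.Injective κ) (fn : (X → Val M) → ℕ → List (Val M) → Val M)

include hκ

theorem famCode_injective : Function.Injective (famCode F κ) := by
  intro a b hab
  have h := hκ hab
  have ha := (exists_seq_tendsto_completion F a).choose_spec
  have hb := (exists_seq_tendsto_completion F b).choose_spec
  rw [h] at ha
  exact tendsto_nhds_unique ha hb

theorem famInterp_dist (a b : UniformSpace.Completion (FamPoint F)) :
    ((famInterp F κ fn).dist (famCode F κ a) (famCode F κ b) : ℝ) = dist a b := by
  have h : famCode F κ a ∈ Set.range (famCode F κ) ∧ famCode F κ b ∈ Set.range (famCode F κ) :=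
    ⟨⟨a, rfl⟩, ⟨b, rfl⟩⟩
  rw [famInterp]
  simp only
  rw [dif_pos h]
  have ha := famCode_injective F hκ h.1.choose_spec
  have hb := famCode_injective F hκ h.2.choose_spec
  simp only [ha, hb]

theorem isCompleteMetric_famInterp :
    IsCompleteMetric fun v w : (famInterp F κ fn).dom => ((famInterp F κ fn).dist v w : ℝ) := by
  have h : IsCompleteMetric fun a b : UniformSpace.Completion (FamPoint F) => dist a b :=
    ⟨inferInstance, fun _ _ => rfl, inferInstance⟩
  refine Eq.mp (congrArg IsCompleteMetric ?_)
    (h.comp_equiv (Equiv.ofInjective _ (famCode_injective F hκ)).symm)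
  funext v w
  obtain ⟨v, a, rfl⟩ := v
  obtain ⟨w, b, rfl⟩ := w
  refine Eq.trans ?_ (famInterp_dist F hκ fn a b).symm
  exact congrArg₂ dist ((Equiv.ofInjective _ (famCode_injective F hκ)).symm_apply_apply a)
    ((Equiv.ofInjective _ (famCode_injective F hκ)).symm_apply_apply b)

/-- The first axiom of canonical parameters: their distance is the supremum distance of the
functions they stand for. -/
theorem famInterp_isLUB [Nonempty J] (x y : X) :
    IsLUB (Set.range fun j => |(F x j : ℝ) - F y j|)
      ((famInterp F κ fn).dist
        (famCode F κ ((⟨x⟩ : FamPoint F) : UniformSpace.Completion (FamPoint F)))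
        (famCode F κ ((⟨y⟩ : FamPoint F) : UniformSpace.Completion (FamPoint F))) : ℝ) := by
  rw [famInterp_dist F hκ, UniformSpace.Completion.dist_eq]
  exact FamPoint.isLUB_dist F _ _

/-- The second axiom of canonical parameters: the images of parameters are dense. -/
theorem famInterp_dense {v : Val M} (hv : v ∈ (famInterp F κ fn).dom) {ε : ℝ} (hε : 0 < ε) :
    ∃ x, ((famInterp F κ fn).dist
      (famCode F κ ((⟨x⟩ : FamPoint F) : UniformSpace.Completion (FamPoint F))) v : ℝ) ≤ ε := by
  obtain ⟨a, rfl⟩ := hv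
  have ha := (exists_seq_tendsto_completion F a).choose_spec
  rw [Metric.tendsto_atTop] at ha
  obtain ⟨N, hN⟩ := ha ε hε
  refine ⟨(exists_seq_tendsto_completion F a).choose N, ?_⟩
  rw [famInterp_dist F hκ]
  exact (hN N le_rfl).le

end

variable (M) in
/-- Countable products: the sequences. -/
noncomputable def prodInterp (S : ℕ → Interp (Val M)) : Interp (Val M) where
  dom := {v | ∃ f : ℕ → Val M, v = .seq f ∧ ∀ n, f n ∈ (S n).dom}
  dist v w := Set.projIcc 0 1 zero_le_one
    (∑' n, ((S n).dist (v.nth n) (w.nth n) : ℝ) / 2 ^ (n + 1))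
  fn i l := (l.getD 0 (.tup [])).nth i

/-- Definable sets: the zeros of the formula. -/
noncomputable def defsetInterp (Γ : List (Interp (Val M))) (A : List (Val M) → unitInterval) :
    Interp (Val M) where
  dom := {v | ∃ l : List (Val M), v = .tup l ∧ l ∈ TupDom Γ ∧ A l = 0}
  dist v w := listDist Γ v.toList w.toList
  fn i l := (l.getD 0 (.tup [])).nth i

/-- A formula `φ(x, y)` as a family of functions of `x`, parametrized by `y`. -/
def canonFam (Γ Δ : List (Interp (Val M))) (φ : List (Val M) → unitInterval) (b : TupDom Δ)
    (x : TupDom Γ) : unitInterval :=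
  φ (x.1 ++ b.1)

/-- The code of a sequence of tuples. -/
def canonCode (Δ : List (Interp (Val M))) (s : ℕ → TupDom Δ) : Val M :=
  .seq fun n => .tup (s n).1

open Classical in
/-- Canonical parameters of a formula. The quotient map has a junk value at lists that are not
tuples of the sorts of the parameters. -/
noncomputable def canonInterp (Γ Δ : List (Interp (Val M))) (φ : List (Val M) → unitInterval) :
    Interp (Val M) :=
  famInterp (canonFam Γ Δ φ) (canonCode Δ)
    (fun emb _ l => if h : l ∈ TupDom Δ then emb ⟨l, h⟩ else .tup [])

/-- The value `φ(x, z)` for a canonical parameter `z`. -/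
noncomputable def paramInterp (Γ Δ : List (Interp (Val M))) (φ : List (Val M) → unitInterval)
    (x : List (Val M)) (z : Val M) : unitInterval :=
  ⨅ b : TupDom Δ, Set.projIcc 0 1 zero_le_one
    ((φ (x ++ b.1) : ℝ) + (canonInterp Γ Δ φ).dist ((canonInterp Γ Δ φ).fn 0 b.1) z)

/-- The disjoint union of the sorts of canonical parameters of finitely many formulas. -/
abbrev UnionPoint (Γ : List (Interp (Val M))) (n : ℕ) (Δ : Fin (n + 1) → List (Interp (Val M)))
    (φ : Fin (n + 1) → List (Val M) → unitInterval) : Type _ :=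
  Σ j : Fin (n + 1), (canonInterp Γ (Δ j) (φ j)).dom

/-- Finitely many formulas `φ_j(x, y_j)`, as a family of functions of `x` that is parametrized by
all their canonical parameters. -/
noncomputable def unionFam (Γ : List (Interp (Val M))) (n : ℕ)
    (Δ : Fin (n + 1) → List (Interp (Val M))) (φ : Fin (n + 1) → List (Val M) → unitInterval)
    (p : UnionPoint Γ n Δ φ) (x : TupDom Γ) : unitInterval :=
  paramInterp Γ (Δ p.1) (φ p.1) x.1 p.2.1

/-- The code of a sequence of canonical parameters. -/
def unionCode (Γ : List (Interp (Val M))) (n : ℕ) (Δ : Fin (n + 1) → List (Interp (Val M)))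
    (φ : Fin (n + 1) → List (Val M) → unitInterval) (s : ℕ → UnionPoint Γ n Δ φ) : Val M :=
  .seq fun n => .tag (s n).1 (s n).2.1

open Classical in
/-- Finite unions of sorts of canonical parameters: the completion of the disjoint union for the
supremum distance of the functions `φ_j(x, z)` of `x`. -/
noncomputable def unionInterp (Γ : List (Interp (Val M))) (n : ℕ)
    (Δ : Fin (n + 1) → List (Interp (Val M))) (φ : Fin (n + 1) → List (Val M) → unitInterval) :
    Interp (Val M) :=
  famInterp (unionFam Γ n Δ φ) (unionCode Γ n Δ φ)
    (fun emb i l =>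
      if h : ∃ hi : i < n + 1, l.getD 0 (.tup []) ∈ (canonInterp Γ (Δ ⟨i, hi⟩) (φ ⟨i, hi⟩)).dom then
        emb ⟨⟨i, h.1⟩, ⟨l.getD 0 (.tup []), h.2⟩⟩
      else .tup [])

theorem canonCode_injective (Δ : List (Interp (Val M))) : Function.Injective (canonCode Δ) := by
  intro s t h
  injection h with h
  funext n
  have := congrFun h n
  injection this with this
  exact Subtype.ext this

theorem unionCode_injective (Γ : List (Interp (Val M))) (n : ℕ)
    (Δ : Fin (n + 1) → List (Interp (Val M))) (φ : Fin (n + 1) → List (Val M) → unitInterval) :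
    Function.Injective (unionCode Γ n Δ φ) := by
  intro s t h
  injection h with h
  funext k
  have := congrFun h k
  injection this with h₁ h₂
  rcases hs : s k with ⟨i, v, hv⟩
  rcases ht : t k with ⟨j, w, hw⟩
  rw [hs, ht] at h₁ h₂
  obtain rfl := Fin.ext h₁
  simp only at h₂
  subst h₂
  rfl

variable (M) in
/-- The sorts of the base language. -/
noncomputable def baseInterp (d : ∀ s, Formula L [s, s]) (s : L.Sorts) : Interp (Val M) where
  dom := {v | ∃ a, v = .base s a}
  dist v w := (d s).realize M (Var.pair (X := M.carrier) (v.decode s) (w.decode s))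
  fn _ _ := .tup []

/-- Read a list of values as a tuple of elements of `M`. -/
noncomputable def decodeTuple (Γ : List L.Sorts) (l : List (Val M)) : M.Tuple Γ :=
  fun s x => (l.getD x.idx (.tup [])).decode s

variable (M) (d : ∀ s, Formula L [s, s])

mutual

/-- The interpretation of the names of sorts over `M`. Names of sorts, terms and formulas are
interpreted by a mutual recursion, since a sort may be named by a formula with symbols and
quantifiers for other imaginary sorts. -/
noncomputable def interp : Name L → Interp (Val M)
  | .base s => baseInterp M d s
  | .prod S => prodInterp M fun n => interp (S n)
  | .defset Γ A => defsetInterp (interpList Γ) (valueOfFormula A)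
  | .canon Γ Δ φ => canonInterp (interpList Γ) (interpList Δ) (valueOfFormula φ)
  | .union Γ n Δ φ =>
      unionInterp (interpList Γ) n (fun j => interpList (Δ j)) (fun j => valueOfFormula (φ j))

/-- The interpretations of the names in a list. -/
noncomputable def interpList : List (Name L) → List (Interp (Val M))
  | [] => []
  | S :: Γ => interp S :: interpList Γ

/-- The value of the name of a term. -/
noncomputable def valueOfTerm : TermName L → List (Val M) → Val M
  | .var i => fun e => e.getD i (.tup [])
  | .baseFn (Γ := Γ) (s := s) f ts => fun e => .base s (M.fn f (decodeTuple Γ (valueOfTerms ts e)))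
  | .newFn S i ts => fun e => (interp S).fn i (valueOfTerms ts e)

/-- The values of the names of terms in a list. -/
noncomputable def valueOfTerms : List (TermName L) → List (Val M) → List (Val M)
  | [] => fun _ => []
  | t :: ts => fun e => valueOfTerm t e :: valueOfTerms ts e

/-- The value of the name of a formula. -/
noncomputable def valueOfFormula : FormulaName L → List (Val M) → unitInterval
  | .baseRel (Γ := Γ) R ts => fun e => M.rel R (decodeTuple Γ (valueOfTerms ts e))
  | .newDist S ts => fun e =>
      (interp S).dist ((valueOfTerms ts e).getD 0 (.tup [])) ((valueOfTerms ts e).getD 1 (.tup []))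
  | .conn _ c φ => fun e => c fun i => valueOfFormula (φ i) e
  | .all S φ => fun e => ⨆ v : (interp S).dom, valueOfFormula φ (v.1 :: e)
  | .ex S φ => fun e => ⨅ v : (interp S).dom, valueOfFormula φ (v.1 :: e)

end

theorem valueOfTerms_eq_map (ts : List (TermName L)) (e : List (Val M)) :
    valueOfTerms M d ts e = ts.map fun t => valueOfTerm M d t e := by
  induction ts with
  | nil => rfl
  | cons t ts ih => rw [valueOfTerms, List.map_cons, ← ih]

end Interp

/-! ### Completeness of tuples and of definable sets -/

theorem IsCompleteMetric.subtype {X : Type u} {d : X → X → ℝ} (h : IsCompleteMetric d)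
    {p : X → Prop} (hp : ∀ (x : ℕ → X) (a : X), (∀ n, p (x n)) →
      (∀ ε : ℝ, 0 < ε → ∃ N, ∀ n ≥ N, d (x n) a ≤ ε) → p a) :
    IsCompleteMetric fun a b : {x // p x} => d a b := by
  refine .of_exists_lim (fun a => h.self _) (fun a b hab => Subtype.ext (h.eq_of_eq_zero hab))
    (fun a b => h.comm _ _) (fun a b c => h.triangle _ _ _) fun x hx => ?_
  obtain ⟨a, ha⟩ := h.exists_lim (fun n => (x n).1) hx
  exact ⟨⟨a, hp _ a (fun n => (x n).2) ha⟩, ha⟩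

namespace Theory

variable (P : Theory.{u}) {M : Struc P.L}

theorem tupDist_le_iff {Γ : List P.L.Sorts} {e e' : M.Tuple Γ} {r : ℝ} (hr : 0 ≤ r) :
    P.tupDist M e e' ≤ r ↔ ∀ s x, P.dist M (e s x) (e' s x) ≤ r :=
  Var.maxDist_le_iff _ _ _ hr

theorem tupDist_nonneg {Γ : List P.L.Sorts} (e e' : M.Tuple Γ) : 0 ≤ P.tupDist M e e' :=
  Var.maxDist_nonneg _ _ _

theorem dist_le_tupDist {Γ : List P.L.Sorts} (e e' : M.Tuple Γ) {s : P.L.Sorts} (x : Var Γ s) :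
    P.dist M (e s x) (e' s x) ≤ P.tupDist M e e' :=
  Var.le_maxDist (fun _ a b => P.dist M a b) e e' x

theorem exists_forall_var {Γ : List P.L.Sorts} {p : ℕ → ∀ s, Var Γ s → Prop}
    (h : ∀ s x, ∃ N, ∀ n ≥ N, p n s x) : ∃ N, ∀ n ≥ N, ∀ s x, p n s x := by
  induction Γ with
  | nil => exact ⟨0, fun _ _ _ x => nomatch x⟩
  | cons b Γ ih =>
    obtain ⟨N, hN⟩ := ih fun s x => h s x.succ
    obtain ⟨N', hN'⟩ := h b .zero
    refine ⟨max N N', fun n hn s x => ?_⟩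
    cases x with
    | zero => exact hN' n (le_of_max_le_right hn)
    | succ x => exact hN n (le_of_max_le_left hn) s x

variable {P} in
theorem isCompleteMetric_tupDist (hM : ∀ s, IsCompleteMetric fun a b : M.carrier s => P.dist M a b)
    (Γ : List P.L.Sorts) : IsCompleteMetric fun e e' : M.Tuple Γ => P.tupDist M e e' := by
  refine .of_exists_lim (fun e => ?_) (fun e e' h => ?_) (fun e e' => ?_) (fun e e' e'' => ?_)
    fun x hx => ?_
  · exact le_antisymm ((P.tupDist_le_iff le_rfl).2 fun s v => ((hM s).self _).le)
      (P.tupDist_nonneg _ _)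
  · funext s v
    exact (hM s).eq_of_eq_zero (le_antisymm ((P.dist_le_tupDist e e' v).trans h.le)
      (dist_nonneg' _ _ _ _))
  · have : ∀ e e' : M.Tuple Γ, P.tupDist M e e' ≤ P.tupDist M e' e := fun e e' =>
      (P.tupDist_le_iff (P.tupDist_nonneg _ _)).2 fun s v =>
        ((hM s).comm _ _).trans_le (P.dist_le_tupDist e' e v)
    exact le_antisymm (this _ _) (this _ _)
  · refine (P.tupDist_le_iff (add_nonneg (P.tupDist_nonneg _ _) (P.tupDist_nonneg _ _))).2
      fun s v => ((hM s).triangle _ (e' s v) _).trans ?_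
    exact add_le_add (P.dist_le_tupDist e e' v) (P.dist_le_tupDist e' e'' v)
  · have : ∀ s v, ∃ a, ∀ ε : ℝ, 0 < ε → ∃ N, ∀ n ≥ N, P.dist M (x n s v) a ≤ ε := by
      intro s v
      refine (hM s).exists_lim (fun n => x n s v) fun ε hε => ?_
      obtain ⟨N, hN⟩ := hx ε hε
      exact ⟨N, fun m hm n hn => (P.dist_le_tupDist _ _ v).trans (hN m hm n hn)⟩
    choose a ha using this
    refine ⟨a, fun ε hε => ?_⟩
    obtain ⟨N, hN⟩ := exists_forall_var P (p := fun n s v => P.dist M (x n s v) (a s v) ≤ ε)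
      fun s v => ha s v ε hε
    exact ⟨N, fun n hn => (P.tupDist_le_iff hε.le).2 (hN n hn)⟩

variable {P}

theorem DefinableIn.le_add {Γ : List P.L.Sorts} {A : Formula P.L Γ} (h : P.DefinableIn M A)
    (x y : M.Tuple Γ) : (A.realize M x : ℝ) ≤ A.realize M y + P.tupDist M x y :=
  ((h.isGLB x).1 ⟨y, rfl⟩).trans (min_le_left _ _)

/-- In a complete structure, `A(x)` is the distance of `x` to a set of zeros of `A`: points with
small values of `A` can be improved step by step, and the improvements converge. -/
theorem DefinableIn.exists_zero (hM : ∀ s, IsCompleteMetric fun a b : M.carrier s => P.dist M a b)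
    {Γ : List P.L.Sorts} {A : Formula P.L Γ} (h : P.DefinableIn M A) (x : M.Tuple Γ) {ε : ℝ}
    (hε : 0 < ε) : ∃ z, A.realize M z = 0 ∧ P.tupDist M x z ≤ A.realize M x + ε := by
  have hδ : ∀ n : ℕ, 0 < ε / 8 / 2 ^ n := fun n => by positivity
  choose f hf using fun (n : ℕ) (x : M.Tuple Γ) => h.exists_near x (ε / 8 / 2 ^ n) (hδ n)
  let y : ℕ → M.Tuple Γ := fun n => Nat.rec x (fun n y => f n y) n
  have hy : ∀ n, (A.realize M (y (n + 1)) : ℝ) ≤ ε / 8 / 2 ^ n := fun n => (hf n (y n)).1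
  have hyd : ∀ n, P.tupDist M (y n) (y (n + 1)) ≤ A.realize M (y n) + ε / 8 / 2 ^ n := fun n => by
    have := (abs_le.1 (hf n (y n)).2).1
    change P.tupDist M (y n) (f n (y n)) ≤ _
    linarith
  obtain ⟨m, hm, hc⟩ := isCompleteMetric_tupDist hM Γ
  have hstep : ∀ n, Dist.dist (y (n + 1)) (y (n + 1 + 1)) ≤ ε / 2 / 2 / 2 ^ n := by
    intro n
    refine (hm _ _).trans_le ((hyd (n + 1)).trans ?_)
    have h1 := hy n
    have h2 : ε / 8 / 2 ^ (n + 1) ≤ ε / 8 / 2 ^ n := by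
      rw [pow_succ]
      gcongr
      exact le_mul_of_one_le_right (by positivity) one_le_two
    have h3 : ε / 2 / 2 / 2 ^ n = ε / 8 / 2 ^ n + ε / 8 / 2 ^ n := by ring
    rw [h3]
    exact add_le_add h1 h2
  obtain ⟨z, hz⟩ := cauchySeq_tendsto_of_complete (cauchySeq_of_le_geometric_two hstep)
  have hz0 := dist_le_of_le_geometric_two_of_tendsto₀ hstep hz
  refine ⟨z, ?_, ?_⟩
  · rw [Formula.realize_eq_zero_iff]
    refine le_antisymm ?_ (A.realize_nonneg M z)
    have h1 : Filter.Tendsto (fun n : ℕ => ε / 8 / 2 ^ n + Dist.dist (y (n + 1)) z) Filter.atTop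
        (nhds 0) := by
      have h2 : Filter.Tendsto (fun n : ℕ => ε / 8 / 2 ^ n) Filter.atTop (nhds 0) := by
        have := (tendsto_pow_atTop_nhds_zero_of_lt_one (r := (1 / 2 : ℝ)) (by norm_num)
          (by norm_num)).const_mul (ε / 8)
        simpa [div_eq_mul_inv] using this
      simpa using h2.add (tendsto_iff_dist_tendsto_zero.1 hz)
    refine ge_of_tendsto' h1 fun n => (h.le_add z (y (n + 1))).trans ?_
    refine add_le_add (hy n) ?_
    rw [_root_.dist_comm]
    exact (hm _ _).ge
  · refine (hm x z).symm.trans_le ((_root_.dist_triangle x (y 1) z).trans ?_)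
    have h1 := (hm _ _).trans_le (hyd 0)
    change Dist.dist x (y 1) ≤ A.realize M x + _ at h1
    rw [pow_zero, div_one] at h1
    linarith

theorem DefinableIn.isGLB_zeros (hM : ∀ s, IsCompleteMetric fun a b : M.carrier s => P.dist M a b)
    {Γ : List P.L.Sorts} {A : Formula P.L Γ} (h : P.DefinableIn M A) (x : M.Tuple Γ) :
    IsGLB (Set.range fun z : {z // A.realize M z = 0} => P.tupDist M x z) (A.realize M x) := by
  refine ⟨?_, fun r hr => le_of_forall_pos_le_add fun ε hε => ?_⟩
  · rintro _ ⟨⟨z, hz⟩, rfl⟩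
    have := h.le_add x z
    rw [hz] at this
    simpa using this
  · obtain ⟨z, hz, hxz⟩ := h.exists_zero hM x hε
    exact (hr ⟨⟨z, hz⟩, rfl⟩).trans hxz

theorem DefinableIn.isCompleteMetric_zeros
    (hM : ∀ s, IsCompleteMetric fun a b : M.carrier s => P.dist M a b)
    {Γ : List P.L.Sorts} {A : Formula P.L Γ} (h : P.DefinableIn M A) :
    IsCompleteMetric fun z w : {z // A.realize M z = 0} => P.tupDist M z.1 w.1 := by
  refine (isCompleteMetric_tupDist hM Γ).subtype fun x a hx hlim => ?_
  rw [Formula.realize_eq_zero_iff]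
  refine le_antisymm (le_of_forall_pos_le_add fun ε hε => ?_) (A.realize_nonneg M a)
  obtain ⟨N, hN⟩ := hlim ε hε
  have := h.le_add a (x N)
  rw [hx, (isCompleteMetric_tupDist hM Γ).comm] at this
  simpa using this.trans (add_le_add le_rfl (hN N le_rfl))

end Theory

/-! ### Countable products -/

section Prod

variable {X : ℕ → Type u} {d : ∀ n, X n → X n → ℝ}

theorem summable_div_two_pow {a : ℕ → ℝ} (h₀ : ∀ n, 0 ≤ a n) (h₁ : ∀ n, a n ≤ 1) :
    Summable fun n => a n / 2 ^ (n + 1) := by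
  refine Summable.of_nonneg_of_le (fun n => div_nonneg (h₀ n) (by positivity)) (fun n => ?_)
    ((summable_nat_add_iff 1).2 summable_geometric_two)
  rw [one_div, inv_pow, div_eq_mul_inv]
  exact mul_le_of_le_one_left (by positivity) (h₁ n)

theorem tsum_div_two_pow_mem {a : ℕ → ℝ} (h₀ : ∀ n, 0 ≤ a n) (h₁ : ∀ n, a n ≤ 1) :
    ∑' n, a n / 2 ^ (n + 1) ∈ Set.Icc (0 : ℝ) 1 := by
  refine ⟨tsum_nonneg fun n => div_nonneg (h₀ n) (by positivity), ?_⟩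
  refine (summable_div_two_pow h₀ h₁).tsum_le_of_sum_range_le fun n => ?_
  rw [← Fin.sum_univ_eq_sum_range fun i => a i / 2 ^ (i + 1)]
  exact sum_div_two_pow_le_one fun i => h₁ i

theorem abs_tsum_sub_sum_le {a : ℕ → ℝ} (h₀ : ∀ n, 0 ≤ a n) (h₁ : ∀ n, a n ≤ 1) (n : ℕ) :
    |∑' i, a i / 2 ^ (i + 1) - ∑ i : Fin n, a i / 2 ^ ((i : ℕ) + 1)| ≤ 1 / 2 ^ n := by
  have hs := summable_div_two_pow h₀ h₁
  rw [Fin.sum_univ_eq_sum_range fun i => a i / 2 ^ (i + 1), ← hs.sum_add_tsum_nat_add n,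
    add_sub_cancel_left]
  have h := tsum_div_two_pow_mem (fun i => h₀ (i + n)) fun i => h₁ (i + n)
  have e : ∑' i, a (i + n) / 2 ^ (i + n + 1) = (∑' i, a (i + n) / 2 ^ (i + 1)) / 2 ^ n := by
    rw [← tsum_div_const]
    refine tsum_congr fun i => ?_
    rw [div_div, ← pow_add]
    congr 2
    ring
  rw [e, abs_of_nonneg (div_nonneg h.1 (by positivity))]
  exact div_le_div_of_nonneg_right h.2 (by positivity)

theorem isCompleteMetric_prod (hd : ∀ n, IsCompleteMetric (d n)) (h₁ : ∀ n a b, d n a b ≤ 1) :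
    IsCompleteMetric fun f g : ∀ n, X n => ∑' n, d n (f n) (g n) / 2 ^ (n + 1) := by
  have hs : ∀ f g : ∀ n, X n, Summable fun n => d n (f n) (g n) / 2 ^ (n + 1) := fun f g =>
    summable_div_two_pow (fun n => (hd n).nonneg _ _) fun n => h₁ n _ _
  have h₀ : ∀ (f g : ∀ n, X n) (n : ℕ), 0 ≤ d n (f n) (g n) / 2 ^ (n + 1) := fun f g n =>
    div_nonneg ((hd n).nonneg _ _) (by positivity)
  have hle : ∀ (f g : ∀ n, X n) (n : ℕ),
      d n (f n) (g n) ≤ 2 ^ (n + 1) * ∑' n, d n (f n) (g n) / 2 ^ (n + 1) := by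
    intro f g n
    rw [mul_comm, ← div_le_iff₀ (by positivity)]
    exact (hs f g).le_tsum n fun m _ => h₀ f g m
  refine .of_exists_lim (fun f => ?_) (fun f g h => ?_) (fun f g => ?_) (fun f g h => ?_)
    fun x hx => ?_
  · simp [(hd _).self]
  · funext n
    refine (hd n).eq_of_eq_zero (le_antisymm ?_ ((hd n).nonneg _ _))
    have := hle f g n
    rwa [h, mul_zero] at this
  · simp only [(hd _).comm]
  · rw [← (hs f g).tsum_add (hs g h)]
    refine (hs f h).tsum_le_tsum (fun n => ?_) ((hs f g).add (hs g h))
    rw [← add_div]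
    exact div_le_div_of_nonneg_right ((hd n).triangle _ _ _) (by positivity)
  · have hlim : ∀ n, ∃ a, ∀ ε : ℝ, 0 < ε → ∃ N, ∀ k ≥ N, d n (x k n) a ≤ ε := by
      intro n
      refine (hd n).exists_lim (fun k => x k n) fun ε hε => ?_
      obtain ⟨N, hN⟩ := hx (ε / 2 ^ (n + 1)) (by positivity)
      refine ⟨N, fun k hk l hl => (hle _ _ n).trans ?_⟩
      have := mul_le_mul_of_nonneg_left (hN k hk l hl) (show (0 : ℝ) ≤ 2 ^ (n + 1) by positivity)
      rwa [mul_div_cancel₀ _ (by positivity)] at this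
    choose a ha using hlim
    refine ⟨a, fun ε hε => ?_⟩
    obtain ⟨N, hN⟩ := hx ε hε
    refine ⟨N, fun k hk => (hs _ _).tsum_le_of_sum_range_le fun K => ?_⟩
    have ht : ∀ n, Filter.Tendsto (fun l => d n (x l n) (a n)) Filter.atTop (nhds 0) := by
      intro n
      refine Metric.tendsto_atTop.2 fun ε hε => ?_
      obtain ⟨N, hN⟩ := ha n (ε / 2) (half_pos hε)
      refine ⟨N, fun l hl => ?_⟩
      rw [Real.dist_0_eq_abs, abs_of_nonneg ((hd n).nonneg _ _)]
      exact (hN l hl).trans_lt (half_lt_self hε)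
    have ht' : Filter.Tendsto
        (fun l => ε + ∑ n ∈ Finset.range K, d n (x l n) (a n) / 2 ^ (n + 1)) Filter.atTop
        (nhds ε) := by
      have := (tendsto_finsetSum (Finset.range K) fun n _ =>
        (ht n).div_const (2 ^ (n + 1))).const_add ε
      simpa using this
    refine ge_of_tendsto ht' (Filter.eventually_atTop.2 ⟨N, fun l hl => ?_⟩)
    refine le_trans ?_ (add_le_add ((((hs (x k) (x l)).sum_le_tsum (Finset.range K)
      fun n _ => h₀ _ _ n)).trans (hN k hk l hl)) le_rfl)
    rw [← Finset.sum_add_distrib]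
    refine Finset.sum_le_sum fun n _ => ?_
    rw [← add_div]
    exact div_le_div_of_nonneg_right ((hd n).triangle _ _ _) (by positivity)

end Prod

/-! ### The canonical structure on the imaginary elements -/

namespace Var

variable {α : Type u} {X : α → Type w} {Y : Type v}

/-- The list of the entries of a tuple, with the types forgotten by means of `f`. -/
def values (f : ∀ a, X a → Y) {Γ : List α} (e : ∀ a, Var Γ a → X a) : List Y :=
  (all Γ).map fun p => f p.1 (e p.1 p.2)

variable (f : ∀ a, X a → Y)

theorem values_eq_cons {b : α} {Γ : List α} (e : ∀ a, Var (b :: Γ) a → X a) :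
    values f e = f b (e b zero) :: values f fun a x => e a x.succ := by
  rw [values, all, List.map_cons, List.map_map]
  rfl

theorem values_append : {Γ Δ : List α} → (e : ∀ a, Var Γ a → X a) → (e' : ∀ a, Var Δ a → X a) →
    values f (append e e') = values f e ++ values f e'
  | [], _, _, _ => rfl
  | b :: Γ, Δ, e, e' => by
    have h := values_append (fun a x => e a x.succ) e'
    exact (values_eq_cons f (Γ := Γ ++ Δ) (append e e')).trans ((congrArg (_ :: ·) h).trans
      (congrArg (· ++ _) (values_eq_cons f e).symm))

theorem getD_values {a : α} (y : Y) : {Γ : List α} → (e : ∀ a, Var Γ a → X a) → (x : Var Γ a) →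
    (values f e).getD x.idx y = f a (e a x)
  | _ :: Γ, e, zero => by
    rw [values_eq_cons]
    rfl
  | _ :: Γ, e, succ x => by
    rw [values_eq_cons]
    exact getD_values y (fun a x => e a x.succ) x

theorem values_injective (hf : ∀ a, Function.Injective (f a)) {Γ : List α} :
    Function.Injective (values f (Γ := Γ)) := by
  intro e e' h
  funext a x
  have hx : Y := f a (e a x)
  refine hf a ?_
  rw [← getD_values f hx e x, h, getD_values]

end Var

section Canonical

open NameSet Var

variable {L : Language.{u}} (M : Struc L) (d : ∀ s, Formula L [s, s]) {V : NameSet L}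

theorem interp_base (s : L.Sorts) : interp M d (.base s) = baseInterp M d s := by rw [interp]

theorem interp_prod (S : ℕ → Name L) :
    interp M d (.prod S) = prodInterp M fun n => interp M d (S n) := by rw [interp]

theorem interp_defset (Γ : List (Name L)) (A : FormulaName L) :
    interp M d (.defset Γ A) = defsetInterp (interpList M d Γ) (valueOfFormula M d A) := by
  rw [interp]

theorem interp_canon (Γ Δ : List (Name L)) (φ : FormulaName L) :
    interp M d (.canon Γ Δ φ) =
      canonInterp (interpList M d Γ) (interpList M d Δ) (valueOfFormula M d φ) := by
  rw [interp]

theorem interp_union (Γ : List (Name L)) (n : ℕ) (Δ : Fin (n + 1) → List (Name L))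
    (φ : Fin (n + 1) → FormulaName L) :
    interp M d (.union Γ n Δ φ) = unionInterp (interpList M d Γ) n
      (fun j => interpList M d (Δ j)) fun j => valueOfFormula M d (φ j) := by
  rw [interp]

theorem mem_tupDom_single {X : Type u} {D : Interp X} {l : List X} :
    l ∈ TupDom [D] ↔ ∃ v ∈ D.dom, l = [v] := by
  constructor
  · rintro (_ | ⟨h, h'⟩)
    cases h'
    exact ⟨_, h, rfl⟩
  · rintro ⟨v, hv, rfl⟩
    exact .cons hv .nil

variable {M d} in
theorem getD_mem_of_mem_tupDom {s : V.Srt} (y : Val M) : {Γ : List V.Srt} → (x : Var Γ s) →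
    {l : List (Val M)} → l ∈ TupDom (interpList M d (names Γ)) →
    l.getD x.idx y ∈ (interp M d s.1).dom
  | _ :: _, .zero, _, .cons h _ => h
  | _ :: _, .succ x, _, .cons _ h => getD_mem_of_mem_tupDom y x h

/-- The function symbols of the expansion, on values. -/
noncomputable def imagFn {Δ : List V.Srt} {S : V.Srt} : V.EqFunc Δ S → List (Val M) → Val M
  | .base (Γ := Γ) (s := s) f _ _ => fun l => .base s (M.fn f (decodeTuple Γ l))
  | .proj F _ n => (interp M d (.prod fun n => (F n).1)).fn n
  | .incl Γ A _ i => (interp M d (.defset (names Γ) A)).fn i.idx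
  | .quot Γ Δ φ _ => (interp M d (.canon (names Γ) (names Δ) φ)).fn 0
  | .inj Γ n Δ φ _ j _ => (interp M d (.union (names Γ) n (fun j => names (Δ j)) φ)).fn j

/-- The relation symbols of the expansion, on values. -/
noncomputable def imagRel {Δ : List V.Srt} : V.EqRel Δ → List (Val M) → unitInterval
  | .base (Γ := Γ) R _ => fun l => M.rel R (decodeTuple Γ l)
  | .dist S _ => fun l => (interp M d S.1).dist (l.getD 0 (.tup [])) (l.getD 1 (.tup []))

/-- The quotient map takes a tuple of parameters to its code. -/
theorem quotFn_apply {Γ Δ : List (Name L)} {φ : FormulaName L} {l : List (Val M)}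
    (hl : l ∈ TupDom (interpList M d Δ)) :
    (interp M d (.canon Γ Δ φ)).fn 0 l = famCode
      (canonFam (interpList M d Γ) (interpList M d Δ) (valueOfFormula M d φ))
      (canonCode (interpList M d Δ)) ((⟨⟨l, hl⟩⟩ : FamPoint
        (canonFam (interpList M d Γ) (interpList M d Δ) (valueOfFormula M d φ))) :
        UniformSpace.Completion (FamPoint _)) := by
  rw [interp]
  exact dif_pos hl

theorem injFn_apply {Γ : List (Name L)} {n : ℕ} {Δ : Fin (n + 1) → List (Name L)}
    {φ : Fin (n + 1) → FormulaName L} (j : Fin (n + 1)) {v : Val M}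
    (hv : v ∈ (canonInterp (interpList M d Γ) (interpList M d (Δ j))
      (valueOfFormula M d (φ j))).dom) :
    (interp M d (.union Γ n Δ φ)).fn j [v] = famCode
      (unionFam (interpList M d Γ) n (fun j => interpList M d (Δ j))
        (fun j => valueOfFormula M d (φ j)))
      (unionCode _ _ _ _) ((⟨⟨j, v, hv⟩⟩ : FamPoint (unionFam (interpList M d Γ) n
        (fun j => interpList M d (Δ j)) (fun j => valueOfFormula M d (φ j)))) :
        UniformSpace.Completion (FamPoint _)) := by
  rw [interp]
  exact dif_pos (⟨j.2, hv⟩ : ∃ hi : (j : ℕ) < n + 1, [v].getD 0 (.tup []) ∈ _)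

theorem imagFn_mem {Δ : List V.Srt} {S : V.Srt} (f : V.EqFunc Δ S) {l : List (Val M)}
    (hl : l ∈ TupDom (interpList M d (names Δ))) : imagFn M d f l ∈ (interp M d S.1).dom := by
  cases f with
  | base f hΔ hS =>
    rw [hS, interp]
    exact ⟨_, rfl⟩
  | @proj T F h n =>
    obtain ⟨v, hv, rfl⟩ := mem_tupDom_single.1 hl
    rw [h, interp] at hv
    obtain ⟨f, rfl, hf⟩ := hv
    rw [imagFn, interp]
    exact hf n
  | @incl T Γ A h s i =>
    obtain ⟨v, hv, rfl⟩ := mem_tupDom_single.1 hl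
    rw [h, interp] at hv
    obtain ⟨l, rfl, hl, -⟩ := hv
    rw [imagFn, interp]
    exact getD_mem_of_mem_tupDom _ i hl
  | quot Γ Δ φ h =>
    rw [imagFn, quotFn_apply M d hl, h, interp]
    exact ⟨_, rfl⟩
  | @inj T C Γ n Δ φ h j hC =>
    obtain ⟨v, hv, rfl⟩ := mem_tupDom_single.1 hl
    rw [hC, interp] at hv
    rw [imagFn, injFn_apply M d j hv, h, interp]
    exact ⟨_, rfl⟩

/-- The tuple of values of a tuple of imaginary elements. -/
abbrev vals {Γ : List V.Srt} (e : ∀ S, Var Γ S → (interp M d (Subtype.val S)).dom) :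
    List (Val M) :=
  values (X := fun S : V.Srt => (interp M d S.1).dom) (fun _ => Subtype.val) e

theorem vals_mem : {Γ : List V.Srt} → (e : ∀ S, Var Γ S → (interp M d (Subtype.val S)).dom) →
    vals M d e ∈ TupDom (interpList M d (names Γ))
  | [], _ => .nil
  | S :: Γ, e => by
    rw [vals, values_eq_cons]
    exact .cons (e S .zero).2 (vals_mem fun a x => e a x.succ)

variable {M d} in
theorem exists_vals_eq : {Γ : List V.Srt} → {l : List (Val M)} →
    l ∈ TupDom (interpList M d (names Γ)) →
    ∃ e : ∀ S, Var Γ S → (interp M d (Subtype.val S)).dom, vals M d e = l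
  | [], _, .nil => ⟨Var.nil, rfl⟩
  | S :: Γ, _, .cons h h' => by
    obtain ⟨e, rfl⟩ := exists_vals_eq h'
    exact ⟨Var.cons ⟨_, h⟩ e, values_eq_cons _ _⟩

/-- The structure formed by the imaginary elements of the sorts in `V`. -/
noncomputable def imagStruc (hV : ∀ S : V.Srt, (interp M d S.1).dom.Nonempty) : Struc V.lang where
  carrier S := (interp M d S.1).dom
  nonempty S := (hV S).to_subtype
  fn f e := ⟨imagFn M d f (vals M d e), imagFn_mem M d f (vals_mem M d e)⟩
  rel R e := imagRel M d R (vals M d e)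

variable (hV : ∀ S : V.Srt, (interp M d S.1).dom.Nonempty)

theorem coe_realize_imagStruc {Γ : List V.lang.Sorts} {s : V.lang.Sorts} (t : Term V.lang Γ s)
    (e : (imagStruc M d hV).Tuple Γ) :
    (t.realize (imagStruc M d hV) e).1 = valueOfTerm M d t.erase (vals M d e) := by
  induction t with
  | var x =>
    rw [Term.erase, valueOfTerm]
    exact (getD_values (X := fun S : V.Srt => (interp M d S.1).dom) (fun _ => Subtype.val)
      _ e x).symm
  | @app Δ s f ts ih =>
    have h : vals M d (fun t x => (ts t x).realize (imagStruc M d hV) e) =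
        valueOfTerms M d ((all Δ).map fun p => (ts p.1 p.2).erase) (vals M d e) := by
      rw [valueOfTerms_eq_map, List.map_map]
      exact List.map_congr_left fun p _ => ih p.1 p.2
    refine Eq.trans (b := imagFn M d f (vals M d (fun t x =>
      (ts t x).realize (imagStruc M d hV) e))) rfl ?_
    rw [h]
    cases f <;> (rw [Term.erase, valueOfTerm]; rfl)

/-- Formulas have the values in the canonical structure that are prescribed by their names. -/
theorem realize_imagStruc {Γ : List V.lang.Sorts} (φ : Formula V.lang Γ)
    (e : (imagStruc M d hV).Tuple Γ) :
    φ.realize (imagStruc M d hV) e = valueOfFormula M d φ.erase (vals M d e) := by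
  induction φ with
  | @rel Γ Δ R ts =>
    have h : vals M d (fun t x => (ts t x).realize (imagStruc M d hV) e) =
        valueOfTerms M d ((all Δ).map fun p => (ts p.1 p.2).erase) (vals M d e) := by
      rw [valueOfTerms_eq_map, List.map_map]
      exact List.map_congr_left fun p _ => coe_realize_imagStruc M d hV _ _
    refine Eq.trans (b := imagRel M d R (vals M d (fun t x =>
      (ts t x).realize (imagStruc M d hV) e))) rfl ?_
    rw [h]
    cases R <;> (rw [Formula.erase, valueOfFormula]; rfl)
  | conn n c φ ih =>
    rw [Formula.realize, Formula.erase, valueOfFormula]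
    congr 1
    funext i
    exact ih i e
  | all s φ ih =>
    rw [Formula.realize, Formula.erase, valueOfFormula]
    refine iSup_congr fun a => (ih _).trans ?_
    exact congrArg _ (values_eq_cons _ _)
  | ex s φ ih =>
    rw [Formula.realize, Formula.erase, valueOfFormula]
    refine iInf_congr fun a => (ih _).trans ?_
    exact congrArg _ (values_eq_cons _ _)

variable {M d}

/-- The value that codes an imaginary element. -/
def imagVal {S : V.Srt} (z : (imagStruc M d hV).carrier S) : Val M := z.1

/-- The imaginary element with a given code. -/
def imagMk (S : V.Srt) (v : Val M) (hv : v ∈ (interp M d S.1).dom) :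
    (imagStruc M d hV).carrier S := ⟨v, hv⟩

/-- The values that code the entries of a tuple of imaginary elements. -/
def imagVals {Γ : List V.Srt} (e : (imagStruc M d hV).Tuple Γ) : List (Val M) :=
  values (X := (imagStruc M d hV).carrier) (fun _ => imagVal hV) e

@[simp] theorem imagVal_imagMk (S : V.Srt) (v : Val M) (hv : v ∈ (interp M d S.1).dom) :
    imagVal hV (imagMk hV S v hv) = v := rfl

theorem imagVal_mem {S : V.Srt} (z : (imagStruc M d hV).carrier S) :
    imagVal hV z ∈ (interp M d S.1).dom := z.2

theorem imagVal_injective (S : V.Srt) : Function.Injective (imagVal hV (S := S)) :=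
  Subtype.val_injective

theorem imagVals_mem {Γ : List V.Srt} (e : (imagStruc M d hV).Tuple Γ) :
    imagVals hV e ∈ TupDom (interpList M d (names Γ)) := vals_mem M d e

theorem exists_imagVals_eq {Γ : List V.Srt} {l : List (Val M)}
    (hl : l ∈ TupDom (interpList M d (names Γ))) :
    ∃ e : (imagStruc M d hV).Tuple Γ, imagVals hV e = l := exists_vals_eq hl

theorem realize_eq_valueOfFormula {Γ : List V.Srt} (φ : Formula V.lang Γ)
    (e : (imagStruc M d hV).Tuple Γ) :
    φ.realize (imagStruc M d hV) e = valueOfFormula M d φ.erase (imagVals hV e) :=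
  realize_imagStruc M d hV φ e

end Canonical

/-! ### The axioms of the expansion hold in the canonical structure -/

namespace Var

theorem mem_of_var {α : Type u} {a : α} : {Γ : List α} → Var Γ a → a ∈ Γ
  | _, zero => List.mem_cons_self
  | _, succ x => List.mem_cons_of_mem _ x.mem_of_var

/-- A context without repetitions, such as `List.range n`, has at most one variable of each type. -/
theorem eq_of_nodup {α : Type u} {a : α} :
    {Γ : List α} → Γ.Nodup → (x y : Var Γ a) → x = y
  | _, _, zero, zero => rfl
  | _, h, zero, succ y => absurd y.mem_of_var (List.nodup_cons.1 h).1
  | _, h, succ x, zero => absurd x.mem_of_var (List.nodup_cons.1 h).1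
  | _, h, succ x, succ y => congrArg succ (eq_of_nodup (List.nodup_cons.1 h).2 x y)

theorem nonempty_of_mem {α : Type u} {a : α} : {Γ : List α} → a ∈ Γ → Nonempty (Var Γ a)
  | b :: Γ, h => by
    rcases List.mem_cons.1 h with rfl | h
    · exact ⟨zero⟩
    · exact (nonempty_of_mem h).map succ

end Var

open NameSet Var

theorem decodeTuple_values {L : Language.{u}} {M : Struc L} {Γ : List L.Sorts} (e : M.Tuple Γ) :
    decodeTuple Γ (values (X := M.carrier) (Y := Val M) Val.base e) = e := by
  funext s x
  rw [decodeTuple, getD_values, Val.decode_base]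

namespace Theory

variable (P : Theory.{u}) (M : Struc P.L) {V : NameSet P.L}
  (hV : ∀ S : V.Srt, (interp M P.d S.1).dom.Nonempty)

/-- The elements of `M`, as elements of the canonical structure. -/
def imagBase (s : P.L.Sorts) (a : M.carrier s) :
    ((imagStruc M P.d hV).reduct V.baseHom).carrier s :=
  imagMk hV (V.base s) (.base s a) ((interp_base M P.d s).symm ▸ ⟨a, rfl⟩)

theorem imagBase_surjective (s : P.L.Sorts) : Function.Surjective (P.imagBase M hV s) := by
  intro z
  have hz := imagVal_mem hV (S := V.base s) z
  change _ ∈ (interp M P.d (.base s)).dom at hz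
  rw [interp_base] at hz
  obtain ⟨a, ha⟩ := hz
  exact ⟨a, imagVal_injective hV _ ha.symm⟩

theorem imagBase_injective (s : P.L.Sorts) : Function.Injective (P.imagBase M hV s) := by
  intro a b h
  injection h with h
  injection h

theorem decodeTuple_imagVals_mapElim {Γ : List P.L.Sorts} (e : M.Tuple Γ) :
    decodeTuple Γ (imagVals hV (mapElim V.base (X := (imagStruc M P.d hV).carrier) Γ
      fun s x => P.imagBase M hV s (e s x))) = e := by
  refine Eq.trans (congrArg _ ?_) (decodeTuple_values e)
  exact all_map_mapElim V.base (X := (imagStruc M P.d hV).carrier) (fun _ => imagVal hV) Γ _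

theorem imagBase_fn {Γ : List P.L.Sorts} {s : P.L.Sorts} (f : P.L.Func Γ s) (e : M.Tuple Γ) :
    P.imagBase M hV s (M.fn f e) =
      ((imagStruc M P.d hV).reduct V.baseHom).fn f fun t x => P.imagBase M hV t (e t x) :=
  imagVal_injective hV _ (congrArg (fun e => Val.base s (M.fn f e))
    (P.decodeTuple_imagVals_mapElim M hV e).symm)

theorem realize_imagBase {Γ : List P.L.Sorts} (φ : Formula P.L Γ) (e : M.Tuple Γ) :
    φ.realize ((imagStruc M P.d hV).reduct V.baseHom) (fun s x => P.imagBase M hV s (e s x)) =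
      φ.realize M e :=
  φ.realize_of_surjective (N := (imagStruc M P.d hV).reduct V.baseHom) (P.imagBase M hV)
    (P.imagBase_surjective M hV) (P.imagBase_fn M hV)
    (fun R e => congrArg (M.rel R) (P.decodeTuple_imagVals_mapElim M hV e)) e

theorem dist_imagBase (s : P.L.Sorts) (a b : M.carrier s) :
    (P.expansion V).dist (imagStruc M P.d hV) (s := V.base s) (P.imagBase M hV s a)
      (P.imagBase M hV s b) = P.dist M a b := by
  refine (P.dist_reduct V (imagStruc M P.d hV) s _ _).symm.trans ?_
  refine Eq.trans ?_ (congrArg Subtype.val (P.realize_imagBase M hV (P.d s)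
    (Var.pair (X := M.carrier) a b)))
  exact congrArg (fun e => (((P.d s).realize _ e : unitInterval) : ℝ))
    (Var.map_pair (X := M.carrier) (P.imagBase M hV) a b).symm

theorem dist_imagStruc {S : V.Srt} (a b : (imagStruc M P.d hV).carrier S) :
    (P.expansion V).dist (imagStruc M P.d hV) a b =
      (interp M P.d S.1).dist (imagVal hV a) (imagVal hV b) := by
  have hnew : ∀ (h : S.1.IsNew) (h' : P.eqDist V S = .rel (L := V.lang) (EqRel.dist S h)
      fun _ x => .var x), (P.expansion V).dist (imagStruc M P.d hV) a b =
        (interp M P.d S.1).dist (imagVal hV a) (imagVal hV b) := by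
    intro h h'
    rw [Theory.dist]
    change (((P.eqDist V S).realize _ _ : unitInterval) : ℝ) = _
    rw [h']
    rfl
  rcases S with ⟨S, hS⟩
  cases S with
  | base s =>
    obtain ⟨a, rfl⟩ := P.imagBase_surjective M hV s a
    obtain ⟨b, rfl⟩ := P.imagBase_surjective M hV s b
    refine (P.dist_imagBase M hV s a b).trans ?_
    refine Eq.trans ?_ (congrArg (fun D : Interp (Val M) => (D.dist (.base s a) (.base s b) : ℝ))
      (interp_base M P.d s).symm)
    change _ = (((P.d s).realize M (Var.pair (X := M.carrier) ((Val.base s a).decode s)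
        ((Val.base s b).decode s)) : unitInterval) : ℝ)
    rw [Val.decode_base, Val.decode_base]
    rfl
  | prod F => exact hnew trivial rfl
  | defset Γ A => exact hnew trivial rfl
  | canon Γ Δ φ => exact hnew trivial rfl
  | union Γ n Δ φ => exact hnew trivial rfl

theorem tupDist_imagStruc : {Γ : List V.Srt} → (e e' : (imagStruc M P.d hV).Tuple Γ) →
    (P.expansion V).tupDist (imagStruc M P.d hV) e e' =
      listDist (interpList M P.d (names Γ)) (imagVals hV e) (imagVals hV e')
  | [], _, _ => rfl
  | S :: Γ, e, e' => by
    rw [imagVals, imagVals, values_eq_cons, values_eq_cons]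
    exact congrArg₂ max (P.dist_imagStruc M hV _ _)
      (tupDist_imagStruc (fun a x => e a x.succ) fun a x => e' a x.succ)

/-- The properties of the interpretation of a sort which make the axioms of the expansion true: it
is a nonempty complete metric space, and if it is named by a formula `A`, as a set of zeros, then
the value of `A` is the distance to this set. -/
structure IsGoodSort (S : Name P.L) : Prop where
  nonempty : (interp M P.d S).dom.Nonempty
  complete : IsCompleteMetric fun a b : (interp M P.d S).dom => ((interp M P.d S).dist a b : ℝ)
  image (Γ : List (Name P.L)) (A : FormulaName P.L) (h : S = .defset Γ A) (l : List (Val M))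
    (hl : l ∈ TupDom (interpList M P.d Γ)) :
    IsGLB (Set.range fun v : (interp M P.d S).dom =>
      (listDist (interpList M P.d Γ) l v.1.toList : ℝ)) (valueOfFormula M P.d A l)

section Functions

variable {P M} {S : V.Srt}

theorem imagVal_projFn (F : ℕ → V.Srt) (h : S.1 = Name.prod fun n => (F n).1) (n : ℕ)
    (z : (imagStruc M P.d hV).carrier S) :
    imagVal hV (projFn (imagStruc M P.d hV) F h n z) = (imagVal hV z).nth n := by
  change (interp M P.d (.prod fun n => (F n).1)).fn n [imagVal hV z] = _
  rw [interp_prod]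
  rfl

theorem imagVals_inclFn (Γ : List V.Srt) (A : FormulaName P.L)
    (h : S.1 = Name.defset (names Γ) A) (z : (imagStruc M P.d hV).carrier S) :
    imagVals hV (inclFn (imagStruc M P.d hV) Γ A h z) = (imagVal hV z).toList := by
  have hz := imagVal_mem hV z
  rw [h, interp_defset] at hz
  obtain ⟨l, hl, hl', -⟩ := hz
  obtain ⟨e, rfl⟩ := exists_imagVals_eq hV hl'
  rw [hl, Val.toList]
  congr 1
  funext s x
  refine imagVal_injective hV _ ?_
  change (interp M P.d (.defset (names Γ) A)).fn x.idx [imagVal hV z] = _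
  rw [interp_defset, hl]
  exact getD_values _ _ _ _

theorem imagVal_quotFn (Γ Δ : List V.Srt) (φ : FormulaName P.L)
    (h : S.1 = Name.canon (names Γ) (names Δ) φ) (b : (imagStruc M P.d hV).Tuple Δ) :
    imagVal hV (quotFn (imagStruc M P.d hV) Γ Δ φ h b) =
      (interp M P.d (.canon (names Γ) (names Δ) φ)).fn 0 (imagVals hV b) := rfl

theorem imagVal_injFn {C : V.Srt} (Γ : List V.Srt) (n : ℕ) (Δ : Fin (n + 1) → List V.Srt)
    (φ : Fin (n + 1) → FormulaName P.L)
    (h : S.1 = Name.union (names Γ) n (fun j => names (Δ j)) φ) (j : Fin (n + 1))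
    (hC : C.1 = Name.canon (names Γ) (names (Δ j)) (φ j)) (z : (imagStruc M P.d hV).carrier C) :
    imagVal hV (injFn (imagStruc M P.d hV) Γ n Δ φ h j hC z) =
      (interp M P.d (.union (names Γ) n (fun j => names (Δ j)) φ)).fn j [imagVal hV z] := rfl

/-- A tuple of imaginary elements, as a tuple of values. -/
def toTupDom {Γ : List V.Srt} (e : (imagStruc M P.d hV).Tuple Γ) :
    TupDom (interpList M P.d (names Γ)) := ⟨_, imagVals_mem hV e⟩

theorem toTupDom_surjective (Γ : List V.Srt) : Function.Surjective (toTupDom hV (Γ := Γ)) := by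
  rintro ⟨l, hl⟩
  obtain ⟨e, rfl⟩ := exists_imagVals_eq hV hl
  exact ⟨e, rfl⟩

theorem coe_projIcc_of_nonneg {r : ℝ} (h : 0 ≤ r) :
    (Set.projIcc (0 : ℝ) 1 zero_le_one r : ℝ) = min r 1 := by
  rw [Set.coe_projIcc, min_comm, max_eq_right (le_min h zero_le_one)]

/-- The extension of `φ` to canonical parameters is the function by which unions are interpreted. -/
theorem paramVal_imagStruc (Γ Δ : List V.Srt) (φ : Formula V.lang (Γ ++ Δ)) {C : V.Srt}
    (hC : C.1 = Name.canon (names Γ) (names Δ) φ.erase) (x : (imagStruc M P.d hV).Tuple Γ)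
    (z : (imagStruc M P.d hV).carrier C) : P.paramVal (imagStruc M P.d hV) Γ Δ φ hC x z =
      paramInterp (interpList M P.d (names Γ)) (interpList M P.d (names Δ))
        (valueOfFormula M P.d φ.erase) (imagVals hV x) (imagVal hV z) := by
  have := (imagStruc M P.d hV).nonempty_tuple Δ
  refine (P.isGLB_paramVal (imagStruc M P.d hV) Γ Δ φ hC x z).unique ?_
  rw [paramInterp, ← (toTupDom_surjective hV Δ).iInf_comp]
  refine unitInterval_isGLB_iInf' fun b => ?_
  rw [dist_imagStruc, realize_eq_valueOfFormula, imagVal_quotFn, hC, interp_canon,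
    show imagVals hV (Var.append (X := (imagStruc M P.d hV).carrier) x b) =
      imagVals hV x ++ imagVals hV b from values_append _ _ _]
  exact coe_projIcc_of_nonneg (add_nonneg unitInterval.nonneg' unitInterval.nonneg')

end Functions

section Spec

variable {P M} (hP : P.Holds M) (hg : ∀ S : V.Srt, P.IsGoodSort M S.1)

/-- The structure formed by the imaginary elements of good sorts. -/
noncomputable abbrev goodStruc : Struc V.lang := imagStruc M P.d fun S => (hg S).nonempty

theorem isCompleteMetric_goodStruc (S : V.Srt) :
    IsCompleteMetric fun a b : (goodStruc hg).carrier S =>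
      (P.expansion V).dist (goodStruc hg) a b := by
  simp only [dist_imagStruc]
  exact (hg S).complete

include hP in
/-- The structure formed by the imaginary elements of good sorts satisfies the axioms of the
expansion. -/
theorem eqSpec_goodStruc : P.EqSpec (goodStruc hg) where
  base σ hσ := by
    have h := P.realize_imagBase M (fun S : V.Srt => (hg S).nonempty) σ Var.nil
    rw [Var.eq_nil (fun s x => P.imagBase M _ s (Var.nil (X := M.carrier) s x))] at h
    exact h.trans (hP σ hσ)
  dist_self S a := by
    rw [dist_imagStruc]
    exact (hg S).complete.self a
  dist_comm S a b := by
    rw [dist_imagStruc, dist_imagStruc]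
    exact (hg S).complete.comm a b
  dist_triangle S a b c := by
    rw [dist_imagStruc, dist_imagStruc, dist_imagStruc]
    exact (hg S).complete.triangle a b c
  prod_dense S F h n e ε hε := by
    classical
    -- the sequence with the given entries at `i < n`, and arbitrary entries from `n` on
    let f : ∀ i, (goodStruc hg).carrier (F i) := fun i =>
      if h : Nonempty (Var (List.range n) i) then e _ (h.some.map F)
      else ((goodStruc hg).nonempty (F i)).some
    refine ⟨imagMk _ S (.seq fun i => imagVal _ (f i)) ?_, fun i x => ?_⟩
    · rw [h, interp_prod]
      exact ⟨_, rfl, fun n => imagVal_mem _ (f n)⟩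
    · have hn : Nonempty (Var (List.range n) i) := ⟨x⟩
      have hx : hn.some = x := eq_of_nodup List.nodup_range _ _
      have hf : f i = e _ (x.map F) := by
        simp only [f]
        rw [dif_pos hn, hx]
      rw [dist_imagStruc, imagVal_projFn, imagVal_imagMk, Val.nth, hf]
      exact ((hg _).complete.self (e _ (x.map F))).trans_le hε.le
  prod_dist S F h n a b := by
    simp only [dist_imagStruc, imagVal_projFn]
    generalize imagVal _ a = a
    generalize imagVal _ b = b
    have h₀ := fun i => ((interp M P.d (F i).1).dist (a.nth i) (b.nth i)).2.1
    have h₁ := fun i => ((interp M P.d (F i).1).dist (a.nth i) (b.nth i)).2.2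
    refine le_of_eq_of_le (congrArg (fun r => |r - _|) ?_) (abs_tsum_sub_sum_le h₀ h₁ n)
    rw [h, interp_prod]
    exact congrArg Subtype.val
      (Set.projIcc_of_mem (zero_le_one' ℝ) (tsum_div_two_pow_mem h₀ h₁))
  defset_image S Γ A h e := by
    have := (hg S).image (names Γ) A.erase h (imagVals _ e) (imagVals_mem _ e)
    rw [realize_eq_valueOfFormula]
    simp only [tupDist_imagStruc, imagVals_inclFn]
    exact this
  defset_dist S Γ A h a b := by
    rw [dist_imagStruc, tupDist_imagStruc, imagVals_inclFn, imagVals_inclFn, h, interp_defset]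
    rfl
  canon_dist C Γ Δ φ h b c := by
    have : Nonempty (TupDom (interpList M P.d (names Γ))) :=
      ((goodStruc hg).nonempty_tuple Γ).map (toTupDom _)
    rw [dist_imagStruc, imagVal_quotFn, imagVal_quotFn, quotFn_apply M P.d (imagVals_mem _ b),
      quotFn_apply M P.d (imagVals_mem _ c), h, interp_canon]
    refine Eq.mp (congrArg₂ IsLUB ?_ rfl)
      (famInterp_isLUB _ (canonCode_injective _) _ (toTupDom _ b) (toTupDom _ c))
    rw [← (toTupDom_surjective _ Γ).range_comp]
    refine congrArg Set.range (funext fun x => ?_)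
    rw [realize_eq_valueOfFormula, realize_eq_valueOfFormula]
    refine congrArg₂ (fun l l' =>
      |(valueOfFormula M P.d φ.erase l : ℝ) - valueOfFormula M P.d φ.erase l'|) ?_ ?_
    · exact (values_append _ _ _).symm
    · exact (values_append _ _ _).symm
  canon_dense C Γ Δ φ h z ε hε := by
    have hz := imagVal_mem _ z
    rw [h, interp_canon] at hz
    obtain ⟨x, hx⟩ := famInterp_dense _ (canonCode_injective _) _ hz hε
    obtain ⟨b, rfl⟩ := toTupDom_surjective (fun S => (hg S).nonempty) Δ x
    refine ⟨b, ?_⟩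
    rw [dist_imagStruc, imagVal_quotFn, quotFn_apply M P.d (imagVals_mem _ b), h, interp_canon]
    exact hx
  union_cover S Γ n Δ φ h C hC x := by
    by_contra! H
    choose ε hε H using H
    -- one index must serve all `ε`; otherwise the least of the finitely many bounds is violated
    obtain ⟨j₀, -, hj₀⟩ := Finset.exists_min_image Finset.univ ε Finset.univ_nonempty
    have hx := imagVal_mem _ x
    rw [h, interp_union] at hx
    obtain ⟨⟨j, v, hv⟩, hp⟩ := famInterp_dense _ (unionCode_injective _ _ _ _) _ hx (hε j₀)
    have hv' : v ∈ (interp M P.d (C j).1).dom := by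
      rw [hC, interp_canon]
      exact hv
    refine (H j (imagMk _ (C j) v hv')).not_ge (le_trans ?_ (hj₀ j (Finset.mem_univ j)))
    rw [(isCompleteMetric_goodStruc hg S).comm, dist_imagStruc, imagVal_injFn, imagVal_imagMk,
      injFn_apply M P.d j hv, h, interp_union]
    exact hp
  union_dist S Γ n Δ φ h C hC j k y z := by
    have : Nonempty (TupDom (interpList M P.d (names Γ))) :=
      ((goodStruc hg).nonempty_tuple Γ).map (toTupDom _)
    have hy := imagVal_mem _ y
    have hz := imagVal_mem _ z
    rw [hC, interp_canon] at hy hz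
    rw [dist_imagStruc, imagVal_injFn, imagVal_injFn, injFn_apply M P.d j hy,
      injFn_apply M P.d k hz, h, interp_union]
    refine Eq.mp (congrArg₂ IsLUB ?_ rfl)
      (famInterp_isLUB _ (unionCode_injective _ _ _ _) _ ⟨j, _, hy⟩ ⟨k, _, hz⟩)
    rw [← (toTupDom_surjective _ Γ).range_comp]
    refine congrArg Set.range (funext fun x => ?_)
    rw [paramVal_imagStruc, paramVal_imagStruc]
    rfl

end Spec

end Theory

/-! ### Good sorts and essential surjectivity -/

namespace Theory

open NameSet Var

theorem famInterp_nonempty {L : Language.{u}} {M : Struc L} {X J : Type u}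
    (F : X → J → unitInterval) (κ : (ℕ → X) → Val M)
    (fn : (X → Val M) → ℕ → List (Val M) → Val M) (x : X) : (famInterp F κ fn).dom.Nonempty :=
  ⟨_, ((⟨x⟩ : FamPoint F) : UniformSpace.Completion (FamPoint F)), rfl⟩

section Closed

variable {P : Theory.{u}} {M : Struc P.L}

theorem IsGoodSort.base (hc : ∀ s, IsCompleteMetric fun a b : M.carrier s => P.dist M a b)
    (s : P.L.Sorts) : P.IsGoodSort M (.base s) where
  nonempty := by
    rw [interp_base]
    exact ⟨_, (M.nonempty s).some, rfl⟩
  complete := by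
    rw [interp_base]
    let e : M.carrier s ≃ (baseInterp M P.d s).dom := Equiv.ofBijective
      (fun a => ⟨.base s a, a, rfl⟩) ⟨fun a b h => by injection h with h; injection h, by
        rintro ⟨_, a, rfl⟩
        exact ⟨a, rfl⟩⟩
    refine Eq.mp (congrArg IsCompleteMetric ?_) ((hc s).comp_equiv e.symm)
    funext v w
    obtain ⟨a, rfl⟩ := e.surjective v
    obtain ⟨b, rfl⟩ := e.surjective w
    rw [e.symm_apply_apply, e.symm_apply_apply]
    change _ = (((P.d s).realize M (Var.pair (X := M.carrier) ((Val.base s a).decode s)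
        ((Val.base s b).decode s)) : unitInterval) : ℝ)
    rw [Val.decode_base, Val.decode_base]
    rfl
  image Γ A h := by injection h

theorem IsGoodSort.prod {S : ℕ → Name P.L} (hS : ∀ n, P.IsGoodSort M (S n)) :
    P.IsGoodSort M (.prod S) where
  nonempty := by
    rw [interp_prod]
    exact ⟨_, fun n => (hS n).nonempty.some, rfl, fun n => (hS n).nonempty.some_mem⟩
  complete := by
    rw [interp_prod]
    let e : (∀ n, (interp M P.d (S n)).dom) ≃ (prodInterp M fun n => interp M P.d (S n)).dom :=
      Equiv.ofBijective (fun f => ⟨.seq fun n => (f n).1, _, rfl, fun n => (f n).2⟩)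
        ⟨fun f g h => by
          injection h with h
          injection h with h
          funext n
          exact Subtype.ext (congrFun h n), by
          rintro ⟨_, f, rfl, hf⟩
          exact ⟨fun n => ⟨f n, hf n⟩, rfl⟩⟩
    have h₁ : ∀ n (a b : (interp M P.d (S n)).dom), ((interp M P.d (S n)).dist a b : ℝ) ≤ 1 :=
      fun _ _ _ => unitInterval.le_one'
    refine Eq.mp (congrArg IsCompleteMetric ?_)
      ((isCompleteMetric_prod (fun n => (hS n).complete) h₁).comp_equiv e.symm)
    funext v w
    obtain ⟨f, rfl⟩ := e.surjective v
    obtain ⟨g, rfl⟩ := e.surjective w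
    rw [e.symm_apply_apply, e.symm_apply_apply]
    exact (congrArg Subtype.val (Set.projIcc_of_mem (zero_le_one' ℝ) (tsum_div_two_pow_mem
      (fun n => ((interp M P.d (S n)).dist (f n) (g n)).2.1) fun n => h₁ n (f n) (g n)))).symm
  image Γ A h := by injection h

variable {V : NameSet P.L} (hP : P.Holds M) (hg : ∀ S : V.Srt, P.IsGoodSort M S.1)

include hP hg in
/-- Definability of `A` is used in the structure of the good sorts, which is a model of the
expansion by these sorts: there `A` has zeros, and `A` is the distance to the set of its zeros. -/
theorem IsGoodSort.defset {Γ : List V.Srt} {A : Formula V.lang Γ}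
    (hA : (P.expansion V).IsDefinableSet A) : P.IsGoodSort M (.defset (names Γ) A.erase) := by
  have h : (P.expansion V).DefinableIn (goodStruc hg) A :=
    ((P.expansion V).isDefinableSet_iff A).1 hA _
      ((P.expansion_holds_iff _).2 (eqSpec_goodStruc hP hg))
  have hc := isCompleteMetric_goodStruc hg
  let e : {z : (goodStruc hg).Tuple Γ // A.realize (goodStruc hg) z = 0} ≃
      (defsetInterp (interpList M P.d (names Γ)) (valueOfFormula M P.d A.erase)).dom :=
    Equiv.ofBijective (fun z => ⟨.tup (imagVals _ z.1), _, rfl, imagVals_mem _ z.1,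
        (realize_eq_valueOfFormula _ _ _).symm.trans z.2⟩)
      ⟨fun z w h => by
        injection h with h
        injection h with h
        exact Subtype.ext (values_injective (X := (goodStruc hg).carrier) _
          (imagVal_injective _) h), by
        rintro ⟨_, l, rfl, hl, hl'⟩
        obtain ⟨z, rfl⟩ := exists_imagVals_eq (fun S => (hg S).nonempty) hl
        exact ⟨⟨z, (realize_eq_valueOfFormula _ _ _).trans hl'⟩, rfl⟩⟩
  have he : ∀ z, (e z).1.toList = imagVals _ z.1 := fun _ => rfl
  have hd : ∀ z w, (P.expansion V).tupDist (goodStruc hg) z.1 w.1 =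
      ((defsetInterp (interpList M P.d (names Γ)) (valueOfFormula M P.d A.erase)).dist
        (e z) (e w) : ℝ) := fun z w => P.tupDist_imagStruc M _ z.1 w.1
  refine ⟨?_, ?_, ?_⟩
  · rw [interp_defset]
    obtain ⟨x⟩ := (goodStruc hg).nonempty_tuple Γ
    obtain ⟨z, hz, -⟩ := h.exists_zero hc x one_pos
    exact ⟨_, (e ⟨z, hz⟩).2⟩
  · rw [interp_defset]
    refine Eq.mp (congrArg IsCompleteMetric ?_) ((h.isCompleteMetric_zeros hc).comp_equiv e.symm)
    funext v w
    rw [hd, e.apply_symm_apply, e.apply_symm_apply]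
  · intro Γ' A' hS l hl
    injection hS with h₁ h₂
    subst h₁ h₂
    obtain ⟨x, rfl⟩ := exists_imagVals_eq (fun S => (hg S).nonempty) hl
    rw [interp_defset, ← e.surjective.range_comp]
    have key := h.isGLB_zeros hc x
    rw [realize_eq_valueOfFormula] at key
    simp only [tupDist_imagStruc] at key
    exact key

include hg in
theorem IsGoodSort.canon (Γ Δ : List V.Srt) (φ : FormulaName P.L) :
    P.IsGoodSort M (.canon (names Γ) (names Δ) φ) where
  nonempty := by
    rw [interp_canon]
    obtain ⟨b⟩ := (goodStruc hg).nonempty_tuple Δ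
    exact famInterp_nonempty _ _ _ (toTupDom _ b)
  complete := by
    rw [interp_canon]
    exact isCompleteMetric_famInterp _ (canonCode_injective _) _
  image Γ A h := by injection h

include hg in
theorem IsGoodSort.union (Γ : List V.Srt) (n : ℕ) (Δ : Fin (n + 1) → List V.Srt)
    (φ : Fin (n + 1) → FormulaName P.L) :
    P.IsGoodSort M (.union (names Γ) n (fun j => names (Δ j)) φ) where
  nonempty := by
    have h := (IsGoodSort.canon hg Γ (Δ 0) (φ 0)).nonempty
    rw [interp_canon] at h
    obtain ⟨v, hv⟩ := h
    rw [interp_union]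
    exact famInterp_nonempty _ _ _ ⟨0, v, hv⟩
  complete := by
    rw [interp_union]
    exact isCompleteMetric_famInterp _ (unionCode_injective _ _ _ _) _
  image Γ A h := by injection h

variable (P) in
/-- Over a model of the theory, all imaginary sorts are good. -/
theorem isGoodSort_eqSorts (M : Mod P) (S : P.eqSorts.Srt) : P.IsGoodSort M.str S.1 := by
  let W : NameSet P.L := ⟨{S | P.IsGoodSort M.str S}, fun s => .base M.complete s⟩
  have hg : ∀ S : W.Srt, P.IsGoodSort M.str S.1 := fun S => S.2
  exact P.eqSorts_subset (V := W)
    { prod_mem := fun F => .prod fun n => hg (F n)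
      defset_mem := fun _ _ hA => .defset M.holds hg hA
      canon_mem := fun Γ Δ φ => .canon hg Γ Δ _
      union_mem := fun Γ n Δ φ => .union hg Γ n Δ _ } S.2

end Closed

variable (P : Theory.{u})

/-- The imaginary elements over a model of the theory form a model of its expansion. -/
noncomputable def imagMod (M : Mod P) : Mod P.eq where
  str := goodStruc (P.isGoodSort_eqSorts M)
  holds := (P.expansion_holds_iff _).2 (eqSpec_goodStruc M.holds _)
  complete := isCompleteMetric_goodStruc _

/-- An elementary map all of whose components are bijections is an isomorphism. -/
noncomputable def isoOfBijective {P : Theory.{u}} {M N : Mod P} (g : M ⟶ N)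
    (hg : ∀ s, Function.Bijective (ElemMap.toFun g s)) : M ≅ N := by
  have key : ∀ s b, ElemMap.toFun g s ((Equiv.ofBijective _ (hg s)).symm b) = b :=
    fun s b => (Equiv.ofBijective _ (hg s)).apply_symm_apply b
  refine ⟨g, ⟨fun s => (Equiv.ofBijective _ (hg s)).symm, fun f e => ?_, fun φ e => ?_⟩, ?_, ?_⟩
  · refine (hg _).1 ((key _ _).trans (Eq.trans ?_ (ElemMap.map_fn g f _).symm))
    simp only [key]
  · refine (ElemMap.map_formula g φ _).symm.trans ?_
    simp only [key]
  · refine ElemMap.ext ?_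
    funext s a
    exact (Equiv.ofBijective _ (hg s)).symm_apply_apply a
  · refine ElemMap.ext ?_
    funext s a
    exact key s a

/-- Every model of the theory is isomorphic to the reduct of the model formed by its imaginary
elements. -/
theorem essSurj_forgetEq : P.forgetEq.EssSurj where
  mem_essImage M := by
    have hV := fun S : P.eqSorts.Srt => (P.isGoodSort_eqSorts M S).nonempty
    let g : M ⟶ P.forgetEq.obj (P.imagMod M) :=
      ⟨P.imagBase M.str hV, P.imagBase_fn M.str hV, P.realize_imagBase M.str hV⟩
    have hg : ∀ s, Function.Bijective (ElemMap.toFun g s) :=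
      fun s => ⟨P.imagBase_injective M.str hV s, P.imagBase_surjective M.str hV s⟩
    exact ⟨P.imagMod M, ⟨(isoOfBijective g hg).symm⟩⟩

end Theory

/-! ### Ultrapowers -/

section Ultralimit

variable {I : Type u} (U : Ultrafilter I)

/-- The limit of a family in `[0,1]` along an ultrafilter. -/
noncomputable def ulim (f : I → unitInterval) : unitInterval := (U.map f).lim

theorem tendsto_ulim (f : I → unitInterval) : Filter.Tendsto f U (nhds (ulim U f)) :=
  Ultrafilter.le_nhds_lim (U.map f)

variable {U}

theorem ulim_eq {f : I → unitInterval} {a : unitInterval} (h : Filter.Tendsto f U (nhds a)) :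
    ulim U f = a :=
  tendsto_nhds_unique (tendsto_ulim U f) h

theorem ulim_const (a : unitInterval) : ulim U (fun _ => a) = a := ulim_eq tendsto_const_nhds

theorem ulim_comp {n : ℕ} (c : C(Fin n → unitInterval, unitInterval))
    (f : Fin n → I → unitInterval) :
    (ulim U fun i => c fun k => f k i) = c fun k => ulim U (f k) :=
  ulim_eq ((c.continuous.tendsto _).comp (tendsto_pi_nhds.2 fun k => tendsto_ulim U (f k)))

theorem ulim_mono {f g : I → unitInterval} (h : ∀ i, f i ≤ g i) : ulim U f ≤ ulim U g :=
  le_of_tendsto_of_tendsto' (tendsto_ulim U f) (tendsto_ulim U g) h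

theorem ulim_le_of_eventually {f : I → unitInterval} {r : ℝ}
    (h : ∀ᶠ i in U, (f i : ℝ) ≤ r) : (ulim U f : ℝ) ≤ r :=
  le_of_tendsto ((continuous_subtype_val.tendsto _).comp (tendsto_ulim U f)) h

theorem eventually_of_ulim_lt {f : I → unitInterval} {r : ℝ} (h : (ulim U f : ℝ) < r) :
    ∀ᶠ i in U, (f i : ℝ) < r :=
  ((continuous_subtype_val.tendsto _).comp (tendsto_ulim U f)).eventually_lt_const h

theorem ulim_iSup {X : Type u} [Nonempty X] (f : I → X → unitInterval) :
    (ulim U fun i => ⨆ a, f i a) = ⨆ x : I → X, ulim U fun i => f i (x i) := by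
  refine (unitInterval_eq_iSup_iff fun _ => rfl).2 ⟨?_, fun r hr => ?_⟩
  · rintro _ ⟨x, rfl⟩
    exact ulim_mono fun i => le_iSup (f i) (x i)
  · refine le_of_forall_pos_le_add fun ε hε => ?_
    have : ∀ i, ∃ a, ((⨆ a, f i a : unitInterval) : ℝ) - ε < f i a := fun i => by
      obtain ⟨_, ⟨a, rfl⟩, ha⟩ := (lt_isLUB_iff (unitInterval_isLUB_iSup (f i))).1
        (sub_lt_self _ hε)
      exact ⟨a, ha⟩
    choose x hx using this
    have h := tendsto_ulim U fun i => f i (x i)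
    refine le_trans ?_ (add_le_add_left (hr ⟨x, rfl⟩) ε)
    refine le_of_tendsto_of_tendsto' ((continuous_subtype_val.tendsto _).comp
      (tendsto_ulim U fun i => ⨆ a, f i a))
      (((continuous_subtype_val.tendsto _).comp h).add_const ε) fun i => ?_
    exact (sub_lt_iff_lt_add.1 (hx i)).le

theorem ulim_iInf {X : Type u} [Nonempty X] (f : I → X → unitInterval) :
    (ulim U fun i => ⨅ a, f i a) = ⨅ x : I → X, ulim U fun i => f i (x i) := by
  refine (unitInterval_eq_iInf_iff fun _ => rfl).2 ⟨?_, fun r hr => ?_⟩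
  · rintro _ ⟨x, rfl⟩
    exact ulim_mono fun i => iInf_le (f i) (x i)
  · refine le_of_forall_pos_le_add fun ε hε => ?_
    have : ∀ i, ∃ a, (f i a : ℝ) < ((⨅ a, f i a : unitInterval) : ℝ) + ε := fun i => by
      obtain ⟨_, ⟨a, rfl⟩, ha⟩ := (isGLB_lt_iff (unitInterval_isGLB_iInf (f i))).1
        (lt_add_of_pos_right _ hε)
      exact ⟨a, ha⟩
    choose x hx using this
    have h := tendsto_ulim U fun i => f i (x i)
    refine (hr ⟨x, rfl⟩).trans ?_
    exact le_of_tendsto_of_tendsto' ((continuous_subtype_val.tendsto _).comp h)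
      (((continuous_subtype_val.tendsto _).comp
      (tendsto_ulim U fun i => ⨅ a, f i a)).add_const ε) fun i => (hx i).le

end Ultralimit

section Power

variable {L : Language.{u}} (M : Struc L) {I : Type u} (U : Ultrafilter I)

/-- The ultrapower of a structure, before identification of the elements of distance `0`. -/
noncomputable def Struc.power : Struc L where
  carrier s := I → M.carrier s
  nonempty s := (M.nonempty s).map fun a _ => a
  fn f e := fun i => M.fn f fun s x => e s x i
  rel R e := ulim U fun i => M.rel R fun s x => e s x i

theorem Term.realize_power {Γ : List L.Sorts} {s : L.Sorts} (t : Term L Γ s)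
    (e : (M.power U).Tuple Γ) (i : I) :
    t.realize (M.power U) e i = t.realize M fun s x => e s x i := by
  induction t with
  | var x => rfl
  | app f ts ih =>
    refine congrArg (M.fn f) ?_
    funext s x
    exact ih s x

/-- The theorem of Łoś. -/
theorem Formula.realize_power {Γ : List L.Sorts} (φ : Formula L Γ) (e : (M.power U).Tuple Γ) :
    φ.realize (M.power U) e = ulim U fun i => φ.realize M fun s x => e s x i := by
  induction φ with
  | rel R ts =>
    refine congrArg (ulim U) (funext fun i => congrArg (M.rel R) ?_)
    funext s x
    exact Term.realize_power M U _ _ _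
  | conn n c φ ih =>
    simp only [Formula.realize]
    rw [ulim_comp]
    simp only [ih]
  | all s φ ih =>
    have := M.nonempty s
    simp only [Formula.realize]
    rw [ulim_iSup]
    refine iSup_congr fun a => (ih _).trans ?_
    refine congrArg (ulim U) (funext fun i => congrArg _ ?_)
    exact Var.map_cons (X := (M.power U).carrier) (Y := M.carrier) (fun s z => z i) a e
  | ex s φ ih =>
    have := M.nonempty s
    simp only [Formula.realize]
    rw [ulim_iInf]
    refine iInf_congr fun a => (ih _).trans ?_
    refine congrArg (ulim U) (funext fun i => congrArg _ ?_)
    exact Var.map_cons (X := (M.power U).carrier) (Y := M.carrier) (fun s z => z i) a e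

theorem Formula.realize_power_const {Γ : List L.Sorts} (φ : Formula L Γ) (e : M.Tuple Γ) :
    φ.realize (M.power U) (fun s x _ => e s x) = φ.realize M e :=
  (φ.realize_power M U _).trans (ulim_const _)

namespace Theory

variable (P : Theory.{u}) (M : Struc P.L)

theorem holds_power (hM : P.Holds M) : P.Holds (M.power U) := by
  intro σ hσ
  have h := (σ.realize_power_const M U Var.nil).trans (hM σ hσ)
  rwa [Var.eq_nil (fun s x (_ : I) => Var.nil (X := M.carrier) s x)] at h

theorem dist_power {s : P.L.Sorts} (a b : (M.power U).carrier s) :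
    P.dist (M.power U) a b =
      ulim U fun i => (P.d s).realize M (Var.pair (X := M.carrier) (a i) (b i)) := by
  refine congrArg Subtype.val (((P.d s).realize_power M U _).trans ?_)
  refine congrArg (ulim U) (funext fun i => congrArg _ ?_)
  exact Var.map_pair (X := (M.power U).carrier) (Y := M.carrier) (fun s z => z i) a b

theorem dist_power_le {s : P.L.Sorts} {a b : (M.power U).carrier s} {r : ℝ}
    (h : ∀ᶠ i in U, P.dist M (a i) (b i) ≤ r) : P.dist (M.power U) a b ≤ r := by
  rw [dist_power]
  exact ulim_le_of_eventually h

theorem eventually_of_dist_power_lt {s : P.L.Sorts} {a b : (M.power U).carrier s} {r : ℝ}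
    (h : P.dist (M.power U) a b < r) : ∀ᶠ i in U, P.dist M (a i) (b i) < r := by
  rw [dist_power] at h
  exact eventually_of_ulim_lt h

/-- Ultrapowers along a countably incomplete ultrafilter are complete: a sequence with
`d(x_k, x_{k+1}) < 2^{-k}` converges to the element whose `i`-th coordinate is that of `x_n`, where
`n ≤ ν(i)` is the largest number such that the inequalities hold in the `i`-th coordinate for all
`k < n`. -/
theorem exists_lim_power (ν : I → ℕ) (hν : ∀ n, ∀ᶠ i in U, n ≤ ν i) {s : P.L.Sorts}
    (h₀ : ∀ a : M.carrier s, P.dist M a a = 0)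
    (h₁ : ∀ a b c : M.carrier s, P.dist M a c ≤ P.dist M a b + P.dist M b c)
    (x : ℕ → (M.power U).carrier s)
    (hx : ∀ k, P.dist (M.power U) (x k) (x (k + 1)) < 1 / 2 ^ k) :
    ∃ a, ∀ k, P.dist (M.power U) (x k) a ≤ 2 / 2 ^ k := by
  classical
  let p : I → ℕ → Prop := fun i n => ∀ k < n, P.dist M (x k i) (x (k + 1) i) < 1 / 2 ^ k
  let n : I → ℕ := fun i => Nat.findGreatest (p i) (ν i)
  have hpn : ∀ i, p i (n i) := fun i =>
    Nat.findGreatest_spec (P := p i) (Nat.zero_le _) fun k hk => absurd hk (Nat.not_lt_zero k)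
  refine ⟨fun i => x (n i) i, fun k => P.dist_power_le U M ?_⟩
  have hev : ∀ᶠ i in U, p i k :=
    (Filter.eventually_all_finite (Set.finite_lt_nat k)).2
      fun l _ => P.eventually_of_dist_power_lt U M (hx l)
  filter_upwards [hev, hν k] with i hi hk
  have hkn : k ≤ n i := Nat.le_findGreatest hk hi
  have key : ∀ m, p i (k + m) → P.dist M (x k i) (x (k + m) i) ≤ 2 / 2 ^ k - 2 / 2 ^ (k + m) := by
    intro m
    induction m with
    | zero => intro _; simp [h₀]
    | succ m ih =>
      intro h
      refine (h₁ _ (x (k + m) i) _).trans ((add_le_add (ih fun l hl => h l (by omega))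
        (h (k + m) (by omega)).le).trans_eq ?_)
      rw [← add_assoc k m 1, pow_succ 2 (k + m)]
      field_simp
      ring
  obtain ⟨m, hm⟩ := Nat.exists_eq_add_of_le hkn
  have hpi := hpn i
  rw [hm] at hpi
  simp only [hm]
  exact (key m hpi).trans (sub_le_self _ (by positivity))

end Theory

end Power

/-! ### Identification of elements of distance zero -/

section Quotient

variable (P : Theory.{u}) (X : Struc P.L)

/-- The function and relation symbols do not distinguish elements of distance `0`. -/
structure Theory.Respects : Prop where
  dist_self {s} (a : X.carrier s) : P.dist X a a = 0
  dist_comm {s} (a b : X.carrier s) : P.dist X a b = P.dist X b a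
  dist_triangle {s} (a b c : X.carrier s) : P.dist X a c ≤ P.dist X a b + P.dist X b c
  fn {Γ : List P.L.Sorts} {s : P.L.Sorts} (f : P.L.Func Γ s) (e e' : X.Tuple Γ)
    (h : ∀ t x, P.dist X (e t x) (e' t x) = 0) : P.dist X (X.fn f e) (X.fn f e') = 0
  rel {Γ : List P.L.Sorts} (R : P.L.Rel Γ) (e e' : X.Tuple Γ)
    (h : ∀ t x, P.dist X (e t x) (e' t x) = 0) : X.rel R e = X.rel R e'

variable {P X} (H : P.Respects X)

namespace Theory.Respects

/-- The relation of having distance `0`. -/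
def setoid (s : P.L.Sorts) : Setoid (X.carrier s) where
  r a b := P.dist X a b = 0
  iseqv :=
    { refl := H.dist_self
      symm := fun {a b} h => (H.dist_comm b a).trans h
      trans := fun {a b c} h h' => le_antisymm
        ((H.dist_triangle a b c).trans_eq (by rw [h, h', add_zero])) (dist_nonneg' _ _ _ _) }

/-- The structure in which elements of distance `0` are identified. -/
noncomputable def quotient : Struc P.L where
  carrier s := Quotient (H.setoid s)
  nonempty s := (X.nonempty s).map (Quotient.mk _)
  fn f e := Quotient.mk _ (X.fn f fun s x => (e s x).out)
  rel R e := X.rel R fun s x => (e s x).out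

/-- The class of an element. -/
def cls (s : P.L.Sorts) (a : X.carrier s) : H.quotient.carrier s := Quotient.mk (H.setoid s) a

theorem cls_surjective (s : P.L.Sorts) : Function.Surjective (H.cls s) := Quotient.mk_surjective

theorem cls_eq_iff {s : P.L.Sorts} {a b : X.carrier s} : H.cls s a = H.cls s b ↔ P.dist X a b = 0 :=
  Quotient.eq (r := H.setoid s)

theorem dist_out {s : P.L.Sorts} (a : X.carrier s) :
    P.dist X (Quotient.mk (H.setoid s) a).out a = 0 := Quotient.mk_out (s := H.setoid s) a

theorem cls_fn {Γ : List P.L.Sorts} {s : P.L.Sorts} (f : P.L.Func Γ s) (e : X.Tuple Γ) :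
    H.cls s (X.fn f e) = H.quotient.fn f fun t x => H.cls t (e t x) :=
  (H.cls_eq_iff.2 (H.fn f _ _ fun t x => H.dist_out (e t x))).symm

theorem realize_cls {Γ : List P.L.Sorts} (φ : Formula P.L Γ) (e : X.Tuple Γ) :
    φ.realize H.quotient (fun s x => H.cls s (e s x)) = φ.realize X e :=
  φ.realize_of_surjective (N := H.quotient) H.cls H.cls_surjective H.cls_fn
    (fun R e => H.rel R _ _ fun t x => H.dist_out (e t x)) e

theorem dist_cls {s : P.L.Sorts} (a b : X.carrier s) :
    P.dist H.quotient (H.cls s a) (H.cls s b) = P.dist X a b := by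
  refine Eq.trans ?_ (congrArg Subtype.val (H.realize_cls (P.d s) (Var.pair (X := X.carrier) a b)))
  exact congrArg (fun e => (((P.d s).realize H.quotient e : unitInterval) : ℝ))
    (Var.map_pair (X := X.carrier) (Y := H.quotient.carrier) H.cls a b).symm

theorem holds_quotient (hX : P.Holds X) : P.Holds H.quotient := by
  intro σ hσ
  have h := H.realize_cls σ Var.nil
  rw [Var.eq_nil (fun s x => H.cls s (Var.nil (X := X.carrier) s x))] at h
  exact h.trans (hX σ hσ)

theorem isCompleteMetric_quotient {s : P.L.Sorts}
    (hc : ∀ x : ℕ → X.carrier s, (∀ k, P.dist X (x k) (x (k + 1)) < 1 / 2 ^ k) →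
      ∃ a, ∀ k, P.dist X (x k) a ≤ 2 / 2 ^ k) :
    IsCompleteMetric fun a b : H.quotient.carrier s => P.dist H.quotient a b := by
  refine .of_exists_lim (fun a => ?_) (fun a b h => ?_) (fun a b => ?_) (fun a b c => ?_)
    fun x hx => ?_
  · obtain ⟨a, rfl⟩ := H.cls_surjective s a
    exact (H.dist_cls _ _).trans (H.dist_self a)
  · obtain ⟨a, rfl⟩ := H.cls_surjective s a
    obtain ⟨b, rfl⟩ := H.cls_surjective s b
    exact H.cls_eq_iff.2 ((H.dist_cls _ _).symm.trans h)
  · obtain ⟨a, rfl⟩ := H.cls_surjective s a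
    obtain ⟨b, rfl⟩ := H.cls_surjective s b
    rw [dist_cls, dist_cls, H.dist_comm]
  · obtain ⟨a, rfl⟩ := H.cls_surjective s a
    obtain ⟨b, rfl⟩ := H.cls_surjective s b
    obtain ⟨c, rfl⟩ := H.cls_surjective s c
    rw [dist_cls, dist_cls, dist_cls]
    exact H.dist_triangle a b c
  · choose y hy using fun n => H.cls_surjective s (x n)
    obtain rfl : (fun n => H.cls s (y n)) = x := funext hy
    simp only [dist_cls] at hx
    choose N hN using fun k : ℕ => hx (1 / 2 ^ k / 2) (by positivity)
    let m : ℕ → ℕ := fun k => (Finset.range (k + 1)).sup N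
    have hm : ∀ k, N k ≤ m k := fun k => Finset.le_sup (f := N) (Finset.self_mem_range_succ k)
    have hm' : ∀ k, N k ≤ m (k + 1) := fun k => Finset.le_sup (f := N) (by simp)
    obtain ⟨a, ha⟩ := hc (fun k => y (m k)) fun k =>
      (hN k _ (hm k) _ (hm' k)).trans_lt (half_lt_self (by positivity))
    refine ⟨H.cls s a, fun ε hε => ?_⟩
    obtain ⟨k, hk⟩ := exists_pow_lt_of_lt_one (half_pos hε |> half_pos) (one_half_lt_one (α := ℝ))
    rw [one_div, inv_pow] at hk
    refine ⟨N k, fun n hn => ?_⟩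
    rw [dist_cls]
    refine (H.dist_triangle _ (y (m k)) _).trans ((add_le_add (hN k n hn _ (hm k)) (ha k)).trans ?_)
    have h1 : (1 : ℝ) / 2 ^ k / 2 ≤ ε / 2 := by
      rw [one_div]
      linarith
    have h2 : (2 : ℝ) / 2 ^ k ≤ ε / 2 := by
      rw [div_eq_mul_inv]
      linarith
    linarith

end Theory.Respects

end Quotient

/-! ### Symbols of the expansion and elements of distance zero -/

theorem Var.single_eta {α : Type u} {X : α → Type w} {b : α} (e : ∀ a, Var [b] a → X a) :
    e = Var.single (e b .zero) := by
  funext a x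
  cases x with
  | zero => rfl
  | succ x => cases x

namespace Theory

open NameSet Formula

theorem names_injective {L : Language.{u}} {V : NameSet L} :
    Function.Injective (names (V := V)) :=
  List.map_injective_iff.2 Subtype.val_injective

theorem eqDist_of_isNew (P : Theory.{u}) {V : NameSet P.L} (S : V.Srt) (hS : S.1.IsNew) :
    P.eqDist V S = .rel (L := V.lang) (EqRel.dist S hS) fun _ x => .var x := by
  rcases S with ⟨S, h⟩
  cases S with
  | base s => exact hS.elim
  | prod F => rfl
  | defset Γ A => rfl
  | canon Γ Δ φ => rfl
  | union Γ n Δ φ => rfl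

theorem coe_rel_dist {P : Theory.{u}} {V : NameSet P.L} (X : Struc V.lang) (S : V.Srt)
    (hS : S.1.IsNew)
    (e : X.Tuple [S, S]) : ((X.rel (Γ := [S, S]) (EqRel.dist S hS) e : unitInterval) : ℝ) =
      (P.expansion V).dist X (e S .zero) (e S (.succ .zero)) := by
  have he : Var.pair (X := X.carrier) (e S .zero) (e S (.succ .zero)) = e := by
    funext s x
    cases x with
    | zero => rfl
    | succ x =>
      cases x with
      | zero => rfl
      | succ x => cases x
  rw [Theory.dist]
  exact Eq.symm (congrArg Subtype.val (Eq.trans (congrArg₂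
    (fun (φ : Formula V.lang [S, S]) e => φ.realize X e) (P.eqDist_of_isNew S hS) he) rfl))

variable (P : Theory.{u})

theorem exists_erase_eq_of_defset (S : P.eqSorts.Srt) : ∀ (Γ : List P.eqSorts.Srt)
    (A : FormulaName P.L), S.1 = Name.defset (names Γ) A →
    ∃ A' : Formula P.eqSorts.lang Γ, A'.erase = A := by
  refine P.eqSorts_induction (Q := fun S => ∀ (Γ : List P.eqSorts.Srt) (A : FormulaName P.L),
    S.1 = Name.defset (names Γ) A → ∃ A' : Formula P.eqSorts.lang Γ, A'.erase = A)
    (fun s Γ A h => ?_) (fun S F hS _ Γ A h => ?_) (fun S Γ' A' hS _ _ _ Γ A h => ?_)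
    (fun S Γ' Δ φ hS _ _ _ Γ A h => ?_) (fun S Γ' n Δ φ hS C hC _ _ _ _ Γ A h => ?_) S
  · injection h
  · injection hS.symm.trans h
  · injection hS.symm.trans h with h₁ h₂
    obtain rfl := names_injective h₁
    exact ⟨A', h₂⟩
  · injection hS.symm.trans h
  · injection hS.symm.trans h

theorem exists_erase_eq_of_union (S : P.eqSorts.Srt) : ∀ (Γ : List P.eqSorts.Srt) (n : ℕ)
    (Δ : Fin (n + 1) → List P.eqSorts.Srt) (φ : Fin (n + 1) → FormulaName P.L),
    S.1 = Name.union (names Γ) n (fun j => names (Δ j)) φ →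
    ∃ φ' : ∀ j, Formula P.eqSorts.lang (Γ ++ Δ j), (fun j => (φ' j).erase) = φ := by
  refine P.eqSorts_induction (Q := fun S => ∀ (Γ : List P.eqSorts.Srt) (n : ℕ)
    (Δ : Fin (n + 1) → List P.eqSorts.Srt) (φ : Fin (n + 1) → FormulaName P.L),
    S.1 = Name.union (names Γ) n (fun j => names (Δ j)) φ →
    ∃ φ' : ∀ j, Formula P.eqSorts.lang (Γ ++ Δ j), (fun j => (φ' j).erase) = φ)
    (fun s Γ n Δ φ h => ?_) (fun S F hS _ Γ n Δ φ h => ?_) (fun S Γ' A' hS _ _ _ Γ n Δ φ h => ?_)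
    (fun S Γ' Δ φ hS _ _ _ Γ n Δ φ h => ?_)
    (fun S Γ' n' Δ' φ' hS C hC _ _ _ _ Γ n Δ φ h => ?_) S
  · injection h
  · injection hS.symm.trans h
  · injection hS.symm.trans h
  · injection hS.symm.trans h
  · injection hS.symm.trans h with h₁ h₂ h₃ h₄
    subst h₂
    obtain rfl := names_injective h₁
    obtain rfl : Δ' = Δ := funext fun j => names_injective (congrFun (eq_of_heq h₃) j)
    exact ⟨φ', eq_of_heq h₄⟩

theorem exists_canon_sort {Γ Δ : List P.eqSorts.Srt} (φ : Formula P.eqSorts.lang (Γ ++ Δ)) :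
    ∃ C : P.eqSorts.Srt, C.1 = Name.canon (names Γ) (names Δ) φ.erase :=
  ⟨⟨_, P.isClosed_eqSorts.canon_mem Γ Δ φ⟩, rfl⟩

variable {P} (hP : P.IsMetric)

namespace EqSpec

variable {V : NameSet P.L} {X : Struc V.lang} (hX : P.EqSpec X)

include hX in
theorem dist_congr {S : V.Srt} {a a' b b' : X.carrier S} (ha : (P.expansion V).dist X a a' = 0)
    (hb : (P.expansion V).dist X b b' = 0) :
    (P.expansion V).dist X a b = (P.expansion V).dist X a' b' := by
  have key : ∀ {a a' b b' : X.carrier S}, (P.expansion V).dist X a a' = 0 →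
      (P.expansion V).dist X b b' = 0 →
      (P.expansion V).dist X a b ≤ (P.expansion V).dist X a' b' := by
    intro a a' b b' ha hb
    have h₁ := hX.dist_triangle S a a' b
    have h₂ := hX.dist_triangle S a' b' b
    have h₃ := hX.dist_comm S b b'
    linarith
  exact le_antisymm (key ha hb)
    (key ((hX.dist_comm _ _ _).trans ha) ((hX.dist_comm _ _ _).trans hb))

include hX in
theorem dist_projFn_le {S : V.Srt} (F : ℕ → V.Srt) (h : S.1 = Name.prod fun n => (F n).1)
    (a b : X.carrier S) (i : ℕ) : (P.expansion V).dist X (projFn X F h i a) (projFn X F h i b) ≤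
      (P.expansion V).dist X a b * 2 ^ (i + 1) := by
  rw [← div_le_iff₀ (by positivity)]
  refine le_of_forall_pos_le_add fun ε hε => ?_
  obtain ⟨m, hm⟩ := exists_pow_lt_of_lt_one hε (one_half_lt_one (α := ℝ))
  have h₁ := (abs_le.1 (hX.prod_dist S F h (m + i + 1) a b)).1
  have h₂ := Finset.single_le_sum (f := fun j : Fin (m + i + 1) =>
    (P.expansion V).dist X (projFn X F h j a) (projFn X F h j b) / 2 ^ ((j : ℕ) + 1))
    (fun j _ => div_nonneg (dist_nonneg' _ _ _ _) (by positivity))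
    (Finset.mem_univ ⟨i, by omega⟩)
  have h₃ : (1 : ℝ) / 2 ^ (m + i + 1) ≤ (1 / 2) ^ m := by
    rw [one_div, one_div, inv_pow]
    exact inv_anti₀ (by positivity) (pow_le_pow_right₀ one_le_two (by omega))
  simp only at h₂
  linarith

include hX in
theorem dist_projFn_eq_zero {S : V.Srt} (F : ℕ → V.Srt) (h : S.1 = Name.prod fun n => (F n).1)
    {a b : X.carrier S} (hab : (P.expansion V).dist X a b = 0) (i : ℕ) :
    (P.expansion V).dist X (projFn X F h i a) (projFn X F h i b) = 0 :=
  le_antisymm ((hX.dist_projFn_le F h a b i).trans (by rw [hab, zero_mul])) (dist_nonneg' _ _ _ _)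

include hX in
theorem paramVal_congr {Γ Δ : List V.Srt} (φ : Formula V.lang (Γ ++ Δ)) {C : V.Srt}
    (hC : C.1 = Name.canon (names Γ) (names Δ) φ.erase) (x : X.Tuple Γ) {z w : X.carrier C}
    (h : (P.expansion V).dist X z w = 0) :
    P.paramVal X Γ Δ φ hC x z = P.paramVal X Γ Δ φ hC x w := by
  rw [paramVal, paramVal]
  refine iInf_congr fun b => ?_
  rw [hX.dist_congr (hX.dist_self _ (quotFn X Γ Δ φ.erase hC b)) h]

end EqSpec

include hP

theorem dist_baseFn_eq_zero {V : NameSet P.L} {X : Struc V.lang} (hX : P.EqSpec X)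
    {Γ : List P.L.Sorts} {s : P.L.Sorts} (f : P.L.Func Γ s)
    {e e' : X.Tuple (Γ.map V.base)} (h : ∀ t x, (P.expansion V).dist X (e t x) (e' t x) = 0) :
    (P.expansion V).dist X (X.fn (s := V.base s) (V.baseHom.onFunc f) e)
      (X.fn (s := V.base s) (V.baseHom.onFunc f) e') = 0 := by
  obtain ⟨e, rfl⟩ := Var.mapElim_surjective V.base (X := X.carrier) Γ e
  obtain ⟨e', rfl⟩ := Var.mapElim_surjective V.base (X := X.carrier) Γ e'
  have h' : ∀ t x, P.dist (X.reduct V.baseHom) (s := t) (e t x) (e' t x) = 0 := by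
    intro t x
    rw [P.dist_reduct V X]
    have := h _ (x.map V.base)
    rwa [Var.mapElim_map, Var.mapElim_map] at this
  refine (P.dist_reduct V X s _ _).symm.trans ?_
  refine le_antisymm (le_of_forall_pos_le_add fun ε hε => ?_) (dist_nonneg' _ _ _ _)
  obtain ⟨δ, hδ, H⟩ := hP.uc_func f ε hε
  rw [zero_add]
  exact H _ hX.base e e' fun t x => (h' t x).trans_lt (hδ t x)

theorem rel_base_eq {V : NameSet P.L} {X : Struc V.lang} (hX : P.EqSpec X)
    {Γ : List P.L.Sorts} (R : P.L.Rel Γ) {e e' : X.Tuple (Γ.map V.base)}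
    (h : ∀ t x, (P.expansion V).dist X (e t x) (e' t x) = 0) :
    X.rel (V.baseHom.onRel R) e = X.rel (V.baseHom.onRel R) e' := by
  obtain ⟨e, rfl⟩ := Var.mapElim_surjective V.base (X := X.carrier) Γ e
  obtain ⟨e', rfl⟩ := Var.mapElim_surjective V.base (X := X.carrier) Γ e'
  have h' : ∀ t x, P.dist (X.reduct V.baseHom) (s := t) (e t x) (e' t x) = 0 := by
    intro t x
    rw [P.dist_reduct V X]
    have := h _ (x.map V.base)
    rwa [Var.mapElim_map, Var.mapElim_map] at this
  refine Subtype.ext (eq_of_abs_sub_eq_zero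
    (le_antisymm (le_of_forall_pos_le_add fun ε hε => ?_) (abs_nonneg _)))
  obtain ⟨δ, hδ, H⟩ := hP.uc_rel R ε hε
  rw [zero_add]
  exact H _ hX.base e e' fun t x => (h' t x).trans_lt (hδ t x)

theorem rel_eq_of_dist_eq_zero {X : Struc P.eqSorts.lang} (hX : P.EqSpec X)
    {Δ : List P.eqSorts.Srt} (R : P.eqSorts.EqRel Δ) {e e' : X.Tuple Δ}
    (h : ∀ t x, P.eq.dist X (e t x) (e' t x) = 0) : X.rel (Γ := Δ) R e = X.rel (Γ := Δ) R e' := by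
  cases R with
  | @base Γ R Δ hΔ =>
    obtain rfl : Δ = Γ.map P.eqSorts.base :=
      names_injective (hΔ.trans (P.eqSorts.names_map_base Γ).symm)
    exact rel_base_eq hP hX R h
  | dist S hS =>
    exact Subtype.ext ((coe_rel_dist X S hS e).trans
      ((hX.dist_congr (h _ _) (h _ _)).trans (coe_rel_dist X S hS e').symm))

/-- All function symbols other than quotient maps respect the relation of having distance `0`, by
the metric theory for the symbols of the base language, and by the axioms for the others. -/
theorem dist_fn_eq_zero_of_quot {X : Struc P.eqSorts.lang} (hX : P.EqSpec X)
    {Δ : List P.eqSorts.Srt} {S : P.eqSorts.Srt} (f : P.eqSorts.EqFunc Δ S) {e e' : X.Tuple Δ}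
    (h : ∀ t x, P.eq.dist X (e t x) (e' t x) = 0)
    (hq : ∀ Γ φ hS, f = EqFunc.quot Γ Δ φ hS → P.eq.dist X (X.fn (Γ := Δ) (s := S) f e)
      (X.fn (Γ := Δ) (s := S) f e') = 0) :
    P.eq.dist X (X.fn (Γ := Δ) (s := S) f e) (X.fn (Γ := Δ) (s := S) f e') = 0 := by
  cases f with
  | @base Γ s f Δ S hΔ hS =>
    obtain rfl : Δ = Γ.map P.eqSorts.base :=
      names_injective (hΔ.trans (P.eqSorts.names_map_base Γ).symm)
    obtain rfl : S = P.eqSorts.base s := Subtype.ext hS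
    exact dist_baseFn_eq_zero hP hX f h
  | @proj T F hS n =>
    rw [Var.single_eta e, Var.single_eta e']
    exact hX.dist_projFn_eq_zero F hS (h _ _) n
  | @incl T Γ A hS s i =>
    obtain ⟨A, rfl⟩ := P.exists_erase_eq_of_defset T Γ A hS
    rw [Var.single_eta e, Var.single_eta e']
    refine le_antisymm ((P.eq.dist_le_tupDist (inclFn X Γ A.erase hS (e _ .zero))
      (inclFn X Γ A.erase hS (e' _ .zero)) i).trans_eq ?_) (dist_nonneg' _ _ _ _)
    exact (hX.defset_dist _ Γ A hS _ _).symm.trans (h _ _)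
  | quot Γ Δ φ hS => exact hq Γ φ hS rfl
  | @inj T C Γ n Δ φ hS j hC =>
    obtain ⟨φ, rfl⟩ := P.exists_erase_eq_of_union _ Γ n Δ φ hS
    rw [Var.single_eta e, Var.single_eta e']
    choose D hD using fun j => P.exists_canon_sort (φ j)
    obtain rfl : C = D j := Subtype.ext (hC.trans (hD j).symm)
    have hlub := hX.union_dist _ Γ n Δ φ hS D hD j j (e _ .zero) (e' _ .zero)
    have := X.nonempty_tuple Γ
    refine hlub.unique ?_
    simp only [hX.paramVal_congr (φ j) (hD j) _ (h _ .zero), sub_self, abs_zero, Set.range_const]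
    exact isLUB_singleton

/-- Function symbols of the expansion do not distinguish elements of distance `0`. For the quotient
map of `φ`, this depends on the symbols in `φ`; so it is proved by induction on the imaginary sort
of the values. -/
theorem dist_fn_eq_zero (S : P.eqSorts.Srt) : ∀ (X : Struc P.eqSorts.lang), P.EqSpec X →
    ∀ (Δ : List P.eqSorts.Srt) (f : P.eqSorts.EqFunc Δ S) (e e' : X.Tuple Δ),
    (∀ t x, P.eq.dist X (e t x) (e' t x) = 0) →
    P.eq.dist X (X.fn (Γ := Δ) (s := S) f e) (X.fn (Γ := Δ) (s := S) f e') = 0 := by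
  let Q : P.eqSorts.Srt → Prop := fun S => ∀ (X : Struc P.eqSorts.lang), P.EqSpec X →
    ∀ (Δ : List P.eqSorts.Srt) (f : P.eqSorts.EqFunc Δ S) (e e' : X.Tuple Δ),
    (∀ t x, P.eq.dist X (e t x) (e' t x) = 0) →
    P.eq.dist X (X.fn (Γ := Δ) (s := S) f e) (X.fn (Γ := Δ) (s := S) f e') = 0
  have hterm : ∀ (X : Struc P.eqSorts.lang), P.EqSpec X → ∀ {Γ : List P.eqSorts.lang.Sorts}
      {s : P.eqSorts.lang.Sorts} (t : Term P.eqSorts.lang Γ s), t.SortsIn Q →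
      ∀ e e' : X.Tuple Γ, (∀ t x, P.eq.dist X (e t x) (e' t x) = 0) →
      P.eq.dist X (t.realize X e) (t.realize X e') = 0 := by
    intro X hX Γ s t ht e e' h
    induction t with
    | var x => exact h _ x
    | app f ts ih => exact ht.1 X hX _ f _ _ fun t x => ih t x (ht.2 t x)
  have hform : ∀ (X : Struc P.eqSorts.lang), P.EqSpec X → ∀ {Γ : List P.eqSorts.lang.Sorts}
      (φ : Formula P.eqSorts.lang Γ), φ.SortsIn Q →
      ∀ e e' : X.Tuple Γ, (∀ t x, P.eq.dist X (e t x) (e' t x) = 0) →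
      φ.realize X e = φ.realize X e' := by
    intro X hX Γ φ hφ e e' h
    induction φ with
    | rel R ts =>
      exact rel_eq_of_dist_eq_zero hP hX R fun t x => hterm X hX (ts t x) (hφ.2 t x) e e' h
    | conn n c φ ih => exact congrArg c (funext fun i => ih i (hφ i) e e' h)
    | all s φ ih =>
      refine iSup_congr fun a => ih hφ.2 _ _ fun t x => ?_
      cases x with
      | zero => exact hX.dist_self _ a
      | succ x => exact h t x
    | ex s φ ih =>
      refine iInf_congr fun a => ih hφ.2 _ _ fun t x => ?_
      cases x with
      | zero => exact hX.dist_self _ a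
      | succ x => exact h t x
  refine P.eqSorts_induction (Q := Q) (fun s X hX Δ f e e' h => ?_)
    (fun S F hS _ X hX Δ f e e' h => ?_) (fun S Γ' A' hS _ _ _ X hX Δ f e e' h => ?_)
    (fun S Γ' Δ' φ' hS _ _ hφ X hX Δ f e e' h => ?_)
    (fun S Γ' n' Δ' φ' hS C hC _ _ _ _ X hX Δ f e e' h => ?_) S
  · refine dist_fn_eq_zero_of_quot hP hX f h fun Γ φ hS' => ?_
    injection hS'
  · refine dist_fn_eq_zero_of_quot hP hX f h fun Γ φ hS' => ?_
    injection hS.symm.trans hS'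
  · refine dist_fn_eq_zero_of_quot hP hX f h fun Γ φ hS' => ?_
    injection hS.symm.trans hS'
  · refine dist_fn_eq_zero_of_quot hP hX f h fun Γ φ hS' hf => ?_
    injection hS.symm.trans hS' with h₁ h₂ h₃
    obtain rfl := names_injective h₁
    obtain rfl := names_injective h₂
    subst h₃ hf
    have hlub := hX.canon_dist S Γ' Δ' φ' hS e e'
    have := X.nonempty_tuple Γ'
    refine hlub.unique ?_
    have key : ∀ x : X.Tuple Γ', φ'.realize X (Var.append (X := X.carrier) x e) =
        φ'.realize X (Var.append (X := X.carrier) x e') := by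
      refine fun x => hform X hX φ' hφ _ _ fun t v => ?_
      refine Var.append_cases Γ' (p := fun v => P.eq.dist X
        (Var.append (X := X.carrier) x e t v) (Var.append (X := X.carrier) x e' t v) = 0)
        (fun v => ?_) (fun v => ?_) v
      · rw [Var.append_inl, Var.append_inl]
        exact hX.dist_self _ _
      · rw [Var.append_inr, Var.append_inr]
        exact h t v
    simp only [key, sub_self, abs_zero, Set.range_const]
    exact isLUB_singleton
  · refine dist_fn_eq_zero_of_quot hP hX f h fun Γ φ hS' => ?_
    injection hS.symm.trans hS'

theorem respects_of_eqSpec {X : Struc P.eqSorts.lang} (hX : P.EqSpec X) : P.eq.Respects X where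
  dist_self := hX.dist_self _
  dist_comm := hX.dist_comm _
  dist_triangle := hX.dist_triangle _
  fn {Γ s} f e e' h := dist_fn_eq_zero hP s X hX Γ f e e' h
  rel R _ _ h := rel_eq_of_dist_eq_zero hP hX R h

end Theory

/-! ### Amalgamation of an elementary map with an ultrapower -/

section Approx

variable {L : Language.{u}} {M N : Struc L} (g : ElemMap M N)

/-- Finitely many elements of `N` have images in `M` that satisfy a formula almost as well, where
the elements in the range of `g` are mapped to their preimages. -/
theorem ElemMap.exists_approx (hg : ∀ s, Function.Injective (g.toFun s)) {Δ : List L.Sorts}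
    (φ : Formula L Δ) (e : N.Tuple Δ) {ε : ℝ} (hε : 0 < ε) :
    ∃ h : ∀ s, N.carrier s → M.carrier s, (∀ s a, h s (g.toFun s a) = a) ∧
      (φ.realize M (fun s x => h s (e s x)) : ℝ) ≤ φ.realize N e + ε := by
  classical
  -- equal entries of the tuple must have equal images: the variables with the same value are
  -- replaced by a single one, and those with values in the range of `g` by parameters
  let rep : ∀ s b, (∃ y : Var Δ s, e s y = b) → Var Δ s := fun s b h => h.choose
  have hrep : ∀ s b h, e s (rep s b h) = b := fun s b h => h.choose_spec
  let p : M.Tuple Δ := fun s x =>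
    if h : ∃ a, g.toFun s a = e s x then h.choose else (M.nonempty s).some
  have hp : ∀ s x, (∃ a, g.toFun s a = e s x) → g.toFun s (p s x) = e s x := fun s x h => by
    simp only [p, dif_pos h]
    exact h.choose_spec
  let σ : ∀ s, Var Δ s → Var (Δ ++ Δ) s := fun s x =>
    if ∃ a, g.toFun s a = e s x then x.inr Δ else (rep s (e s x) ⟨x, rfl⟩).inl
  let ψ : Formula L (Δ ++ Δ) := φ.subst fun s x => .var (σ s x)
  have hψ : ψ.realize N (Var.append (X := N.carrier) e fun s x => g.toFun s (p s x)) =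
      φ.realize N e := by
    rw [Formula.realize_subst]
    congr 1
    funext s x
    by_cases h : ∃ a, g.toFun s a = e s x
    · simp only [Term.realize, σ, if_pos h, Var.append_inr]
      exact hp s x h
    · simp only [Term.realize, σ, if_neg h, Var.append_inl]
      exact hrep _ _ _
  have hM := M.nonempty_tuple Δ
  have hN := N.nonempty_tuple Δ
  have h₁ : ((Formula.exBlock Δ ψ).realize M p : ℝ) ≤ φ.realize N e := by
    rw [← g.map_formula, Formula.realize_exBlock, ← hψ]
    exact iInf_le (fun x : N.Tuple Δ => ψ.realize N (Var.append (X := N.carrier) x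
      fun s x => g.toFun s (p s x))) e
  rw [Formula.realize_exBlock] at h₁
  obtain ⟨_, ⟨m, rfl⟩, hm⟩ := (isGLB_lt_iff (unitInterval_isGLB_iInf fun x : M.Tuple Δ =>
    ψ.realize M (Var.append (X := M.carrier) x p))).1 (h₁.trans_lt (lt_add_of_pos_right _ hε))
  refine ⟨fun s b => if h : ∃ a, g.toFun s a = b then h.choose else
    if h' : ∃ y : Var Δ s, e s y = b then m s (rep s b h') else (M.nonempty s).some,
    fun s a => ?_, le_of_eq_of_le (congrArg Subtype.val ?_) hm.le⟩
  · have h : ∃ a', g.toFun s a' = g.toFun s a := ⟨a, rfl⟩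
    exact (dif_pos h).trans (hg s h.choose_spec)
  · change _ = ψ.realize M _
    rw [Formula.realize_subst]
    congr 1
    funext s x
    by_cases h : ∃ a, g.toFun s a = e s x
    · simp only [Term.realize, σ, if_pos h, dif_pos h, Var.append_inr, p]
    · have h' : ∃ y : Var Δ s, e s y = e s x := ⟨x, rfl⟩
      simp only [Term.realize, σ, if_neg h, dif_neg h, dif_pos h', Var.append_inl]

/-- Finitely many conditions on a map `h : N → M` are expressed by a single formula `ψ`: if `ψ` is
small at the image of a certain tuple, then `h` almost preserves the values of the given formulas.
-/
theorem exists_formula_of_list (N : Struc L) (l : List (Σ Γ, Formula L Γ × N.Tuple Γ)) :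
    ∃ (Δ : List L.Sorts) (ψ : Formula L Δ) (e : N.Tuple Δ), ψ.realize N e = 0 ∧
      ∀ (M : Struc L) (h : ∀ s, N.carrier s → M.carrier s), ∀ p ∈ l,
        |(p.2.1.realize M (fun s x => h s (p.2.2 s x)) : ℝ) - p.2.1.realize N p.2.2| ≤
          ψ.realize M fun s x => h s (e s x) := by
  induction l with
  | nil =>
    refine ⟨[], .const 0, Var.nil, ?_, fun M h p hp => by simp at hp⟩
    rw [Formula.realize_eq_zero_iff, Formula.realize_const _ _ ⟨le_rfl, zero_le_one⟩]
  | cons q l ih =>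
    obtain ⟨Δ, ψ, e, h₀, h₁⟩ := ih
    obtain ⟨Γ, φ, f⟩ := q
    have hr := (φ.realize N f).2
    obtain ⟨χ, key⟩ : ∃ χ : Formula L (Γ ++ Δ), ∀ (M : Struc L) (a : M.Tuple Γ) (b : M.Tuple Δ),
        (χ.realize M (Var.append (X := M.carrier) a b) : ℝ) =
        max |(φ.realize M a : ℝ) - φ.realize N f| (ψ.realize M b) := by
      refine ⟨.max (.absDiff (φ.subst fun _ x => .var (x.inl (Δ := Δ)))
        (.const (φ.realize N f))) (ψ.subst fun _ x => .var (x.inr Γ)), fun M a b => ?_⟩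
      rw [Formula.realize_max, Formula.realize_absDiff, Formula.realize_const _ _ hr,
        Formula.realize_subst, Formula.realize_subst]
      simp only [Term.realize, Var.append_inl, Var.append_inr]
    refine ⟨Γ ++ Δ, χ, Var.append (X := N.carrier) f e, ?_, fun M h p hp => ?_⟩
    · rw [Formula.realize_eq_zero_iff, key, h₀]
      simp
    · rw [Var.append_map (Y := M.carrier) h, key]
      rcases List.mem_cons.1 hp with rfl | hp
      · exact le_max_left _ _
      · exact (h₁ M h p hp).trans (le_max_right _ _)

/-- `N` maps to an ultrapower of `M`, over `M`: the coordinates of this map are maps `h i` which are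
inverse to `g` on its range and preserve finitely many values up to a small error. The function `ν`
shows that the ultrafilter is countably incomplete. -/
theorem ElemMap.exists_power (hg : ∀ s, Function.Injective (g.toFun s)) :
    ∃ (I : Type u) (U : Ultrafilter I) (ν : I → ℕ) (h : I → ∀ s, N.carrier s → M.carrier s),
      (∀ n, ∀ᶠ i in U, n ≤ ν i) ∧ (∀ i s a, h i s (g.toFun s a) = a) ∧
      ∀ {Γ : List L.Sorts} (φ : Formula L Γ) (e : N.Tuple Γ),
        (ulim U fun i => φ.realize M fun s x => h i s (e s x)) = φ.realize N e := by
  classical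
  let I : Type u := Finset (Σ Γ, Formula L Γ × N.Tuple Γ) × ℕ
  have key : ∀ i : I, ∃ h : ∀ s, N.carrier s → M.carrier s, (∀ s a, h s (g.toFun s a) = a) ∧
      ∀ p ∈ i.1, |(p.2.1.realize M (fun s x => h s (p.2.2 s x)) : ℝ) - p.2.1.realize N p.2.2| ≤
        1 / ((i.2 : ℝ) + 1) := by
    intro i
    obtain ⟨Δ, ψ, e, h₀, h₁⟩ := exists_formula_of_list N i.1.toList
    obtain ⟨h, hh, he⟩ := g.exists_approx hg ψ e (ε := 1 / ((i.2 : ℝ) + 1)) (by positivity)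
    refine ⟨h, hh, fun p hp => (h₁ M h p (Finset.mem_toList.2 hp)).trans ?_⟩
    rw [h₀] at he
    simpa using he
  choose h hh hφ using key
  refine ⟨I, Ultrafilter.of Filter.atTop, fun i => i.2, h, fun n => ?_, hh, fun {Γ} φ e => ?_⟩
  · refine Ultrafilter.of_le _ (Filter.mem_of_superset
      (Filter.eventually_ge_atTop ((∅, n) : I)) fun i hi => ?_)
    exact hi.2
  · refine ulim_eq ?_
    rw [tendsto_subtype_rng, Metric.tendsto_nhds]
    intro ε hε
    obtain ⟨n, hn⟩ := exists_nat_one_div_lt hε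
    refine Ultrafilter.of_le _ (Filter.mem_of_superset
      (Filter.eventually_ge_atTop (({⟨Γ, φ, e⟩}, n) : I)) fun i hi => ?_)
    refine (hφ i ⟨Γ, φ, e⟩ (hi.1 (Finset.mem_singleton_self _))).trans_lt (lt_of_le_of_lt ?_ hn)
    have : (n : ℝ) ≤ i.2 := Nat.cast_le.2 hi.2
    exact one_div_le_one_div_of_le (by positivity) (by linarith)

end Approx

theorem Formula.realize_map_mapElim {L L' : Language.{u}} (h : LHom L L') (M : Struc L')
    {Γ : List L.Sorts} (φ : Formula L Γ) (e : (M.reduct h).Tuple Γ) :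
    (φ.map h).realize M (Var.mapElim h.onSort (X := M.carrier) Γ e) =
      φ.realize (M.reduct h) e := by
  refine (Formula.realize_map h M φ _).trans (congrArg (φ.realize (M.reduct h)) ?_)
  funext s x
  exact Var.mapElim_map h.onSort (X := M.carrier) Γ e s x

namespace Theory

open NameSet

variable {P : Theory.{u}} (hP : P.IsMetric)

include hP in
/-- Every elementary map of reducts is a part of an elementary extension of models of the expansion:
if `g : F(M) → F(N)` then there are `δ : M → M'` and `h : F(N) → F(M')` with `h ∘ g = F(δ)`. Here
`M'` is the ultrapower of `M`, including its imaginary sorts, after identification of elements of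
distance `0`, and `δ` is the diagonal map. -/
theorem exists_amalgam {M N : Mod P.eq} (g : P.forgetEq.obj M ⟶ P.forgetEq.obj N) :
    ∃ (M' : Mod P.eq) (δ : M ⟶ M') (h : P.forgetEq.obj N ⟶ P.forgetEq.obj M'),
      g ≫ h = P.forgetEq.map δ := by
  let g' : ElemMap (P.forgetEq.obj M).str (P.forgetEq.obj N).str := g
  have hg : ∀ s, Function.Injective (g'.toFun s) := by
    intro s a b hab
    refine ((P.forgetEq.obj M).complete s).eq_of_eq_zero ?_
    have h := congrArg Subtype.val
      (g'.map_formula (P.d s) (Var.pair (X := (P.forgetEq.obj M).str.carrier) a b))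
    rw [Var.map_pair (Y := (P.forgetEq.obj N).str.carrier) g'.toFun, hab] at h
    exact h.symm.trans (((P.forgetEq.obj N).complete s).self _)
  obtain ⟨I, U, ν, h, hν, hh, hφ⟩ := g'.exists_power hg
  have hM := (P.expansion_holds_iff M.str).1 M.holds
  have hpow := P.eq.holds_power U M.str M.holds
  let H := respects_of_eqSpec hP ((P.expansion_holds_iff _).1 hpow)
  let M' : Mod P.eq :=
    { str := H.quotient
      holds := H.holds_quotient hpow
      complete := fun s => H.isCompleteMetric_quotient
        (P.eq.exists_lim_power U M.str ν hν (hM.dist_self s) (hM.dist_triangle s)) }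
  let δ : M ⟶ M' :=
    { toFun := fun s a => H.cls s fun _ => a
      map_fn := fun f e => H.cls_fn f fun s x _ => e s x
      map_formula := fun φ e => (H.realize_cls φ fun s x _ => e s x).trans
        (φ.realize_power_const M.str U e) }
  have hcls : ∀ {Γ : List P.L.Sorts} (e : (P.forgetEq.obj N).str.Tuple Γ),
      Var.mapElim P.eqSorts.base (X := H.quotient.carrier) Γ (fun s x =>
        H.cls (P.eqSorts.base s) fun i => h i s (e s x)) = fun s x =>
        H.cls s (Var.mapElim P.eqSorts.base (X := (M.str.power U).carrier) Γ
          (fun s x i => h i s (e s x)) s x) := by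
    intro Γ e
    funext s x
    exact (Var.apply_mapElim P.eqSorts.base (Y := H.quotient.carrier) H.cls Γ _ s x).symm
  have hcoord : ∀ {Γ : List P.L.Sorts} (e : (P.forgetEq.obj N).str.Tuple Γ) (i : I),
      (fun s x => Var.mapElim P.eqSorts.base (X := (M.str.power U).carrier) Γ
        (fun s x i => h i s (e s x)) s x i) =
      Var.mapElim P.eqSorts.base (X := M.str.carrier) Γ fun s x => h i s (e s x) := by
    intro Γ e i
    funext s x
    exact Var.apply_mapElim P.eqSorts.base (X := (M.str.power U).carrier) (Y := M.str.carrier)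
      (fun s z => z i) Γ _ s x
  let k : ElemMap (P.forgetEq.obj N).str (P.forgetEq.obj M').str :=
    { toFun := fun s b => H.cls (P.eqSorts.base s) fun i => h i s b
      map_fn := fun {Γ s} f e => by
        refine Eq.trans ?_ (congrArg (H.quotient.fn (P.eqSorts.baseHom.onFunc f)) (hcls e)).symm
        refine (H.cls_eq_iff.2 ?_).trans (H.cls_fn (P.eqSorts.baseHom.onFunc f) _)
        let χ : Formula P.L (s :: Γ) :=
          .distTerm P.d (.var .zero) (.app f fun _ x => .var x.succ)
        have hχ : ∀ (K : Struc P.L) (b : K.carrier s) (c : K.Tuple Γ),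
            (χ.realize K (Var.cons (X := K.carrier) b c) : ℝ) = P.dist K b (K.fn f c) := by
          intro K b c
          rw [Formula.realize_distTerm]
          rfl
        have hlim := hφ χ (Var.cons (X := (P.forgetEq.obj N).str.carrier)
          ((P.forgetEq.obj N).str.fn f e) e)
        refine (P.eq.dist_power U M.str (s := P.eqSorts.base s) _ _).trans ?_
        refine (congrArg Subtype.val (Eq.trans (congrArg (ulim U) (funext fun i => Subtype.ext ?_))
          hlim)).trans ((hχ _ _ _).trans (((P.forgetEq.obj N).complete s).self _))
        refine Eq.trans ?_ (congrArg (fun e => ((χ.realize (P.forgetEq.obj M).str e :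
          unitInterval) : ℝ)) (Var.map_cons (X := (P.forgetEq.obj N).str.carrier)
          (Y := (P.forgetEq.obj M).str.carrier) (h i) _ e)).symm
        refine Eq.trans ?_ (hχ _ _ _).symm
        refine Eq.trans ?_ (P.dist_reduct P.eqSorts M.str s _ _).symm
        exact congrArg (fun e => P.eq.dist M.str (s := P.eqSorts.base s) _
          (M.str.fn (P.eqSorts.baseHom.onFunc f) e)) (hcoord e i)
      map_formula := fun {Γ} φ e => by
        refine (φ.realize_map_mapElim P.eqSorts.baseHom H.quotient _).symm.trans ?_
        refine (congrArg _ (hcls e)).trans ((H.realize_cls _ _).trans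
          ((Formula.realize_power _ _ _ _).trans (Eq.trans ?_ (hφ φ e))))
        exact congrArg (ulim U) (funext fun i => Eq.trans (congrArg _ (hcoord e i))
          (φ.realize_map_mapElim P.eqSorts.baseHom M.str _)) }
  refine ⟨M', δ, k, ElemMap.ext ?_⟩
  funext s a
  exact congrArg (H.cls (P.eqSorts.base s)) (funext fun i => hh i s a)

end Theory

/-! ### Lifting elementary maps to imaginary elements -/

/-- The quotient maps to sorts of canonical parameters and the inclusions in unions; the sorts of
their values are the closures of the ranges of such functions. -/
def NameSet.EqFunc.IsDense {L : Language.{u}} {V : NameSet L} {Δ : List V.Srt} {S : V.Srt} :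
    V.EqFunc Δ S → Prop
  | .quot _ _ _ _ => True
  | .inj _ _ _ _ _ _ _ => True
  | _ => False

/-- Names of sorts of canonical parameters and of unions. -/
def Name.IsClosure {L : Language.{u}} : Name L → Prop
  | .canon _ _ _ => True
  | .union _ _ _ _ => True
  | _ => False

namespace Theory

open NameSet Formula

variable {P : Theory.{u}}

/-- Elementary maps between the reducts of two models of the expansion. -/
abbrev ReductMap (M N : Mod P.eq) : Type u :=
  ElemMap (M.str.reduct P.eqSorts.baseHom) (N.str.reduct P.eqSorts.baseHom)

/-- The relation between imaginary elements of `M` and of `N` which is induced by a map `g` of the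
reducts: elements of products and of definable sets correspond if all their coordinates do, and
canonical parameters and elements of unions correspond if they are limits of corresponding values of
the dense function symbols. -/
inductive Lift {M N : Mod P.eq} (g : ReductMap M N) :
    ∀ S : P.eqSorts.Srt, M.str.carrier S → N.str.carrier S → Prop
  | base (s : P.L.Sorts) (a : M.str.carrier (P.eqSorts.base s)) :
      Lift g (P.eqSorts.base s) a (g.toFun s a)
  | prod (S : P.eqSorts.Srt) (F : ℕ → P.eqSorts.Srt) (h : S.1 = Name.prod fun n => (F n).1)
      (z : M.str.carrier S) (w : N.str.carrier S)
      (hzw : ∀ n, Lift g (F n) (projFn M.str F h n z) (projFn N.str F h n w)) : Lift g S z w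
  | defset (S : P.eqSorts.Srt) (Γ : List P.eqSorts.Srt) (A : Formula P.eqSorts.lang Γ)
      (h : S.1 = Name.defset (names Γ) A.erase) (z : M.str.carrier S) (w : N.str.carrier S)
      (hzw : ∀ s x, Lift g s (inclFn M.str Γ A.erase h z s x) (inclFn N.str Γ A.erase h w s x)) :
      Lift g S z w
  | lim (S : P.eqSorts.Srt) (Δ : List P.eqSorts.Srt) (f : P.eqSorts.EqFunc Δ S) (hf : f.IsDense)
      (z : M.str.carrier S) (w : N.str.carrier S) (b : ∀ ε : ℝ, 0 < ε → M.str.Tuple Δ)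
      (b' : ∀ ε : ℝ, 0 < ε → N.str.Tuple Δ)
      (hb : ∀ ε hε s x, Lift g s (b ε hε s x) (b' ε hε s x))
      (hz : ∀ ε hε, P.eq.dist M.str (M.str.fn (Γ := Δ) (s := S) f (b ε hε)) z ≤ ε)
      (hw : ∀ ε hε, P.eq.dist N.str (N.str.fn (Γ := Δ) (s := S) f (b' ε hε)) w ≤ ε) : Lift g S z w

/-- Correspondence of tuples. -/
abbrev LiftTuple {M N : Mod P.eq} (g : ReductMap M N) {Γ : List P.eqSorts.Srt} (e : M.str.Tuple Γ)
    (e' : N.str.Tuple Γ) : Prop :=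
  ∀ s x, Lift g s (e s x) (e' s x)

theorem Mod.eqSpec (M : Mod P.eq) : P.EqSpec M.str := (P.expansion_holds_iff M.str).1 M.holds

section Inversion

variable {M N : Mod P.eq} {g : ReductMap M N} {S : P.eqSorts.Srt} {z : M.str.carrier S}
  {w : N.str.carrier S}

theorem isClosure_of_isDense {Δ : List P.eqSorts.Srt} {f : P.eqSorts.EqFunc Δ S} (hf : f.IsDense) :
    S.1.IsClosure := by
  cases f with
  | quot Γ Δ φ h => rw [h]; trivial
  | inj Γ n Δ φ h => rw [h]; trivial
  | base => exact hf.elim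
  | proj => exact hf.elim
  | incl => exact hf.elim

theorem Lift.base_inv_aux (h : Lift g S z w) : ∀ (s : P.L.Sorts) (hS : S = P.eqSorts.base s),
    (hS ▸ w : N.str.carrier (P.eqSorts.base s)) =
      g.toFun s (hS ▸ z : M.str.carrier (P.eqSorts.base s)) := by
  intro s hS
  cases h with
  | base s' =>
    obtain rfl : s' = s := by
      have := congrArg Subtype.val hS
      injection this
    rfl
  | prod _ F h => subst hS; injection h
  | defset _ Γ A h => subst hS; injection h
  | lim _ Δ f hf =>
    have := isClosure_of_isDense hf
    rw [hS] at this
    exact this.elim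

theorem Lift.base_inv {s : P.L.Sorts} {a : M.str.carrier (P.eqSorts.base s)}
    {b : N.str.carrier (P.eqSorts.base s)} (h : Lift g (P.eqSorts.base s) a b) :
    b = g.toFun s a := h.base_inv_aux s rfl

theorem Lift.proj (h : Lift g S z w) (F : ℕ → P.eqSorts.Srt) (hS : S.1 = Name.prod fun n => (F n).1)
    (n : ℕ) : Lift g (F n) (projFn M.str F hS n z) (projFn N.str F hS n w) := by
  cases h with
  | base s => injection hS
  | prod _ F' h _ _ H =>
    injection h.symm.trans hS with h'
    obtain rfl : F' = F := funext fun n => Subtype.ext (congrFun h' n)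
    exact H n
  | defset _ Γ A h => injection h.symm.trans hS
  | lim _ Δ f hf =>
    have := isClosure_of_isDense hf
    rw [hS] at this
    exact this.elim

theorem Lift.incl (h : Lift g S z w) (Γ : List P.eqSorts.Srt) (A : FormulaName P.L)
    (hS : S.1 = Name.defset (names Γ) A) :
    LiftTuple g (inclFn M.str Γ A hS z) (inclFn N.str Γ A hS w) := by
  cases h with
  | base s => injection hS
  | prod _ F h => injection h.symm.trans hS
  | defset _ Γ' A' h _ _ H =>
    injection h.symm.trans hS with h₁ h₂
    obtain rfl := names_injective h₁
    subst h₂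
    exact H
  | lim _ Δ f hf =>
    have := isClosure_of_isDense hf
    rw [hS] at this
    exact this.elim

theorem Lift.lim_inv (h : Lift g S z w) (hS : S.1.IsClosure) :
    ∃ (Δ : List P.eqSorts.Srt) (f : P.eqSorts.EqFunc Δ S), f.IsDense ∧ ∀ ε : ℝ, 0 < ε →
      ∃ (b : M.str.Tuple Δ) (b' : N.str.Tuple Δ), LiftTuple g b b' ∧
        P.eq.dist M.str (M.str.fn (Γ := Δ) (s := S) f b) z ≤ ε ∧
        P.eq.dist N.str (N.str.fn (Γ := Δ) (s := S) f b') w ≤ ε := by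
  cases h with
  | base s => exact hS.elim
  | prod _ F h => rw [h] at hS; exact hS.elim
  | defset _ Γ A h => rw [h] at hS; exact hS.elim
  | lim _ Δ f hf _ _ b b' hb hz hw =>
    exact ⟨Δ, f, hf, fun ε hε => ⟨b ε hε, b' ε hε, hb ε hε, hz ε hε, hw ε hε⟩⟩

theorem Lift.of_forall_exists {Δ : List P.eqSorts.Srt} (f : P.eqSorts.EqFunc Δ S) (hf : f.IsDense)
    (h : ∀ ε : ℝ, 0 < ε → ∃ (b : M.str.Tuple Δ) (b' : N.str.Tuple Δ), LiftTuple g b b' ∧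
      P.eq.dist M.str (M.str.fn (Γ := Δ) (s := S) f b) z ≤ ε ∧
      P.eq.dist N.str (N.str.fn (Γ := Δ) (s := S) f b') w ≤ ε) : Lift g S z w := by
  choose b b' hb hz hw using h
  exact .lim S Δ f hf z w b b' hb hz hw

/-- Function symbols preserve the correspondence. -/
theorem LiftTuple.fn {Δ : List P.eqSorts.Srt} {e : M.str.Tuple Δ} {e' : N.str.Tuple Δ}
    (h : LiftTuple g e e') (f : P.eqSorts.EqFunc Δ S) :
    Lift g S (M.str.fn (Γ := Δ) (s := S) f e) (N.str.fn (Γ := Δ) (s := S) f e') := by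
  have hdense : f.IsDense →
      Lift g S (M.str.fn (Γ := Δ) (s := S) f e) (N.str.fn (Γ := Δ) (s := S) f e') := fun hf =>
    .of_forall_exists f hf fun ε hε => ⟨e, e', h, ((Mod.eqSpec M).dist_self _ _).trans_le hε.le,
      ((Mod.eqSpec N).dist_self _ _).trans_le hε.le⟩
  cases f with
  | @base Γ s f Δ S hΔ hS =>
    obtain rfl : Δ = Γ.map P.eqSorts.base :=
      names_injective (hΔ.trans (P.eqSorts.names_map_base Γ).symm)
    obtain rfl : S = P.eqSorts.base s := Subtype.ext hS
    obtain ⟨e, rfl⟩ := Var.mapElim_surjective P.eqSorts.base (X := M.str.carrier) Γ e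
    obtain ⟨e', rfl⟩ := Var.mapElim_surjective P.eqSorts.base (X := N.str.carrier) Γ e'
    have he : e' = fun t x => g.toFun t (e t x) := by
      funext t x
      have := h _ (x.map P.eqSorts.base)
      rw [Var.mapElim_map, Var.mapElim_map] at this
      exact this.base_inv
    subst he
    have h' := g.map_fn f e
    have h'' := Lift.base (g := g) s ((M.str.reduct P.eqSorts.baseHom).fn f e)
    rw [h'] at h''
    exact h''
  | @proj T F hS n =>
    rw [Var.single_eta e, Var.single_eta e']
    exact (h T .zero).proj F hS n
  | @incl T Γ A hS s i =>
    rw [Var.single_eta e, Var.single_eta e']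
    exact (h T .zero).incl Γ A hS _ i
  | quot Γ Δ φ hS => exact hdense trivial
  | inj Γ n Δ φ hS j hC => exact hdense trivial

theorem LiftTuple.term {Γ : List P.eqSorts.lang.Sorts} {e : M.str.Tuple Γ} {e' : N.str.Tuple Γ}
    (h : LiftTuple g e e') {s : P.eqSorts.lang.Sorts} (t : Term P.eqSorts.lang Γ s) :
    Lift g s (t.realize M.str e) (t.realize N.str e') := by
  induction t with
  | var x => exact h _ x
  | app f ts ih => exact LiftTuple.fn (fun t x => ih t x) f

theorem LiftTuple.cons {s : P.eqSorts.Srt} {Γ : List P.eqSorts.Srt} {a : M.str.carrier s}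
    {b : N.str.carrier s} {e : M.str.Tuple Γ} {e' : N.str.Tuple Γ} (hab : Lift g s a b)
    (h : LiftTuple g e e') : LiftTuple g (Var.cons (X := M.str.carrier) a e)
      (Var.cons (X := N.str.carrier) b e') := by
  intro t x
  cases x with
  | zero => exact hab
  | succ x => exact h t x

theorem LiftTuple.append {Γ Δ : List P.eqSorts.Srt} {e : M.str.Tuple Γ} {e' : N.str.Tuple Γ}
    {f : M.str.Tuple Δ} {f' : N.str.Tuple Δ} (h : LiftTuple g e e') (h' : LiftTuple g f f') :
    LiftTuple g (Var.append (X := M.str.carrier) e f) (Var.append (X := N.str.carrier) e' f') := by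
  intro t x
  refine Var.append_cases Γ (p := fun x => Lift g t (Var.append (X := M.str.carrier) e f t x)
    (Var.append (X := N.str.carrier) e' f' t x)) (fun v => ?_) (fun v => ?_) x
  · rw [Var.append_inl, Var.append_inl]
    exact h t v
  · rw [Var.append_inr, Var.append_inr]
    exact h' t v

end Inversion

/-- An element of a product is determined by its coordinates. -/
theorem ext_of_projFn (N : Mod P.eq) {S : P.eqSorts.Srt} (F : ℕ → P.eqSorts.Srt)
    (h : S.1 = Name.prod fun n => (F n).1) {w w' : N.str.carrier S}
    (hw : ∀ n, projFn N.str F h n w = projFn N.str F h n w') : w = w' := by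
  refine (N.complete S).eq_of_eq_zero (le_antisymm (le_of_forall_pos_le_add fun ε hε => ?_)
    (dist_nonneg' _ _ _ _))
  obtain ⟨m, hm⟩ := exists_pow_lt_of_lt_one hε (one_half_lt_one (α := ℝ))
  have := (Mod.eqSpec N).prod_dist S F h m w w'
  simp only [hw, (Mod.eqSpec N).dist_self, zero_div, Finset.sum_const_zero, sub_zero] at this
  rw [one_div_pow] at hm
  linarith [le_abs_self (P.eq.dist N.str w w')]

theorem tupDist_self (N : Mod P.eq) {Γ : List P.eqSorts.Srt} (e : N.str.Tuple Γ) :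
    P.eq.tupDist N.str e e = 0 :=
  (isCompleteMetric_tupDist N.complete Γ).self e

theorem ext_of_inclFn (N : Mod P.eq) {S : P.eqSorts.Srt} (Γ : List P.eqSorts.Srt)
    (A : Formula P.eqSorts.lang Γ) (h : S.1 = Name.defset (names Γ) A.erase)
    {w w' : N.str.carrier S} (hw : inclFn N.str Γ A.erase h w = inclFn N.str Γ A.erase h w') :
    w = w' := by
  refine (N.complete S).eq_of_eq_zero ?_
  refine ((Mod.eqSpec N).defset_dist S Γ A h w w').trans ?_
  rw [hw]
  exact tupDist_self N _

theorem _root_.ContLogic.ElemMap.map_dist {M N : Mod P.eq} (δ : ElemMap M.str N.str)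
    {S : P.eqSorts.Srt} (a b : M.str.carrier S) :
    P.eq.dist N.str (δ.toFun S a) (δ.toFun S b) = P.eq.dist M.str a b := by
  refine Eq.trans ?_ (congrArg Subtype.val (δ.map_formula (P.eq.d S)
    (Var.pair (X := M.str.carrier) a b)))
  exact congrArg (fun e => (((P.eq.d S).realize N.str e : unitInterval) : ℝ))
    (Var.map_pair (X := M.str.carrier) (Y := N.str.carrier) δ.toFun a b).symm

/-- The correspondence induced by the reduct of an elementary map is given by the map. -/
theorem Lift.eq_of_map {M N : Mod P.eq} (δ : M ⟶ N) {S : P.eqSorts.Srt} {z : M.str.carrier S}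
    {w : N.str.carrier S} (h : Lift (P.forgetEq.map δ : ElemMap _ _) S z w) :
    w = ElemMap.toFun δ S z := by
  let δ' : ElemMap M.str N.str := δ
  have single : ∀ {T : P.eqSorts.Srt} (z : M.str.carrier T),
      (fun t x => δ'.toFun t (Var.single (X := M.str.carrier) z t x)) =
        Var.single (X := N.str.carrier) (δ'.toFun T z) := fun z =>
    Var.map_single (X := M.str.carrier) (Y := N.str.carrier) δ'.toFun z
  induction h with
  | base s a => rfl
  | prod S F h z w _ ih =>
    refine ext_of_projFn N F h fun n => (ih n).trans ?_
    refine (δ'.map_fn (Γ := [S]) (s := F n) (EqFunc.proj F h n) _).trans ?_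
    exact congrArg _ (single z)
  | defset S Γ A h z w _ ih =>
    refine ext_of_inclFn N Γ A h ?_
    funext s x
    refine (ih s x).trans ((δ'.map_fn (Γ := [S]) (s := s) (EqFunc.incl Γ A.erase h x) _).trans ?_)
    exact congrArg _ (single z)
  | lim S Δ f hf z w b b' _ hz hw ih =>
    refine (N.complete S).eq_of_eq_zero (le_antisymm (le_of_forall_pos_le_add fun ε hε => ?_)
      (dist_nonneg' _ _ _ _))
    have h₁ := hz _ (half_pos hε)
    have h₂ := hw _ (half_pos hε)
    have h₃ : b' _ (half_pos hε) = fun t x => δ'.toFun t (b _ (half_pos hε) t x) := by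
      funext t x
      exact ih _ _ t x
    rw [h₃, ← δ'.map_fn (Γ := Δ) (s := S) f] at h₂
    rw [← δ'.map_dist] at h₁
    have h₄ := (Mod.eqSpec N).dist_triangle S w (δ'.toFun S (M.str.fn (Γ := Δ) (s := S) f
      (b _ (half_pos hε)))) (δ'.toFun S z)
    have h₅ := (Mod.eqSpec N).dist_comm S w (δ'.toFun S (M.str.fn (Γ := Δ) (s := S) f
      (b _ (half_pos hε))))
    change P.eq.dist N.str w (δ'.toFun S z) ≤ 0 + ε
    change P.eq.dist N.str w (δ'.toFun S z) ≤ _ at h₄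
    rw [h₅] at h₄
    linarith

end Theory

/-! ### Preservation of formulas -/

theorem Term.sortsIn_var {L : Language.{u}} (Q : L.Sorts → Prop) {Γ : List L.Sorts} {s : L.Sorts}
    (x : Var Γ s) : (Term.var x : Term L Γ s).SortsIn Q := True.intro

theorem Term.SortsIn.subst {L : Language.{u}} {Q : L.Sorts → Prop} {Γ Δ : List L.Sorts}
    {σ : ∀ s, Var Γ s → Term L Δ s} (hσ : ∀ s x, (σ s x).SortsIn Q) {s : L.Sorts} {t : Term L Γ s}
    (ht : t.SortsIn Q) : (t.subst σ).SortsIn Q := by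
  induction t with
  | var x => exact hσ _ x
  | app f ts ih => exact ⟨ht.1, fun t x => ih t x (ht.2 t x)⟩

theorem Formula.SortsIn.subst {L : Language.{u}} {Q : L.Sorts → Prop} {Γ Δ : List L.Sorts}
    {σ : ∀ s, Var Γ s → Term L Δ s} (hσ : ∀ s x, (σ s x).SortsIn Q) {φ : Formula L Γ}
    (hφ : φ.SortsIn Q) : (φ.subst σ).SortsIn Q := by
  have key : ∀ {Γ Δ : List L.Sorts} {σ : ∀ s, Var Γ s → Term L Δ s}, (∀ s x, (σ s x).SortsIn Q) →
      ∀ (b s : L.Sorts) (x : Var (b :: Γ) s), (Var.cons (X := Term L (b :: Δ)) (.var .zero)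
        (fun _ x => (σ _ x).weaken) s x).SortsIn Q := by
    intro Γ Δ σ hσ b s x
    cases x with
    | zero => trivial
    | succ x => exact Term.SortsIn.subst (fun _ _ => Term.sortsIn_var Q _) (hσ _ x)
  induction φ generalizing Δ with
  | rel R ts => exact ⟨hφ.1, fun s x => (hφ.2 s x).subst hσ⟩
  | conn n c φ ih => exact fun i => ih i hσ (hφ i)
  | all s φ ih => exact ⟨hφ.1, ih (key hσ s) hφ.2⟩
  | ex s φ ih => exact ⟨hφ.1, ih (key hσ s) hφ.2⟩

theorem Term.sortsIn_of_forall {L : Language.{u}} {Q : L.Sorts → Prop} (hQ : ∀ s, Q s)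
    {Γ : List L.Sorts} {s : L.Sorts} (t : Term L Γ s) : t.SortsIn Q := by
  induction t with
  | var x => trivial
  | app f ts ih => exact ⟨hQ _, ih⟩

namespace Formula

theorem sortsIn_of_forall {L : Language.{u}} {Q : L.Sorts → Prop} (hQ : ∀ s, Q s)
    {Γ : List L.Sorts} (φ : Formula L Γ) : φ.SortsIn Q := by
  induction φ with
  | rel R ts => exact ⟨fun s _ => hQ s, fun s x => Term.sortsIn_of_forall hQ _⟩
  | conn n c φ ih => exact ih
  | all s φ ih => exact ⟨hQ s, ih⟩
  | ex s φ ih => exact ⟨hQ s, ih⟩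

variable {L : Language.{u}} {Q : L.Sorts → Prop} {Γ Δ : List L.Sorts}

theorem SortsIn.allBlock (hΓ : ∀ s, Var Γ s → Q s) {φ : Formula L (Γ ++ Δ)} (hφ : φ.SortsIn Q) :
    (Formula.allBlock Γ φ).SortsIn Q := by
  induction Γ with
  | nil => exact hφ
  | cons s Γ ih => exact ih (fun s x => hΓ s x.succ) ⟨hΓ s .zero, hφ⟩

theorem SortsIn.exBlock (hΓ : ∀ s, Var Γ s → Q s) {φ : Formula L (Γ ++ Δ)} (hφ : φ.SortsIn Q) :
    (Formula.exBlock Γ φ).SortsIn Q := by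
  induction Γ with
  | nil => exact hφ
  | cons s Γ ih => exact ih (fun s x => hΓ s x.succ) ⟨hΓ s .zero, hφ⟩

theorem SortsIn.conn₂ {φ ψ : Formula L Γ} (hφ : φ.SortsIn Q) (hψ : ψ.SortsIn Q)
    (c : C(Fin 2 → unitInterval, unitInterval)) : (Formula.conn 2 c ![φ, ψ]).SortsIn Q :=
  Fin.forall_fin_two.2 ⟨hφ, hψ⟩

theorem SortsIn.distTerm {d : ∀ s, Formula L [s, s]} {s : L.Sorts} (hd : (d s).SortsIn Q)
    {t t' : Term L Γ s} (ht : t.SortsIn Q) (ht' : t'.SortsIn Q) :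
    (Formula.distTerm d t t').SortsIn Q := by
  refine hd.subst fun s x => ?_
  cases x with
  | zero => exact ht
  | succ x =>
    cases x with
    | zero => exact ht'
    | succ x => cases x

end Formula

namespace Theory

open NameSet Formula

variable {P : Theory.{u}}

theorem sortsIn_eqDist {V : NameSet P.L} {Q : V.Srt → Prop} (hQ : ∀ s, Q (V.base s)) {S : V.Srt}
    (hS : Q S) : (P.eqDist V S).SortsIn Q := by
  have hnew : S.1.IsNew → (P.eqDist V S).SortsIn Q := by
    intro h
    rw [P.eqDist_of_isNew S h]
    refine ⟨fun s x => ?_, fun _ _ => trivial⟩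
    cases x with
    | zero => exact hS
    | succ x =>
      cases x with
      | zero => exact hS
      | succ x => cases x
  rcases S with ⟨S, h⟩
  cases S with
  | base s => exact sortsIn_map V.baseHom hQ _
  | prod F => exact hnew trivial
  | defset Γ A => exact hnew trivial
  | canon Γ Δ φ => exact hnew trivial
  | union Γ n Δ φ => exact hnew trivial

theorem sortsIn_paramFormula {V : NameSet P.L} {Q : V.Srt → Prop} (hQ : ∀ s, Q (V.base s))
    {Θ Γ Δ : List V.Srt} {φ : Formula V.lang (Γ ++ Δ)} {C : V.Srt}
    (hC : C.1 = Name.canon (names Γ) (names Δ) φ.erase) {z : Term V.lang Θ C}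
    (hΔ : ∀ s, Var Δ s → Q s) (hφ : φ.SortsIn Q) (hCQ : Q C) (hz : z.SortsIn Q) :
    (paramFormula P Γ Δ φ hC z).SortsIn Q := by
  have hq : ∀ {Ξ : List V.Srt} {t : ∀ s, Var Δ s → Term V.lang Ξ s},
      (∀ s x, (t s x).SortsIn Q) → (quotTerm Γ Δ φ hC t).SortsIn Q := fun h => ⟨hCQ, h⟩
  refine SortsIn.exBlock hΔ (SortsIn.conn₂ (SortsIn.subst (fun s x => ?_) hφ)
    (SortsIn.distTerm (sortsIn_eqDist hQ hCQ) (hq fun _ _ => Term.sortsIn_var (L := V.lang) Q _)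
      (Term.SortsIn.subst (L := V.lang) (fun _ _ => Term.sortsIn_var (L := V.lang) Q _) hz)) _)
  refine Var.append_cases Γ (p := fun x => (Var.append (X := Term V.lang (Δ ++ (Γ ++ Θ)))
      (fun _ (x : Var Γ _) => .var ((x.inl).inr Δ))
      (fun _ (y : Var Δ _) => .var y.inl) s x).SortsIn Q)
    (fun v => ?_) (fun v => ?_) x
  · rw [Var.append_inl]
    exact Term.sortsIn_var (L := V.lang) Q _
  · rw [Var.append_inr]
    exact Term.sortsIn_var (L := V.lang) Q _

/-- The correspondence of elements of the sort `S` that is induced by a map of the reducts is the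
graph of an isometric map, compatibly with composition. -/
structure Transfers (P : Theory.{u}) (S : P.eqSorts.Srt) : Prop where
  exists_lift {M N : Mod P.eq} (g : ReductMap M N) (z : M.str.carrier S) : ∃ w, Lift g S z w
  dist_eq {M N : Mod P.eq} {g : ReductMap M N} {z z' : M.str.carrier S} {w w' : N.str.carrier S} :
    Lift g S z w → Lift g S z' w' → P.eq.dist M.str z z' = P.eq.dist N.str w w'
  comp {M N K : Mod P.eq} {g : ReductMap M N} {g' : ReductMap N K} {k : ReductMap M K}
    {z : M.str.carrier S} {w : N.str.carrier S} {v : K.str.carrier S} :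
    (∀ s a, k.toFun s a = g'.toFun s (g.toFun s a)) → Lift g S z w → Lift g' S w v → Lift k S z v

theorem Transfers.unique {S : P.eqSorts.Srt} (hS : P.Transfers S) {M N : Mod P.eq}
    {g : ReductMap M N} {z : M.str.carrier S} {w w' : N.str.carrier S} (h : Lift g S z w)
    (h' : Lift g S z w') : w = w' :=
  (N.complete S).eq_of_eq_zero ((hS.dist_eq h h').symm.trans ((Mod.eqSpec M).dist_self S z))

section

variable {M N : Mod P.eq} {g : ReductMap M N}

theorem exists_liftTuple {Γ : List P.eqSorts.Srt} (hΓ : ∀ s, Var Γ s → P.Transfers s)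
    (g : ReductMap M N) (e : M.str.Tuple Γ) : ∃ e' : N.str.Tuple Γ, LiftTuple g e e' := by
  choose e' he' using fun s x => (hΓ s x).exists_lift g (e s x)
  exact ⟨e', he'⟩

theorem LiftTuple.rel {Δ : List P.eqSorts.Srt} (hΔ : ∀ s, Var Δ s → P.Transfers s)
    {e : M.str.Tuple Δ} {e' : N.str.Tuple Δ} (h : LiftTuple g e e') (R : P.eqSorts.EqRel Δ) :
    M.str.rel (Γ := Δ) R e = N.str.rel (Γ := Δ) R e' := by
  cases R with
  | @base Γ R Δ hb =>
    obtain rfl : Δ = Γ.map P.eqSorts.base :=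
      names_injective (hb.trans (P.eqSorts.names_map_base Γ).symm)
    obtain ⟨e, rfl⟩ := Var.mapElim_surjective P.eqSorts.base (X := M.str.carrier) Γ e
    obtain ⟨e', rfl⟩ := Var.mapElim_surjective P.eqSorts.base (X := N.str.carrier) Γ e'
    have he : e' = fun t x => g.toFun t (e t x) := by
      funext t x
      have := h _ (x.map P.eqSorts.base)
      rw [Var.mapElim_map, Var.mapElim_map] at this
      exact this.base_inv
    subst he
    exact (g.map_formula (.rel R fun _ x => .var x) e).symm
  | dist S hS =>
    exact Subtype.ext ((coe_rel_dist M.str S hS e).trans (((hΔ S .zero).dist_eq (h S .zero)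
      (h S (.succ .zero))).trans (coe_rel_dist N.str S hS e').symm))

end

variable (hP : P.IsMetric)

include hP in
/-- Corresponding tuples `e` of `M` and `e'` of `N`, and an element `b` of `N`, are moved to an
amalgam `M'` of `M` and `N`: there `e'` corresponds to the image of `e` under an elementary map
`δ : M → M'`, and `b` to some element `c`. So a value that is attained over `e'` in `N` is attained
over `δ(e)` in `M'`. -/
theorem exists_liftTuple_elementary {Γ : List P.eqSorts.Srt} (hΓ : ∀ s, Var Γ s → P.Transfers s)
    {M N : Mod P.eq} {g : ReductMap M N} {e : M.str.Tuple Γ} {e' : N.str.Tuple Γ}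
    (h : LiftTuple g e e') {S : P.eqSorts.Srt} (hS : P.Transfers S) (b : N.str.carrier S) :
    ∃ (M' : Mod P.eq) (δ : ElemMap M.str M'.str) (k : ReductMap N M') (c : M'.str.carrier S),
      Lift k S b c ∧ LiftTuple k e' fun s x => δ.toFun s (e s x) := by
  obtain ⟨M', δ, k, hk⟩ := exists_amalgam hP (M := M) (N := N) g
  have hk' : ∀ s a, (P.forgetEq.map δ : ReductMap M M').toFun s a =
      ElemMap.toFun k s (g.toFun s a) := fun s a =>
    (congrArg (fun f : ReductMap M M' => f.toFun s a) hk).symm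
  obtain ⟨c, hc⟩ := hS.exists_lift (k : ReductMap N M') b
  obtain ⟨e'', he''⟩ := exists_liftTuple hΓ (k : ReductMap N M') e'
  refine ⟨M', δ, k, c, hc, fun s x => ?_⟩
  have hx := he'' s x
  rw [Lift.eq_of_map δ ((hΓ s x).comp hk' (h s x) hx)] at hx
  exact hx

include hP in
/-- Formulas have the same value at corresponding tuples. For a quantifier, elements of `M` are
moved to `N` along the correspondence; elements of `N` are moved to an elementary extension of `M`.
-/
theorem LiftTuple.realize {Γ : List P.eqSorts.lang.Sorts} (φ : Formula P.eqSorts.lang Γ)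
    (hΓ : ∀ s, Var Γ s → P.Transfers s) (hφ : φ.SortsIn P.Transfers) {M N : Mod P.eq}
    {g : ReductMap M N} {e : M.str.Tuple Γ} {e' : N.str.Tuple Γ} (h : LiftTuple g e e') :
    φ.realize M.str e = φ.realize N.str e' := by
  have hcons : ∀ {Γ : List P.eqSorts.lang.Sorts} {S : P.eqSorts.lang.Sorts}, P.Transfers S →
      (∀ s, Var Γ s → P.Transfers s) → ∀ s, Var (S :: Γ) s → P.Transfers s := by
    intro Γ S hS hΓ s x
    cases x with
    | zero => exact hS
    | succ x => exact hΓ s x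
  induction φ generalizing M N with
  | rel R ts => exact LiftTuple.rel hφ.1 (fun s x => LiftTuple.term h (ts s x)) R
  | conn n c φ ih => exact congrArg c (funext fun i => ih i hΓ (hφ i) h)
  | all S φ ih =>
    refine le_antisymm (iSup_le fun a => ?_) (iSup_le fun b => ?_)
    · obtain ⟨b, hb⟩ := hφ.1.exists_lift g a
      exact (ih (hcons hφ.1 hΓ) hφ.2 (LiftTuple.cons hb h)).trans_le
        (le_iSup (fun b => φ.realize N.str (Var.cons (X := N.str.carrier) b e')) b)
    · obtain ⟨M', δ, k, c, hc, he⟩ := exists_liftTuple_elementary hP hΓ h hφ.1 b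
      refine (ih (hcons hφ.1 hΓ) hφ.2 (LiftTuple.cons hc he)).trans_le ?_
      exact (le_iSup (fun c => φ.realize M'.str (Var.cons (X := M'.str.carrier) c _)) c).trans_eq
        (δ.map_formula (.all S φ) e)
  | ex S φ ih =>
    refine le_antisymm (le_iInf fun b => ?_) (le_iInf fun a => ?_)
    · obtain ⟨M', δ, k, c, hc, he⟩ := exists_liftTuple_elementary hP hΓ h hφ.1 b
      refine Eq.trans_ge (ih (hcons hφ.1 hΓ) hφ.2 (LiftTuple.cons hc he)) ?_
      exact (δ.map_formula (.ex S φ) e).symm.trans_le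
        (iInf_le (fun c => φ.realize M'.str (Var.cons (X := M'.str.carrier) c _)) c)
    · obtain ⟨b, hb⟩ := hφ.1.exists_lift g a
      exact (iInf_le (fun b => φ.realize N.str (Var.cons (X := N.str.carrier) b e')) b).trans_eq
        (ih (hcons hφ.1 hΓ) hφ.2 (LiftTuple.cons hb h)).symm

end Theory

/-! ### Sorts that transfer -/

theorem IsCompleteMetric.exists_lim_of_le_pow {X : Type u} {d : X → X → ℝ} (h : IsCompleteMetric d)
    (x : ℕ → X) (hx : ∀ k m n, k ≤ m → k ≤ n → d (x m) (x n) ≤ (1 / 2) ^ k) :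
    ∃ a, ∀ ε : ℝ, 0 < ε → ∃ N, ∀ n ≥ N, d (x n) a ≤ ε ∧ (1 / 2) ^ n ≤ ε := by
  have hpow : ∀ ε : ℝ, 0 < ε → ∃ N : ℕ, ∀ n ≥ N, ((1 : ℝ) / 2) ^ n ≤ ε := fun ε hε => by
    obtain ⟨N, hN⟩ := exists_pow_lt_of_lt_one hε (one_half_lt_one (α := ℝ))
    exact ⟨N, fun n hn =>
      (pow_le_pow_of_le_one (by norm_num) (by norm_num) hn).trans hN.le⟩
  obtain ⟨a, ha⟩ := h.exists_lim x fun ε hε => by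
    obtain ⟨N, hN⟩ := hpow ε hε
    exact ⟨N, fun m hm n hn => (hx N m n hm hn).trans (hN N le_rfl)⟩
  refine ⟨a, fun ε hε => ?_⟩
  obtain ⟨N, hN⟩ := ha ε hε
  obtain ⟨N', hN'⟩ := hpow ε hε
  exact ⟨max N N', fun n hn =>
    ⟨hN n ((le_max_left _ _).trans hn), hN' n ((le_max_right _ _).trans hn)⟩⟩

namespace Theory

open NameSet Formula

variable {P : Theory.{u}}

theorem EqSpec.abs_dist_sub_dist_le {V : NameSet P.L} {X : Struc V.lang} (hX : P.EqSpec X)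
    {S : V.Srt} (a a' b b' : X.carrier S) :
    |(P.expansion V).dist X a b - (P.expansion V).dist X a' b'| ≤
      (P.expansion V).dist X a a' + (P.expansion V).dist X b b' := by
  have h₁ := hX.dist_triangle S a a' b
  have h₂ := hX.dist_triangle S a' b' b
  have h₃ := hX.dist_triangle S a' a b'
  have h₄ := hX.dist_triangle S a b b'
  have h₅ := hX.dist_comm S b b'
  have h₆ := hX.dist_comm S a a'
  rw [abs_le]
  constructor <;> linarith

/-- A sort which is the closure of the ranges of dense function symbols transfers, if the distances
between values of these symbols are preserved. -/
theorem transfers_of_dense {S : P.eqSorts.Srt} (hS : S.1.IsClosure)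
    (hctx : ∀ (Δ : List P.eqSorts.Srt) (f : P.eqSorts.EqFunc Δ S), f.IsDense →
      ∀ s, Var Δ s → P.Transfers s)
    (hdense : ∀ (M : Mod P.eq) (z : M.str.carrier S), ∃ (Δ : List P.eqSorts.Srt)
      (f : P.eqSorts.EqFunc Δ S), f.IsDense ∧ ∀ ε : ℝ, 0 < ε → ∃ b : M.str.Tuple Δ,
        P.eq.dist M.str (M.str.fn (Γ := Δ) (s := S) f b) z ≤ ε)
    (hdist : ∀ (Δ : List P.eqSorts.Srt) (f : P.eqSorts.EqFunc Δ S), f.IsDense →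
      ∀ (Δ' : List P.eqSorts.Srt) (f' : P.eqSorts.EqFunc Δ' S), f'.IsDense →
      ∀ (M N : Mod P.eq) (g : ReductMap M N) (b : M.str.Tuple Δ) (b' : N.str.Tuple Δ)
        (c : M.str.Tuple Δ') (c' : N.str.Tuple Δ'), LiftTuple g b b' → LiftTuple g c c' →
        P.eq.dist M.str (M.str.fn (Γ := Δ) (s := S) f b) (M.str.fn (Γ := Δ') (s := S) f' c) =
          P.eq.dist N.str (N.str.fn (Γ := Δ) (s := S) f b') (N.str.fn (Γ := Δ') (s := S) f' c')) :
    P.Transfers S := by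
  have dist_eq : ∀ {M N : Mod P.eq} {g : ReductMap M N} {z z' : M.str.carrier S}
      {w w' : N.str.carrier S}, Lift g S z w → Lift g S z' w' →
        P.eq.dist M.str z z' = P.eq.dist N.str w w' := by
    intro M N g z z' w w' h h'
    obtain ⟨Δ, f, hf, hb⟩ := h.lim_inv hS
    obtain ⟨Δ', f', hf', hc⟩ := h'.lim_inv hS
    refine eq_of_abs_sub_le_all fun ε hε => ?_
    obtain ⟨b, b', hb, hz, hw⟩ := hb (ε / 4) (by positivity)
    obtain ⟨c, c', hc, hz', hw'⟩ := hc (ε / 4) (by positivity)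
    have h₁ := (Mod.eqSpec M).abs_dist_sub_dist_le (M.str.fn (Γ := Δ) (s := S) f b) z
      (M.str.fn (Γ := Δ') (s := S) f' c) z'
    have h₂ := (Mod.eqSpec N).abs_dist_sub_dist_le (N.str.fn (Γ := Δ) (s := S) f b') w
      (N.str.fn (Γ := Δ') (s := S) f' c') w'
    have h₃ := hdist Δ f hf Δ' f' hf' M N g b b' c c' hb hc
    rw [abs_le] at h₁ h₂ ⊢
    constructor <;> linarith
  refine ⟨fun {M N} g z => ?_, dist_eq, fun {M N K g g' k z w v} hk h h' => ?_⟩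
  · obtain ⟨Δ, f, hf, hb⟩ := hdense M z
    choose b hb using fun n : ℕ => hb ((1 / 2) ^ (n + 1)) (by positivity)
    choose b' hb' using fun n => exists_liftTuple (hctx Δ f hf) g (b n)
    obtain ⟨w, hw⟩ := (N.complete S).exists_lim_of_le_pow
      (fun n => N.str.fn (Γ := Δ) (s := S) f (b' n)) fun k m n hm hn => by
        refine (hdist Δ f hf Δ f hf M N g _ _ _ _ (hb' m) (hb' n)).symm.trans_le ?_
        have h₁ := (Mod.eqSpec M).dist_triangle S (M.str.fn (Γ := Δ) (s := S) f (b m)) z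
          (M.str.fn (Γ := Δ) (s := S) f (b n))
        have h₂ := (Mod.eqSpec M).dist_comm S z (M.str.fn (Γ := Δ) (s := S) f (b n))
        have h₃ := hb m
        have h₄ := hb n
        have h₅ := pow_le_pow_of_le_one (a := (1 / 2 : ℝ)) (by norm_num) (by norm_num) hm
        have h₆ := pow_le_pow_of_le_one (a := (1 / 2 : ℝ)) (by norm_num) (by norm_num) hn
        rw [pow_succ] at h₃ h₄
        linarith
    refine ⟨w, .of_forall_exists f hf fun ε hε => ?_⟩
    obtain ⟨n, hn⟩ := hw ε hε
    refine ⟨b n, b' n, hb' n, (hb n).trans ?_, (hn n le_rfl).1⟩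
    exact (pow_le_pow_of_le_one (by norm_num) (by norm_num) n.le_succ).trans (hn n le_rfl).2
  · obtain ⟨Δ, f, hf, hb⟩ := h.lim_inv hS
    refine .of_forall_exists f hf fun ε hε => ?_
    obtain ⟨b, b', hb, hz, hw⟩ := hb ε hε
    obtain ⟨b'', hb''⟩ := exists_liftTuple (hctx Δ f hf) g' b'
    refine ⟨b, b'', fun s x => (hctx Δ f hf s x).comp hk (hb s x) (hb'' s x), hz, ?_⟩
    exact (dist_eq (LiftTuple.fn hb'' f) h').symm.trans_le hw

theorem transfers_base (s : P.L.Sorts) : P.Transfers (P.eqSorts.base s) where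
  exists_lift g z := ⟨_, .base s z⟩
  dist_eq {M N g z z' w w'} h h' := by
    obtain rfl := h.base_inv
    obtain rfl := h'.base_inv
    refine (P.dist_reduct P.eqSorts M.str s z z').symm.trans
      (Eq.trans ?_ (P.dist_reduct P.eqSorts N.str s _ _))
    refine (congrArg Subtype.val (g.map_formula (P.d s)
      (Var.pair (X := (M.str.reduct P.eqSorts.baseHom).carrier) z z'))).symm.trans ?_
    exact congrArg
      (fun e => (((P.d s).realize (N.str.reduct P.eqSorts.baseHom) e : unitInterval) : ℝ))
      (Var.map_pair (X := (M.str.reduct P.eqSorts.baseHom).carrier)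
        (Y := (N.str.reduct P.eqSorts.baseHom).carrier) g.toFun z z')
  comp {M N K g g' k z w v} hk h h' := by
    obtain rfl := h.base_inv
    obtain rfl := h'.base_inv
    exact Eq.mp (congrArg (fun v => Lift k (P.eqSorts.base s) z v) (hk s z)) (.base s z)

/-- In a model of the expansion, every sequence of elements is given by an element of the product:
the axioms provide approximations, and the sort of the product is complete. -/
theorem exists_projFn_eq (N : Mod P.eq) {S : P.eqSorts.Srt} (F : ℕ → P.eqSorts.Srt)
    (h : S.1 = Name.prod fun n => (F n).1) (w : ∀ n, N.str.carrier (F n)) :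
    ∃ y : N.str.carrier S, ∀ n, projFn N.str F h n y = w n := by
  have hN := Mod.eqSpec N
  have near : ∀ (n : ℕ) (ε : ℝ), 0 < ε → ∃ y : N.str.carrier S, ∀ i < n,
      P.eq.dist N.str (projFn N.str F h i y) (w i) ≤ ε := by
    intro n ε hε
    obtain ⟨y, hy⟩ := hN.prod_dense S F h n
      (Var.mapElim F (X := N.str.carrier) (List.range n) fun i _ => w i) ε hε
    refine ⟨y, fun i hi => ?_⟩
    obtain ⟨x⟩ := Var.nonempty_of_mem (List.mem_range.2 hi)
    have := hy i x
    rw [Var.mapElim_map F (X := N.str.carrier)] at this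
    exact this
  choose y hy using fun n : ℕ => near (n + 2) ((1 / 2) ^ (n + 2)) (by positivity)
  obtain ⟨z, hz⟩ := (N.complete S).exists_lim_of_le_pow y fun k m n hm hn => by
    have hd := (abs_le.1 (hN.prod_dist S F h (k + 2) (y m) (y n))).2
    have hpow : ∀ {j}, k ≤ j → ((1 : ℝ) / 2) ^ (j + 2) ≤ (1 / 2) ^ (k + 2) := fun hj =>
      pow_le_pow_of_le_one (by norm_num) (by norm_num) (Nat.add_le_add_right hj 2)
    have hs : ∑ i : Fin (k + 2), P.eq.dist N.str (projFn N.str F h i (y m))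
        (projFn N.str F h i (y n)) / 2 ^ ((i : ℕ) + 1) ≤ 2 * (1 / 2) ^ (k + 2) := by
      have hi : ∀ i : Fin (k + 2), P.eq.dist N.str (projFn N.str F h i (y m))
          (projFn N.str F h i (y n)) ≤ 2 * (1 / 2) ^ (k + 2) := fun i => by
        have h₁ := hN.dist_triangle _ (projFn N.str F h i (y m)) (w i) (projFn N.str F h i (y n))
        have h₂ := (hy m i (by omega)).trans (hpow hm)
        have h₃ := (hy n i (by omega)).trans (hpow hn)
        have h₄ := hN.dist_comm _ (w i) (projFn N.str F h i (y n))
        linarith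
      have h1 := mul_le_mul_of_nonneg_left (sum_div_two_pow_le_one (n := k + 2)
        (a := fun _ => 1) fun _ => le_rfl) (show (0 : ℝ) ≤ 2 * (1 / 2) ^ (k + 2) by positivity)
      rw [Finset.mul_sum, mul_one] at h1
      refine (Finset.sum_le_sum fun i _ => ?_).trans h1
      rw [mul_one_div]
      exact div_le_div_of_nonneg_right (hi i) (by positivity)
    rw [← one_div_pow] at hd
    rw [pow_add] at hd hs
    have : (0 : ℝ) < (1 / 2) ^ k := by positivity
    change P.eq.dist N.str (y m) (y n) - _ ≤ _ at hd
    linarith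
  refine ⟨z, fun i => (N.complete (F i)).eq_of_eq_zero
    (le_antisymm (le_of_forall_pos_le_add fun ε hε => ?_) (dist_nonneg' _ _ _ _))⟩
  obtain ⟨K, hK⟩ := hz (ε / 2 / 2 ^ (i + 1)) (by positivity)
  obtain ⟨K', hK'⟩ := hz (ε / 2) (by positivity)
  have h₁ := (hK (max (max K K') i) ((le_max_left _ _).trans (le_max_left _ _))).1
  have h₂ := (hK' (max (max K K') i) ((le_max_right _ _).trans (le_max_left _ _))).2
  have h₃ := hy (max (max K K') i) i (Nat.lt_add_right 1 (Nat.lt_succ_of_le (le_max_right _ _)))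
  set m := max (max K K') i
  have h₄ := hN.dist_projFn_le F h (y m) z i
  have h₅ := hN.dist_triangle _ (projFn N.str F h i z) (projFn N.str F h i (y m)) (w i)
  have h₆ := hN.dist_comm _ (projFn N.str F h i z) (projFn N.str F h i (y m))
  have h₇ := (le_div_iff₀ (by positivity)).1 h₁
  have h₈ : ((1 : ℝ) / 2) ^ (m + 2) ≤ (1 / 2) ^ m :=
    pow_le_pow_of_le_one (by norm_num) (by norm_num) (Nat.le_add_right m 2)
  linarith

theorem transfers_prod {S : P.eqSorts.Srt} (F : ℕ → P.eqSorts.Srt)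
    (h : S.1 = Name.prod fun n => (F n).1) (hF : ∀ n, P.Transfers (F n)) : P.Transfers S where
  exists_lift {M N} g z := by
    choose w hw using fun n => (hF n).exists_lift g (projFn M.str F h n z)
    obtain ⟨y, hy⟩ := exists_projFn_eq N F h w
    exact ⟨y, .prod S F h z y fun n => (hy n).symm ▸ hw n⟩
  dist_eq {M N g z z' w w'} hz hz' := by
    refine eq_of_abs_sub_le_all fun ε hε => ?_
    obtain ⟨m, hm⟩ := exists_pow_lt_of_lt_one (half_pos hε) (one_half_lt_one (α := ℝ))
    have h₁ := (Mod.eqSpec M).prod_dist S F h m z z'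
    have h₂ := (Mod.eqSpec N).prod_dist S F h m w w'
    have hs : ∀ i : Fin m, P.eq.dist M.str (projFn M.str F h i z) (projFn M.str F h i z') =
        P.eq.dist N.str (projFn N.str F h i w) (projFn N.str F h i w') := fun i =>
      (hF i).dist_eq (hz.proj F h i) (hz'.proj F h i)
    simp only [hs] at h₁
    rw [← one_div_pow] at h₁ h₂
    rw [abs_le] at h₁ h₂ ⊢
    constructor <;> linarith
  comp {M N K g g' k z w v} hk hz hw :=
    .prod S F h z v fun n => (hF n).comp hk (hz.proj F h n) (hw.proj F h n)

/-- In a model of the expansion, every zero of `A` is given by an element of the sort of the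
definable set `A`. -/
theorem exists_inclFn_eq (N : Mod P.eq) {S : P.eqSorts.Srt} (Γ : List P.eqSorts.Srt)
    (A : Formula P.eqSorts.lang Γ) (h : S.1 = Name.defset (names Γ) A.erase) (e : N.str.Tuple Γ)
    (he : A.realize N.str e = 0) : ∃ w : N.str.carrier S, inclFn N.str Γ A.erase h w = e := by
  have hN := Mod.eqSpec N
  have hc := isCompleteMetric_tupDist N.complete Γ
  have hglb := hN.defset_image S Γ A h e
  rw [(realize_eq_zero_iff _ _ _).1 he] at hglb
  have near : ∀ ε : ℝ, 0 < ε → ∃ y : N.str.carrier S,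
      P.eq.tupDist N.str e (inclFn N.str Γ A.erase h y) ≤ ε := fun ε hε => by
    obtain ⟨_, ⟨y, rfl⟩, hy⟩ := (isGLB_lt_iff hglb).1 hε
    exact ⟨y, hy.le⟩
  choose y hy using fun n : ℕ => near ((1 / 2) ^ (n + 1)) (by positivity)
  obtain ⟨w, hw⟩ := (N.complete S).exists_lim_of_le_pow y fun k m n hm hn => by
    refine (hN.defset_dist S Γ A h (y m) (y n)).trans_le ?_
    have h₁ := hc.triangle (inclFn N.str Γ A.erase h (y m)) e (inclFn N.str Γ A.erase h (y n))
    have h₂ := hc.comm (inclFn N.str Γ A.erase h (y m)) e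
    have h₃ := hy m
    have h₄ := hy n
    have h₅ := pow_le_pow_of_le_one (a := (1 / 2 : ℝ)) (by norm_num) (by norm_num) hm
    have h₆ := pow_le_pow_of_le_one (a := (1 / 2 : ℝ)) (by norm_num) (by norm_num) hn
    rw [pow_succ] at h₃ h₄
    linarith
  refine ⟨w, hc.eq_of_eq_zero (le_antisymm (le_of_forall_pos_le_add fun ε hε => ?_)
    (tupDist_nonneg _ _ _))⟩
  obtain ⟨n, hn⟩ := hw (ε / 2) (half_pos hε)
  have h₁ := hn n le_rfl
  have h₂ := hN.defset_dist S Γ A h (y n) w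
  have h₃ := hc.triangle (inclFn N.str Γ A.erase h w) (inclFn N.str Γ A.erase h (y n)) e
  have h₄ := hc.comm (inclFn N.str Γ A.erase h w) (inclFn N.str Γ A.erase h (y n))
  have h₅ := hc.comm (inclFn N.str Γ A.erase h (y n)) e
  have h₆ := hy n
  have h₇ : ((1 : ℝ) / 2) ^ (n + 1) ≤ (1 / 2) ^ n :=
    pow_le_pow_of_le_one (by norm_num) (by norm_num) n.le_succ
  change P.eq.tupDist N.str _ _ ≤ _ at h₃
  change P.eq.dist N.str _ _ ≤ _ ∧ _ at h₁
  change P.eq.dist N.str _ _ = P.eq.tupDist N.str _ _ at h₂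
  linarith

theorem transfers_defset (hP : P.IsMetric) {S : P.eqSorts.Srt} {Γ : List P.eqSorts.Srt}
    (A : Formula P.eqSorts.lang Γ) (h : S.1 = Name.defset (names Γ) A.erase)
    (hΓ : ∀ s, Var Γ s → P.Transfers s) (hA : A.SortsIn P.Transfers) : P.Transfers S where
  exists_lift {M N} g z := by
    obtain ⟨e', he⟩ := exists_liftTuple hΓ g (inclFn M.str Γ A.erase h z)
    have hz : A.realize M.str (inclFn M.str Γ A.erase h z) = 0 := by
      refine (realize_eq_zero_iff _ _ _).2 (le_antisymm ?_ (realize_nonneg _ _ _))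
      refine (((Mod.eqSpec M).defset_image S Γ A h _).1 ⟨z, rfl⟩).trans_eq ?_
      exact tupDist_self M _
    obtain ⟨w, rfl⟩ := exists_inclFn_eq N Γ A h e' ((LiftTuple.realize hP A hΓ hA he).symm.trans hz)
    exact ⟨w, .defset S Γ A h z w he⟩
  dist_eq {M N g z z' w w'} hz hz' := by
    refine ((Mod.eqSpec M).defset_dist S Γ A h z z').trans
      (Eq.trans ?_ ((Mod.eqSpec N).defset_dist S Γ A h w w').symm)
    exact Var.maxDist_congr _ _ _ _ _ _ fun s x => (hΓ s x).dist_eq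
      (hz.incl Γ A.erase h s x) (hz'.incl Γ A.erase h s x)
  comp {M N K g g' k z w v} hk hz hw :=
    .defset S Γ A h z v fun s x =>
      (hΓ s x).comp hk (hz.incl Γ A.erase h s x) (hw.incl Γ A.erase h s x)

end Theory

/-! ### Fullness and faithfulness -/

namespace Theory

open NameSet Formula

variable {P : Theory.{u}}

/-- The only dense function symbol of a sort of canonical parameters is the quotient map. -/
theorem forall_isDense_canon {C : P.eqSorts.Srt} {Γ Δ : List P.eqSorts.Srt} {φ : FormulaName P.L}
    (h : C.1 = Name.canon (names Γ) (names Δ) φ)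
    {p : ∀ Δ' : List P.eqSorts.Srt, P.eqSorts.EqFunc Δ' C → Prop} (hp : p Δ (.quot Γ Δ φ h))
    (Δ' : List P.eqSorts.Srt) (f : P.eqSorts.EqFunc Δ' C) (hf : f.IsDense) : p Δ' f := by
  cases f with
  | quot Γ' Δ' φ' h' =>
    injection h'.symm.trans h with h₁ h₂ h₃
    obtain rfl := names_injective h₁
    obtain rfl := names_injective h₂
    subst h₃
    exact hp
  | inj Γ' n Δ' φ' h' j hC => injection h'.symm.trans h
  | base => exact hf.elim
  | proj => exact hf.elim
  | incl => exact hf.elim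

/-- The only dense function symbols of a union are the inclusions of its parts. -/
theorem forall_isDense_union {S : P.eqSorts.Srt} {Γ : List P.eqSorts.Srt} {n : ℕ}
    {Δ : Fin (n + 1) → List P.eqSorts.Srt} {φ : Fin (n + 1) → FormulaName P.L}
    (h : S.1 = Name.union (names Γ) n (fun j => names (Δ j)) φ) {C : Fin (n + 1) → P.eqSorts.Srt}
    (hC : ∀ j, (C j).1 = Name.canon (names Γ) (names (Δ j)) (φ j))
    {p : ∀ Δ' : List P.eqSorts.Srt, P.eqSorts.EqFunc Δ' S → Prop}
    (hp : ∀ j, p [C j] (.inj Γ n Δ φ h j (hC j)))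
    (Δ' : List P.eqSorts.Srt) (f : P.eqSorts.EqFunc Δ' S) (hf : f.IsDense) : p Δ' f := by
  cases f with
  | quot Γ' Δ' φ' h' => injection h'.symm.trans h
  | @inj _ C' Γ' n' Δ' φ' h' j hC' =>
    injection h'.symm.trans h with h₁ h₂ h₃ h₄
    subst h₂
    obtain rfl := names_injective h₁
    obtain rfl : Δ' = Δ := funext fun j => names_injective (congrFun (eq_of_heq h₃) j)
    obtain rfl := eq_of_heq h₄
    obtain rfl : C' = C j := Subtype.ext (hC'.trans (hC j).symm)
    exact hp j
  | base => exact hf.elim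
  | proj => exact hf.elim
  | incl => exact hf.elim

variable (hP : P.IsMetric)

include hP

theorem transfers_canon {C : P.eqSorts.Srt} {Γ Δ : List P.eqSorts.Srt}
    (φ : Formula P.eqSorts.lang (Γ ++ Δ)) (h : C.1 = Name.canon (names Γ) (names Δ) φ.erase)
    (hΓ : ∀ s, Var Γ s → P.Transfers s) (hΔ : ∀ s, Var Δ s → P.Transfers s)
    (hφ : φ.SortsIn P.Transfers) : P.Transfers C := by
  refine transfers_of_dense (by rw [h]; trivial) (forall_isDense_canon h hΔ)
    (fun M z => ⟨Δ, .quot Γ Δ φ.erase h, trivial, (Mod.eqSpec M).canon_dense C Γ Δ φ h z⟩)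
    (forall_isDense_canon h (forall_isDense_canon h ?_))
  intro M N g b b' c c' hb hc
  -- the distance of two parameters is the value of a formula to which the induction applies
  let σ (τ : ∀ s, Var Δ s → Var (Δ ++ Δ) s) : ∀ s, Var (Γ ++ Δ) s →
      Term P.eqSorts.lang (Γ ++ (Δ ++ Δ)) s :=
    Var.append (X := Term P.eqSorts.lang (Γ ++ (Δ ++ Δ)))
      (fun _ x => .var x.inl) (fun _ y => .var ((τ _ y).inr Γ))
  have hσ : ∀ τ s x, (σ τ s x).SortsIn P.Transfers := fun τ s x => by
    refine Var.append_cases Γ (p := fun x => (σ τ s x).SortsIn P.Transfers)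
      (fun v => ?_) (fun v => ?_) x
    · change Term.SortsIn _ (Var.append (X := Term P.eqSorts.lang (Γ ++ (Δ ++ Δ))) _ _ s v.inl)
      rw [Var.append_inl]
      exact Term.sortsIn_var (L := P.eqSorts.lang) _ _
    · change Term.SortsIn _ (Var.append (X := Term P.eqSorts.lang (Γ ++ (Δ ++ Δ))) _ _ s (v.inr Γ))
      rw [Var.append_inr]
      exact Term.sortsIn_var (L := P.eqSorts.lang) _ _
  let ψ : Formula P.eqSorts.lang (Δ ++ Δ) := allBlock (L := P.eqSorts.lang) Γ (absDiff
    (φ.subst (σ fun _ y => y.inl)) (φ.subst (σ fun _ y => y.inr Δ)))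
  have hψ : ψ.SortsIn P.Transfers :=
    SortsIn.allBlock hΓ (SortsIn.conn₂ (hφ.subst (hσ _)) (hφ.subst (hσ _)) _)
  have key : ∀ (X : Mod P.eq) (b c : X.str.Tuple Δ),
      P.eq.dist X.str (quotFn X.str Γ Δ φ.erase h b) (quotFn X.str Γ Δ φ.erase h c) =
        ψ.realize X.str (Var.append (X := X.str.carrier) b c) := by
    intro X b c
    have hX := (sat_close _ _).1 (X.holds _ (.canon_dist C Γ Δ φ h))
      (Var.append (X := X.str.carrier) b c)
    rw [realize_absDiff_eq_zero, realize_distTerm] at hX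
    refine Eq.trans ?_ (congrArg Subtype.val hX)
    simp only [quotTerm, Term.realize, Var.append_inl, Var.append_inr]
    rfl
  refine (key M b c).trans (Eq.trans ?_ (key N b' c').symm)
  refine congrArg Subtype.val (LiftTuple.realize hP ψ (fun s x => ?_) hψ (LiftTuple.append hb hc))
  exact Var.append_cases Δ (p := fun _ => P.Transfers s) (hΔ s) (hΔ s) x

theorem transfers_union {S : P.eqSorts.Srt} {Γ : List P.eqSorts.Srt} {n : ℕ}
    {Δ : Fin (n + 1) → List P.eqSorts.Srt} (φ : ∀ j, Formula P.eqSorts.lang (Γ ++ Δ j))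
    (h : S.1 = Name.union (names Γ) n (fun j => names (Δ j)) (fun j => (φ j).erase))
    {C : Fin (n + 1) → P.eqSorts.Srt}
    (hC : ∀ j, (C j).1 = Name.canon (names Γ) (names (Δ j)) (φ j).erase)
    (hΓ : ∀ s, Var Γ s → P.Transfers s) (hΔ : ∀ j s, Var (Δ j) s → P.Transfers s)
    (hφ : ∀ j, (φ j).SortsIn P.Transfers) (hCT : ∀ j, P.Transfers (C j)) : P.Transfers S := by
  have hctx : ∀ j s, Var [C j] s → P.Transfers s := by
    intro j s x
    cases x with
    | zero => exact hCT j
    | succ x => cases x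
  refine transfers_of_dense (by rw [h]; trivial) (forall_isDense_union h hC hctx)
    (fun M z => ?_) (forall_isDense_union h hC fun j => forall_isDense_union h hC fun k => ?_)
  · obtain ⟨j, hj⟩ := (Mod.eqSpec M).union_cover S Γ n Δ φ h C hC z
    refine ⟨[C j], .inj Γ n Δ _ h j (hC j), trivial, fun ε hε => ?_⟩
    obtain ⟨y, hy⟩ := hj ε hε
    exact ⟨Var.single (X := M.str.carrier) y, ((Mod.eqSpec M).dist_comm S _ _).trans_le hy⟩
  intro M N g b b' c c' hb hc
  rw [Var.single_eta b, Var.single_eta b', Var.single_eta c, Var.single_eta c']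
  let ψ : Formula P.eqSorts.lang [C j, C k] := allBlock (L := P.eqSorts.lang) Γ (absDiff
    (paramFormula P Γ (Δ j) (φ j) (hC j) (.var .zero))
    (paramFormula P Γ (Δ k) (φ k) (hC k) (.var (.succ .zero))))
  have hψ : ψ.SortsIn P.Transfers :=
    SortsIn.allBlock hΓ (SortsIn.conn₂
      (sortsIn_paramFormula transfers_base (hC j) (hΔ j) (hφ j) (hCT j)
        (Term.sortsIn_var (L := P.eqSorts.lang) _ _))
      (sortsIn_paramFormula transfers_base (hC k) (hΔ k) (hφ k) (hCT k)
        (Term.sortsIn_var (L := P.eqSorts.lang) _ _)) _)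
  have key : ∀ (X : Mod P.eq) (y : X.str.carrier (C j)) (z : X.str.carrier (C k)),
      P.eq.dist X.str (injFn X.str Γ n Δ (fun j => (φ j).erase) h j (hC j) y)
        (injFn X.str Γ n Δ (fun j => (φ j).erase) h k (hC k) z) =
        ψ.realize X.str (Var.pair (X := X.str.carrier) y z) := by
    intro X y z
    have hX := (sat_close _ _).1 (X.holds _ (.union_dist S Γ n Δ φ h C hC j k))
      (Var.pair (X := X.str.carrier) y z)
    rw [realize_absDiff_eq_zero, realize_distTerm, realize_app1, realize_app1] at hX
    exact congrArg Subtype.val hX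
  refine (key M _ _).trans (Eq.trans ?_ (key N _ _).symm)
  refine congrArg Subtype.val (LiftTuple.realize hP ψ (fun s x => ?_) hψ
    (LiftTuple.cons (hb _ .zero) (LiftTuple.cons (hc _ .zero) fun _ x => nomatch x)))
  cases x with
  | zero => exact hCT j
  | succ x => exact hctx k s x

/-- By induction on imaginary sorts, every sort transfers. -/
theorem transfers (S : P.eqSorts.Srt) : P.Transfers S :=
  P.eqSorts_induction (Q := P.Transfers) transfers_base (fun _ F h hF => transfers_prod F h hF)
    (fun _ _ A h _ hΓ hA => transfers_defset hP A h hΓ hA)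
    (fun _ _ _ φ h hΓ hΔ hφ => transfers_canon hP φ h hΓ hΔ hφ)
    (fun _ _ _ _ φ h _ hC hΓ hΔ hφ hCT => transfers_union hP φ h hC hΓ hΔ hφ hCT) S

theorem realize_eq_of_liftTuple {M N : Mod P.eq} {g : ReductMap M N}
    {Γ : List P.eqSorts.Srt} (φ : Formula P.eqSorts.lang Γ) {e : M.str.Tuple Γ}
    {e' : N.str.Tuple Γ} (h : LiftTuple g e e') : φ.realize M.str e = φ.realize N.str e' :=
  LiftTuple.realize hP φ (fun s _ => transfers hP s)
    (sortsIn_of_forall (Q := P.Transfers) (transfers hP) φ) h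

/-- The correspondence induced by a map of the reducts is the graph of an elementary map. -/
theorem full_forgetEq : P.forgetEq.Full where
  map_surjective {M N} g := by
    choose f hf using fun S z => (transfers hP S).exists_lift (g : ReductMap M N) z
    refine ⟨⟨f, fun {Γ s} q e => ?_, fun {Γ} φ e => ?_⟩, ?_⟩
    · exact (transfers hP s).unique (hf s _) (LiftTuple.fn (fun t x => hf t (e t x)) q)
    · exact (realize_eq_of_liftTuple hP φ fun t x => hf t (e t x)).symm
    · refine ElemMap.ext (funext fun s => funext fun a => ?_)
      exact (hf (P.eqSorts.base s) a).base_inv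

/-- An elementary map is determined by its reduct, since it is contained in the correspondence
induced by the reduct. -/
theorem faithful_forgetEq : P.forgetEq.Faithful where
  map_injective {M N δ δ'} h := by
    refine ElemMap.ext (funext fun S => funext fun z => ?_)
    obtain ⟨w, hw⟩ := (transfers hP S).exists_lift (P.forgetEq.map δ : ReductMap M N) z
    exact (Lift.eq_of_map δ hw).symm.trans (Lift.eq_of_map δ' (h ▸ hw))

end Theory

end ContLogic

theorem mainTheorem11 (P : ContLogic.Theory.{u}) (hP : P.IsMetric) :
    P.forgetEq.IsEquivalence := by
  have := ContLogic.Theory.faithful_forgetEq hP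
  have := ContLogic.Theory.full_forgetEq hP
  have := ContLogic.Theory.essSurj_forgetEq P
  exact {}
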